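/- Let $d\in\mathbb N$, let $G=G(x,v)$ be a smooth vector field $\mathbb R^d\times\mathbb R^d\to\mathbb R^d$, and let $M=M(x,v)\ge 0$ be measurable with $\int_{\mathbb R^d} M(x,v)\,dv=1$ for every $x\in\mathbb R^d$. Write $\langle g\rangle(x)=\int_{\mathbb R^d} g(x,v)\,dv$. Consider $$\partial_t f = Af := -v\cdot\nabla_x f-\nabla_v\cdot(Gf)+Lf,$$ where either $Lf=\nabla_v\cdot\big(M\nabla_v(f/M)\big)$ (Fokker–Planck case; here $M>0$ and $M$ is $C^2$) or $Lf=\langle f\rangle M-f$ (BGK case). (H1) There is a positive $C^1$ function $f_\infty=f_\infty(x,v)$ ($C^2$ in the Fokker–Planck case), with $\langle f_\infty\rangle$ of class $C^1$, such that $v\cdot\nabla_x f_\infty+\nabla_v\cdot(Gf_\infty)=Lf_\infty$, $\int f_\infty\,dx\,dv=1$, and $f_\infty(x,v)\ge c_\infty\langle f_\infty\rangle(x)$ for all $x$ and $|v|\le 1$, with $c_\infty>0$; moreover, for a constant $c_M$, $\sup_x\sup_{|v|\le1}|\nabla_vM|/M\le c_M$ in the Fokker–Planck case, and $\sup_x\int_{|v|\le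 1}M^2\frac{\langle f_\infty\rangle}{f_\infty}\,dv\le c_M$ in the BGK case. (H2) There is $\lambda_1>0$ such that for every $x\in\mathbb R^d$ and every $g\in C_c^\infty(\mathbb R^d)$, with $\langle g\rangle=\int g\,dv$, the quantity $\int\big|g-\langle g\rangle\frac{f_\infty}{\langle f_\infty\rangle}\big|^2\frac{dv}{f_\infty}$ is at most $\lambda_1\int\big|\nabla_v\big(\frac g{f_\infty}\big)\big|^2f_\infty\,dv$ in the Fokker–Planck case, and at most $\frac{\lambda_1}2\iint\Big(\frac{g(v)}{f_\infty(x,v)}-\frac{g(v_*)}{f_\infty(x,v_*)}\Big)^2f_\infty(x,v)M(x,v_*)\,dv\,dv_*$ in the BGK case. (H3) Let $$w(x)=1+\frac{\int_{|v|\le1}f_\infty|G|^2\,dv}{\langle f_\infty\rangle}+\Big(\int_{|v|\le1}\Big|\nabla_x\Big(\frac{f_\infty}{\langle f_\infty\rangle}\Big)\Big|\,dv\Big)^2+\Big|\frac{\nabla_x\langle f_\infty\rangle}{\langle f_\infty\rangle}\Big|^2.$$ There are $T>0$ and $\lambda_2$ such that for every $g=g(t,x)$ on $[0,T]\times\mathbb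 R^d$ with $\int g^2\,\frac{dt\,dx}{\langle f_\infty\rangle}<\infty$ and $\int g\,dt\,dx=0$ there is a weakly differentiable vector field $\vec F:[0,T]\times\mathbb R^d\to\mathbb R^{1+d}$ with $\nabla_{t,x}\cdot\vec F=g$, with $\vec F(0,\cdot)=\vec F(T,\cdot)=0$ (in the sense of traces), and $$\int_{[0,T]\times\mathbb R^d}\big[|\vec F|^2w+|\nabla_{t,x}\vec F|^2\big]\frac{dt\,dx}{\langle f_\infty\rangle}\le\lambda_2\int_{[0,T]\times\mathbb R^d}g^2\,\frac{dt\,dx}{\langle f_\infty\rangle}.$$ Let $\|g\|^2=\int|g|^2\,\frac{dx\,dv}{f_\infty}$ be the norm of $L^2(f_\infty^{-1})$. A solution with initial data $f_{\mathrm{in}}$ is a mild solution in this space: a continuous $f:[0,\infty)\to L^2(f_\infty^{-1})$ such that, for all $t\ge0$, $\int_0^tf(s)\,ds$ lies in the domain of $\bar A$ and $\bar A\int_0^tf(s)\,ds=f(t)-f_{\mathrm{in}}$, where $\bar A$ is the closure in $L^2(f_\infty^{-1})$ of $A$ restricted to the functions $g\in C_c^\infty(\mathbb R^{2d})$ with $Ag\in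 L^2(f_\infty^{-1})$. Then there are constants $\lambda,C>0$, depending only on $d$, on the choice between the two collision operators, and on $c_\infty,c_M,\lambda_1,\lambda_2,T$, such that every solution whose initial data satisfies $\int f_{\mathrm{in}}\,dx\,dv=0$ obeys $$\|f(t)\|\le Ce^{-\lambda t}\|f_{\mathrm{in}}\|\qquad\text{for all }t>0.$$ -/

import Mathlib

open MeasureTheory Set
open scoped ContDiff

noncomputable section

namespace Kinetic

/-- Position space and velocity space `ℝ^d`, with the Euclidean norm. -/
abbrev E (d : ℕ) : Type := EuclideanSpace ℝ (Fin d)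

variable {d : ℕ}

/-- The two collision operators. -/
inductive Collision
  | fokkerPlanck
  | bgk

/-- Smooth compactly supported real functions. -/
def IsTest {X : Type*} [NormedAddCommGroup X] [NormedSpace ℝ X] (φ : X → ℝ) : Prop :=
  ContDiff ℝ ∞ φ ∧ HasCompactSupport φ

/-- `∇_x f (x, v)`. -/
def gradX (f : E d × E d → ℝ) (z : E d × E d) : E d :=
  gradient (fun x => f (x, z.2)) z.1

/-- `∇_v f (x, v)`. -/
def gradV (f : E d × E d → ℝ) (z : E d × E d) : E d :=
  gradient (fun v => f (z.1, v)) z.2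

/-- `∇_v · H (x, v)` for a vector field `H`. -/
def divV (H : E d × E d → E d) (z : E d × E d) : ℝ :=
  ∑ i, fderiv ℝ (fun v => H (z.1, v) i) z.2 (EuclideanSpace.single i 1)

/-- The spatial density `⟨f⟩(x) = ∫ f(x, v) dv`. -/
def density (f : E d × E d → ℝ) (x : E d) : ℝ := ∫ v, f (x, v)

/-- The collision operator: `∇_v · (M ∇_v (f / M))` or `⟨f⟩ M - f`. -/
def collisionOp (L : Collision) (M f : E d × E d → ℝ) : E d × E d → ℝ :=
  match L with
  | .fokkerPlanck => divV (fun z => M z • gradV (fun y => f y / M y) z)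
  | .bgk => fun z => density f z.1 * M z - f z

/-- The transport part `v · ∇_x f + ∇_v · (G f)`. -/
def transportOp (G : E d × E d → E d) (f : E d × E d → ℝ) (z : E d × E d) : ℝ :=
  inner ℝ z.2 (gradX f z) + divV (fun y => f y • G y) z

/-- The evolution operator `A f = - v · ∇_x f - ∇_v · (G f) + L f`. -/
def evolutionOp (L : Collision) (G : E d × E d → E d) (M f : E d × E d → ℝ)
    (z : E d × E d) : ℝ :=
  -transportOp G f z + collisionOp L M f z

/-- `M` is a background: `M(x, ·)` is a probability density for every `x`; it is positive and
twice continuously differentiable when the Fokker-Planck operator is formed with it. -/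
structure IsBackground (L : Collision) (M : E d × E d → ℝ) : Prop where
  measurable : Measurable M
  nonneg : ∀ z, 0 ≤ M z
  integral_eq_one : ∀ x, ∫ v, M (x, v) = 1
  regular_fp : L = .fokkerPlanck → ContDiff ℝ 2 M ∧ ∀ z, 0 < M z

/-- `fInf` is a normalised stationary state, with the lower bound `cInf` for `fInf / ⟨fInf⟩` on
`|v| ≤ 1` and the bound `cM` for the quantity controlling `M` on `|v| ≤ 1`. -/
structure IsStationaryState (L : Collision) (G : E d × E d → E d) (M fInf : E d × E d → ℝ)
    (cInf cM : ℝ) : Prop where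
  pos : ∀ z, 0 < fInf z
  contDiff : ContDiff ℝ 1 fInf
  contDiff_fp : L = .fokkerPlanck → ContDiff ℝ 2 fInf
  contDiff_density : ContDiff ℝ 1 (density fInf)
  stationary : ∀ z, transportOp G fInf z = collisionOp L M fInf z
  integral_eq_one : ∫ z, fInf z = 1
  lower_bound : ∀ x v : E d, ‖v‖ ≤ 1 → cInf ≤ fInf (x, v) / density fInf x
  bound_fp : L = .fokkerPlanck → ∀ x v : E d, ‖v‖ ≤ 1 → ‖gradV M (x, v)‖ / M (x, v) ≤ cM
  bound_bgk : L = .bgk → ∀ x : E d,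
    ∫⁻ v in Metric.closedBall (0 : E d) 1,
      ENNReal.ofReal (M (x, v) ^ 2 * (density fInf x / fInf (x, v))) ≤ ENNReal.ofReal cM

/-- The right-hand side (without `lam1`) of the local coercivity inequality at the point `x`. -/
def velocityDissipation (L : Collision) (M fInf : E d × E d → ℝ) (x : E d) (g : E d → ℝ) : ℝ :=
  match L with
  | .fokkerPlanck => ∫ v, ‖gradient (fun u => g u / fInf (x, u)) v‖ ^ 2 * fInf (x, v)
  | .bgk => 1 / 2 * ∫ p : E d × E d,
      (g p.1 / fInf (x, p.1) - g p.2 / fInf (x, p.2)) ^ 2 * (fInf (x, p.1) * M (x, p.2))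

/-- Local coercivity in velocity with constant `lam1`. -/
def LocalCoercivity (L : Collision) (M fInf : E d × E d → ℝ) (lam1 : ℝ) : Prop :=
  ∀ (x : E d) (g : E d → ℝ), IsTest g →
    ∫ v, (g v - (∫ u, g u) * (fInf (x, v) / density fInf x)) ^ 2 / fInf (x, v)
      ≤ lam1 * velocityDissipation L M fInf x g

/-- The weight `w(x)`. -/
def weight (G : E d × E d → E d) (fInf : E d × E d → ℝ) (x : E d) : ℝ :=
  1 + (∫ v in Metric.closedBall (0 : E d) 1, fInf (x, v) * ‖G (x, v)‖ ^ 2) / density fInf x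
    + (∫ v in Metric.closedBall (0 : E d) 1,
        ‖gradX (fun z => fInf z / density fInf z.1) (x, v)‖) ^ 2
    + ‖(density fInf x)⁻¹ • gradient (density fInf) x‖ ^ 2

/-- The space-time slab `[0, T] × ℝ^d`. -/
def slab (d : ℕ) (T : ℝ) : Set (ℝ × E d) := Icc 0 T ×ˢ univ

/-- The coordinate directions of `ℝ × ℝ^d`, time being number `0`. -/
def stDir (i : Fin (d + 1)) : ℝ × E d :=
  Fin.cases (1, 0) (fun j => (0, EuclideanSpace.single j 1)) i

/-- `D` is the weak derivative of `F` in direction `e` in the slab, and `F` vanishes at the times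
`0` and `T` in the sense of traces if `e` is the time direction: since the test functions need not
vanish at `t = 0` and `t = T`, the absence of boundary terms encodes the boundary condition. -/
def HasWeakDerivZeroBoundary (T : ℝ) (F D : ℝ × E d → ℝ) (e : ℝ × E d) : Prop :=
  LocallyIntegrableOn F (slab d T) ∧ LocallyIntegrableOn D (slab d T) ∧
  ∀ φ : ℝ × E d → ℝ, IsTest φ →
    ∫ p in slab d T, F p * fderiv ℝ φ p e = -∫ p in slab d T, D p * φ p

/-- Spatial coercivity over the time `T` with constant `lam2`: every `g` of zero average in
`L²(dt dx / ⟨fInf⟩)` is the space-time divergence of a field `F = (F_0, …, F_d)` vanishing at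
`t = 0` and `t = T` and satisfying the weighted bound; here `D i j = ∂_j F_i`. -/
def SpatialCoercivity (G : E d × E d → E d) (fInf : E d × E d → ℝ) (T lam2 : ℝ) : Prop :=
  ∀ g : ℝ × E d → ℝ, Measurable g →
    ∫⁻ p in slab d T, ENNReal.ofReal (g p ^ 2 / density fInf p.2) < ⊤ →
    ∫ p in slab d T, g p = 0 →
    ∃ (F : Fin (d + 1) → ℝ × E d → ℝ) (D : Fin (d + 1) → Fin (d + 1) → ℝ × E d → ℝ),
      (∀ i j, HasWeakDerivZeroBoundary T (F i) (D i j) (stDir j)) ∧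
      (∀ᵐ p ∂(volume.restrict (slab d T)), ∑ i, D i i p = g p) ∧
      ∫⁻ p in slab d T, ENNReal.ofReal
          (((∑ i, F i p ^ 2) * weight G fInf p.2 + ∑ i, ∑ j, D i j p ^ 2) / density fInf p.2)
        ≤ ENNReal.ofReal lam2 *
          ∫⁻ p in slab d T, ENNReal.ofReal (g p ^ 2 / density fInf p.2)

/-- The measure `dx dv / fInf`. -/
def weightedMeasure (fInf : E d × E d → ℝ) : Measure (E d × E d) :=
  volume.withDensity (fun z => ENNReal.ofReal (1 / fInf z))

/-- The weighted space `L²(dx dv / fInf)`. -/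
abbrev WL2 (fInf : E d × E d → ℝ) : Type := Lp ℝ 2 (weightedMeasure fInf)

/-- The graph of `A` on the smooth compactly supported functions `g` with `g` and `A g` in the
weighted space. -/
def coreGraph (L : Collision) (G : E d × E d → E d) (M fInf : E d × E d → ℝ) :
    Set (WL2 fInf × WL2 fInf) :=
  {p | ∃ g : E d × E d → ℝ, IsTest g ∧ p.1 =ᵐ[weightedMeasure fInf] g ∧
    p.2 =ᵐ[weightedMeasure fInf] evolutionOp L G M g}

/-- Mild (semigroup) solutions of `∂_t f = A f`, `f(0) = fIn`, in the weighted space, where `A` is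
the closed operator having the smooth compactly supported functions as a core: `f` is continuous
on `[0, ∞)`, `∫_0^t f ds` lies in the domain and `A (∫_0^t f ds) = f(t) - fIn`. -/
structure IsSolution (L : Collision) (G : E d × E d → E d) (M fInf : E d × E d → ℝ)
    (fIn : WL2 fInf) (f : ℝ → WL2 fInf) : Prop where
  continuousOn : ContinuousOn f (Ici 0)
  initial : f 0 = fIn
  mild : ∀ t, 0 ≤ t → (∫ s in (0 : ℝ)..t, f s, f t - fIn) ∈ closure (coreGraph L G M fInf)

end Kinetic

end

/-! The derivative of ‖f‖² is 2⟨f, Af⟩, and this dissipation only sees the velocity variable. Let Π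
be the orthogonal projection of L²(1/f∞) onto the local equilibria r(x) f∞ (`proj`), and write T for
the transport operator. With h = g/f∞, transport is skew up to the defect ½ h² Tf∞. Stationarity,
Tf∞ = Lf∞, turns this defect into a collision term, and what remains is exactly the dissipation of
(H2) (`collision_energy`, `integral_evolutionOp_energy`). Hence ‖f − Πf‖² ≤ −λ₁⟨f, Af⟩ (`coercive`),
which says nothing about Πf at a fixed time.

Control of Πf comes from averaging over the time interval of (H3). The density ρ = ⟨f⟩ has zero
average on the slab, so ρ is the space-time divergence of a field F vanishing at both end times.
Choose functions β_j(x, v), supported in |v| ≤ 1, with ∫ f∞ v_i β_j dv = δ_ij, where v_0 = 1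
(`exists_isDualFamily`); they come from inverting the moment matrix of f∞/⟨f∞⟩, which is coercive by
the lower bound c∞. Test the equation with Y = ∑ F_j β_j. No boundary terms arise, so f is
annihilated by (∂_t + A*)Y (`inner_spaceField_eq`, `inner_timeField_eq`). Pairing (∂_t + A*)Y with
Πf instead gives ∫ (div F) ρ/⟨f∞⟩ = ∫ ρ²/⟨f∞⟩, the squared space-time norm of Πf
(`inner_field_proj`): the β_j are dual to the moments, and ∫ f∞ A*β_j dv = 0 because f∞ is
stationary and its moments against v_i β_j are constant in x. Subtracting, this squared norm equals
minus the pairing of (∂_t + A*)Y with f − Πf. The weight w is what makes the dual norm of (∂_t +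
A*)Y at most a constant times the norm of Πf (`memLp_field_of_abs_le`). Thus ∫‖Πf‖² ≤ K ∫‖f − Πf‖²
over the time interval (`exists_averaged_bound`).

Together the two estimates give T‖f(T)‖² ≤ c(‖f(0)‖² − ‖f(T)‖²), with T now the length of the
interval: a fixed contraction factor per period, hence exponential decay (`exists_classical_decay`).

Two approximations make this rigorous. The field F is only weakly differentiable and the domain of A
is a closure of test functions, so the identities are proved for products θ(t)u, and curves are
replaced by Bernstein polynomials in time; `exists_macroscopic_bound` keeps track of the residual,
which vanishes in the limit. Mild solutions need not be differentiable, but their averages over [t,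
t + ε] are C¹ with values in the domain (`IsSolution.isClassicalSolution`), and the constants do not
depend on ε. -/

noncomputable section

/-! ### Calculus in position and velocity; velocity averages of velocity-bounded functions. -/

namespace Kinetic

variable {d : ℕ}

/-- The partial derivative in the `i`-th position coordinate. -/
def dX (i : Fin d) (f : E d × E d → ℝ) (z : E d × E d) : ℝ :=
  fderiv ℝ f z (EuclideanSpace.single i 1, 0)

/-- The partial derivative in the `i`-th velocity coordinate. -/
def dV (i : Fin d) (f : E d × E d → ℝ) (z : E d × E d) : ℝ :=
  fderiv ℝ f z (0, EuclideanSpace.single i 1)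

/-- `f` vanishes for velocities of norm larger than `R`. -/
def VelocityBounded (R : ℝ) (f : E d × E d → ℝ) : Prop :=
  ∀ z : E d × E d, R < ‖z.2‖ → f z = 0

/-- Integration by parts against the constant 1. Boundary terms, both in velocity alone and in phase
space, disappear through this fact. -/
theorem integral_fderiv_eq_zero {X : Type*} [NormedAddCommGroup X] [NormedSpace ℝ X]
    [FiniteDimensional ℝ X] [MeasurableSpace X] [BorelSpace X] (μ : Measure X)
    [μ.IsAddHaarMeasure] {f : X → ℝ} (hf : ContDiff ℝ 1 f) (hc : HasCompactSupport f) (e : X) :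
    ∫ z, fderiv ℝ f z e ∂μ = 0 := by
  have hc' : HasCompactSupport fun z => fderiv ℝ f z e := hc.fderiv_apply ℝ e
  have hcont : Continuous fun z => fderiv ℝ f z e :=
    (hf.continuous_fderiv (by norm_num)).clm_apply continuous_const
  have h := integral_mul_fderiv_eq_neg_fderiv_mul_of_integrable (μ := μ) (f := fun _ : X => (1 : ℝ))
    (g := f) (v := e) (by simp) (by simpa using hcont.integrable_of_hasCompactSupport hc')
    (by simpa using hf.continuous.integrable_of_hasCompactSupport hc)
    (by simp) (fun x _ => hf.differentiable (by norm_num) x)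
  simpa using h

section Slices

variable {f g : E d × E d → ℝ}

theorem continuous_dX (hf : ContDiff ℝ 1 f) (i : Fin d) : Continuous (dX i f) :=
  (hf.continuous_fderiv (by norm_num)).clm_apply continuous_const

theorem continuous_dV (hf : ContDiff ℝ 1 f) (i : Fin d) : Continuous (dV i f) :=
  (hf.continuous_fderiv (by norm_num)).clm_apply continuous_const

theorem contDiff_dV {m n : WithTop ℕ∞} (hf : ContDiff ℝ n f) (hmn : m + 1 ≤ n) (i : Fin d) :
    ContDiff ℝ m (dV i f) :=
  (hf.fderiv_right hmn).clm_apply contDiff_const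

theorem dX_mul {z : E d × E d} (hf : DifferentiableAt ℝ f z) (hg : DifferentiableAt ℝ g z)
    (i : Fin d) : dX i (fun y => f y * g y) z = f z * dX i g z + g z * dX i f z := by
  simp [dX, fderiv_fun_mul hf hg]

theorem dV_mul {z : E d × E d} (hf : DifferentiableAt ℝ f z) (hg : DifferentiableAt ℝ g z)
    (i : Fin d) : dV i (fun y => f y * g y) z = f z * dV i g z + g z * dV i f z := by
  simp [dV, fderiv_fun_mul hf hg]

theorem dX_velocity_eq_zero (i j : Fin d) (z : E d × E d) :
    dX i (fun y : E d × E d => y.2 j) z = 0 := by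
  have : (fun y : E d × E d => y.2 j) =
      ((EuclideanSpace.proj j : E d →L[ℝ] ℝ).comp (ContinuousLinearMap.snd ℝ (E d) (E d))) := rfl
  rw [dX, this, ContinuousLinearMap.fderiv]
  simp

theorem hasFDerivAt_sliceV {z : E d × E d} (hf : DifferentiableAt ℝ f z) :
    HasFDerivAt (fun v => f (z.1, v))
      ((fderiv ℝ f z).comp (ContinuousLinearMap.inr ℝ (E d) (E d))) z.2 := by
  exact (hf.hasFDerivAt (x := (z.1, z.2))).comp z.2 (hasFDerivAt_prodMk_right z.1 z.2)

theorem hasFDerivAt_sliceX {z : E d × E d} (hf : DifferentiableAt ℝ f z) :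
    HasFDerivAt (fun x => f (x, z.2))
      ((fderiv ℝ f z).comp (ContinuousLinearMap.inl ℝ (E d) (E d))) z.1 := by
  exact (hf.hasFDerivAt (x := (z.1, z.2))).comp z.1 (hasFDerivAt_prodMk_left z.1 z.2)

theorem fderiv_sliceV {z : E d × E d} (hf : DifferentiableAt ℝ f z) (i : Fin d) :
    fderiv ℝ (fun v => f (z.1, v)) z.2 (EuclideanSpace.single i 1) = dV i f z := by
  rw [(hasFDerivAt_sliceV hf).fderiv]; simp [dV]

theorem gradient_apply {φ : E d → ℝ} (x : E d) (i : Fin d) :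
    gradient φ x i = fderiv ℝ φ x (EuclideanSpace.single i 1) := by
  have h := InnerProductSpace.toDual_symm_apply (𝕜 := ℝ) (x := EuclideanSpace.single i (1 : ℝ))
    (y := fderiv ℝ φ x)
  rw [← h, EuclideanSpace.inner_single_right]
  simp [gradient]

theorem gradV_apply {z : E d × E d} (hf : DifferentiableAt ℝ f z) (i : Fin d) :
    gradV f z i = dV i f z := by
  rw [gradV, gradient_apply, fderiv_sliceV hf]

theorem gradX_apply {z : E d × E d} (hf : DifferentiableAt ℝ f z) (i : Fin d) :
    gradX f z i = dX i f z := by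
  rw [gradX, gradient_apply, (hasFDerivAt_sliceX hf).fderiv]; simp [dX]

theorem divV_eq {H : E d × E d → E d} {z : E d × E d}
    (hH : ∀ i, DifferentiableAt ℝ (fun y => H y i) z) :
    divV H z = ∑ i, dV i (fun y => H y i) z :=
  Finset.sum_congr rfl fun i _ => fderiv_sliceV (hH i) i

theorem inner_gradX_eq {z : E d × E d} (hf : DifferentiableAt ℝ f z) (w : E d) :
    inner ℝ w (gradX f z) = ∑ i, w i * dX i f z := by
  rw [PiLp.inner_apply]
  refine Finset.sum_congr rfl fun i _ => ?_
  rw [gradX_apply hf]; simp [mul_comm]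

theorem transportOp_eq {G : E d × E d → E d} (hG : ContDiff ℝ ∞ G) {z : E d × E d}
    (hf : DifferentiableAt ℝ f z) :
    transportOp G f z =
      ∑ i, z.2 i * dX i f z + ∑ i, dV i (fun y => f y * G y i) z := by
  rw [transportOp, inner_gradX_eq hf, divV_eq]
  · rfl
  · intro i
    have : DifferentiableAt ℝ (fun y => G y i) z :=
      ((contDiff_piLp 2).1 hG i).differentiable (by simp) z
    exact hf.mul this

theorem collisionOp_fp_eq {M : E d × E d → ℝ} (hM : ContDiff ℝ 2 M) (hM0 : ∀ z, 0 < M z)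
    (hf : ContDiff ℝ 2 f) (z : E d × E d) :
    collisionOp .fokkerPlanck M f z =
      ∑ i, dV i (fun y => M y * dV i (fun x => f x / M x) y) z := by
  have hq : ContDiff ℝ 2 (fun x => f x / M x) := hf.div hM fun x => (hM0 x).ne'
  have hEq : ∀ i, (fun y => (M y • gradV (fun y => f y / M y) y) i) =
      fun y => M y * dV i (fun x => f x / M x) y := fun i => by
    funext y
    simp [gradV_apply (hq.differentiable (by norm_num) y)]
  have h1 : ∀ i, ContDiff ℝ 1 fun y => M y * dV i (fun x => f x / M x) y := fun i =>
    (hM.of_le (by norm_num)).mul (contDiff_dV hq (by norm_num) i)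
  rw [collisionOp, divV_eq]
  · exact Finset.sum_congr rfl fun i _ => by rw [hEq]
  · intro i; rw [hEq]; exact (h1 i).differentiable (by norm_num) z

theorem VelocityBounded.fderiv_eq_zero {R : ℝ} (hR : VelocityBounded R f) {z : E d × E d}
    (hz : R < ‖z.2‖) : fderiv ℝ f z = 0 := by
  have : f =ᶠ[nhds z] fun _ => 0 := by
    have ho : IsOpen {y : E d × E d | R < ‖y.2‖} := isOpen_lt continuous_const (by fun_prop)
    filter_upwards [ho.mem_nhds hz] with y hy using hR y hy
  rw [this.fderiv_eq]; simp

theorem VelocityBounded.dV {R : ℝ} (hR : VelocityBounded R f) (i : Fin d) :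
    VelocityBounded R (dV i f) := fun z hz => by simp [Kinetic.dV, hR.fderiv_eq_zero hz]

theorem VelocityBounded.dX {R : ℝ} (hR : VelocityBounded R f) (i : Fin d) :
    VelocityBounded R (dX i f) := fun z hz => by simp [Kinetic.dX, hR.fderiv_eq_zero hz]

theorem VelocityBounded.mul_right {R : ℝ} (hR : VelocityBounded R f) (g : E d × E d → ℝ) :
    VelocityBounded R (fun z => g z * f z) := fun z hz => by simp [hR z hz]

theorem VelocityBounded.mul_left {R : ℝ} (hR : VelocityBounded R f) (g : E d × E d → ℝ) :
    VelocityBounded R (fun z => f z * g z) := fun z hz => by simp [hR z hz]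

theorem VelocityBounded.hasCompactSupport {R : ℝ} (hR : VelocityBounded R f) (x : E d) :
    HasCompactSupport fun v => f (x, v) :=
  HasCompactSupport.intro (isCompact_closedBall (0 : E d) R) fun v hv => hR (x, v) (by simpa using hv)

theorem VelocityBounded.integrable {R : ℝ} (hR : VelocityBounded R f) (hf : Continuous f)
    (x : E d) : Integrable fun v => f (x, v) :=
  (hf.comp (by fun_prop : Continuous fun v : E d => (x, v))).integrable_of_hasCompactSupport
    (hR.hasCompactSupport x)

theorem exists_velocityBounded (hf : HasCompactSupport f) : ∃ R, VelocityBounded R f := by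
  obtain ⟨R, hR⟩ := hf.isCompact.isBounded.subset_closedBall (0 : E d × E d)
  refine ⟨R, fun z hz => ?_⟩
  by_contra h
  have := hR (subset_tsupport f h)
  rw [mem_closedBall_zero_iff] at this
  exact absurd ((norm_snd_le z).trans this) (not_le.2 hz)

/-- Integration of a velocity derivative. -/
theorem integral_dV_eq_zero {R : ℝ} (hf : ContDiff ℝ 1 f) (hR : VelocityBounded R f) (i : Fin d)
    (x : E d) : ∫ v, dV i f (x, v) = 0 := by
  have h := integral_fderiv_eq_zero volume (f := fun v => f (x, v))
    (hf.comp (by fun_prop : ContDiff ℝ 1 fun v : E d => (x, v)))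
    (hR.hasCompactSupport x) (EuclideanSpace.single i 1)
  rw [← h]
  refine integral_congr_ae (.of_forall fun v => ?_)
  exact (fderiv_sliceV (z := (x, v)) (hf.differentiable (by norm_num) _) i).symm

/-- Differentiation of a velocity average. -/
theorem hasFDerivAt_density {R : ℝ} (hf : ContDiff ℝ 1 f) (hR : VelocityBounded R f) (x : E d) :
    HasFDerivAt (density f)
      (∫ v, (fderiv ℝ f (x, v)).comp (ContinuousLinearMap.inl ℝ (E d) (E d))) x := by
  have hcf : Continuous fun z => (fderiv ℝ f z).comp (ContinuousLinearMap.inl ℝ (E d) (E d)) :=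
    (hf.continuous_fderiv (by norm_num)).clm_comp continuous_const
  -- Bounded velocity support leaves a supremum over a compact product; it dominates the derivative
  -- for all positions within distance 1 of x.
  obtain ⟨C, hC⟩ := ((isCompact_closedBall x 1).prod (isCompact_closedBall (0 : E d) R)).exists_bound_of_continuousOn
    hcf.continuousOn
  refine hasFDerivAt_integral_of_dominated_of_fderiv_le (F := fun x v => f (x, v))
    (F' := fun x v => (fderiv ℝ f (x, v)).comp (ContinuousLinearMap.inl ℝ (E d) (E d)))
    (bound := (Metric.closedBall (0 : E d) R).indicator fun _ => C)
    (Metric.closedBall_mem_nhds x one_pos)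
    (.of_forall fun y => (hf.continuous.comp (by fun_prop)).aestronglyMeasurable)
    (hR.integrable hf.continuous x)
    (hcf.comp (by fun_prop : Continuous fun v : E d => (x, v))).aestronglyMeasurable
    (.of_forall fun v y hy => ?_) ?_ (.of_forall fun v y _ => ?_)
  · by_cases hv : v ∈ Metric.closedBall (0 : E d) R
    · simpa [hv] using hC (y, v) ⟨hy, hv⟩
    · rw [indicator_of_notMem hv, hR.fderiv_eq_zero (z := (y, v)) (by simpa using hv)]
      simp
  · exact (integrable_indicator_iff measurableSet_closedBall).2
      (integrableOn_const (isCompact_closedBall (0 : E d) R).measure_ne_top)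
  · exact hasFDerivAt_sliceX (z := (y, v)) (hf.differentiable (by norm_num) _)

theorem fderiv_density_apply {R : ℝ} (hf : ContDiff ℝ 1 f) (hR : VelocityBounded R f) (x : E d)
    (i : Fin d) :
    fderiv ℝ (density f) x (EuclideanSpace.single i 1) = ∫ v, dX i f (x, v) := by
  have hcf : Continuous fun v =>
      (fderiv ℝ f (x, v)).comp (ContinuousLinearMap.inl ℝ (E d) (E d)) :=
    ((hf.continuous_fderiv (by norm_num)).comp (by fun_prop)).clm_comp continuous_const
  have hint : Integrable fun v =>
      (fderiv ℝ f (x, v)).comp (ContinuousLinearMap.inl ℝ (E d) (E d)) :=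
    hcf.integrable_of_hasCompactSupport
      (HasCompactSupport.intro (isCompact_closedBall (0 : E d) R) fun v hv => by
        rw [hR.fderiv_eq_zero (z := (x, v)) (by simpa using hv)]; simp)
  rw [(hasFDerivAt_density hf hR x).fderiv, ContinuousLinearMap.integral_apply hint]
  simp [dX]

theorem continuous_density {R : ℝ} (hf : Continuous f) (hR : VelocityBounded R f) :
    Continuous (density f) := by
  have h := continuous_parametric_integral_of_continuous (μ := (volume : Measure (E d)))
    (f := fun x v => f (x, v)) hf (isCompact_closedBall (0 : E d) R)
  convert h using 2 with x
  refine (setIntegral_eq_integral_of_forall_compl_eq_zero fun v hv => hR (x, v) ?_).symm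
  simpa using hv

theorem contDiff_density {R : ℝ} (hf : ContDiff ℝ 1 f) (hR : VelocityBounded R f) :
    ContDiff ℝ 1 (density f) := by
  rw [contDiff_one_iff_fderiv]
  refine ⟨fun x => (hasFDerivAt_density hf hR x).differentiableAt, ?_⟩
  have hcf : Continuous fun z => (fderiv ℝ f z).comp (ContinuousLinearMap.inl ℝ (E d) (E d)) :=
    (hf.continuous_fderiv (by norm_num)).clm_comp continuous_const
  have h := continuous_parametric_integral_of_continuous (μ := (volume : Measure (E d)))
    (f := fun x v => (fderiv ℝ f (x, v)).comp (ContinuousLinearMap.inl ℝ (E d) (E d))) hcf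
    (isCompact_closedBall (0 : E d) R)
  refine h.congr fun x => ?_
  rw [(hasFDerivAt_density hf hR x).fderiv]
  refine (setIntegral_eq_integral_of_forall_compl_eq_zero fun v hv => ?_)
  rw [hR.fderiv_eq_zero (z := (x, v)) (by simpa using hv)]; simp

end Slices

end Kinetic

end

/-! ### Mollification, and weak derivatives tested with C¹ functions. -/

noncomputable section

namespace Kinetic

variable {d : ℕ}

open scoped Convolution Topology in
/-- Mollification of a compactly supported `C¹` function. -/
theorem exists_isTest_approx {X : Type*} [NormedAddCommGroup X] [NormedSpace ℝ X]
    [FiniteDimensional ℝ X] [MeasurableSpace X] [BorelSpace X] (μ : Measure X)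
    [μ.IsAddHaarMeasure] {φ : X → ℝ} (hφ : ContDiff ℝ 1 φ) (hc : HasCompactSupport φ) (e : X) :
    ∃ (ψ : ℕ → X → ℝ) (K : Set X) (C : ℝ), IsCompact K ∧ (∀ n, IsTest (ψ n)) ∧
      (∀ n x, x ∉ K → ψ n x = 0 ∧ fderiv ℝ (ψ n) x e = 0) ∧
      (∀ n x, |ψ n x| ≤ C ∧ |fderiv ℝ (ψ n) x e| ≤ C) ∧
      (∀ x, Filter.Tendsto (fun n => ψ n x) Filter.atTop (𝓝 (φ x))) ∧
      ∀ x, Filter.Tendsto (fun n => fderiv ℝ (ψ n) x e) Filter.atTop (𝓝 (fderiv ℝ φ x e)) := by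
  have : ProperSpace X := FiniteDimensional.proper ℝ X
  -- The outer radii tend to 0 and never exceed 1, so all mollifications live in one compact
  -- thickening of the support.
  let η : ℕ → ContDiffBump (0 : X) := fun n =>
    ⟨1 / (n + 2), 1 / (n + 1), by positivity, by gcongr; linarith⟩
  have hη1 : ∀ n, (η n).rOut ≤ 1 := fun n => by
    show 1 / ((n : ℝ) + 1) ≤ 1
    rw [div_le_one (by positivity)]; linarith [n.cast_nonneg (α := ℝ)]
  have hη0 : Filter.Tendsto (fun n => (η n).rOut) Filter.atTop (𝓝 0) :=
    tendsto_one_div_add_atTop_nhds_zero_nat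
  let L := ContinuousLinearMap.lsmul ℝ ℝ (E := ℝ)
  let conv : ℕ → (X → ℝ) → X → ℝ := fun n g => (η n).normed μ ⋆[L, μ] g
  -- properties of the mollification of a continuous function
  have hbd : ∀ (g : X → ℝ), Continuous g → ∀ C, (∀ x, |g x| ≤ C) → ∀ n x,
      |conv n g x| ≤ 3 * C := by
    intro g hg C hC n x
    -- The oscillation of g is at most 2C, so its mollification is within 2C of g(x); this explains
    -- the factor 3.
    have h := (η n).dist_normed_convolution_le (μ := μ) (x₀ := x) (ε := 2 * C)
      hg.aestronglyMeasurable fun y _ => by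
        rw [Real.dist_eq]; linarith [abs_sub (g y) (g x), hC y, hC x]
    rw [Real.dist_eq] at h
    have := abs_sub_abs_le_abs_sub (conv n g x) (g x)
    have h2 : |conv n g x - g x| ≤ 2 * C := h
    linarith [hC x]
  have hzero : ∀ (g : X → ℝ), Continuous g → (∀ x, x ∉ tsupport φ → g x = 0) → ∀ n x,
      x ∉ Metric.cthickening 1 (tsupport φ) → conv n g x = 0 := by
    intro g hg hg0 n x hx
    have hout : ∀ y, dist y x < 1 → g y = 0 := fun y hy => hg0 y fun hys =>
      hx (Metric.mem_cthickening_of_dist_le x y 1 _ hys (by rw [dist_comm]; exact hy.le))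
    have h := (η n).dist_normed_convolution_le (μ := μ) (x₀ := x) (ε := 0)
      hg.aestronglyMeasurable fun y hy => by
        rw [hout y (lt_of_lt_of_le (Metric.mem_ball.1 hy) (hη1 n)), hout x (by simp)]; simp
    have h2 : conv n g x = g x := dist_le_zero.1 h
    rw [h2, hout x (by simp)]
  have hlim : ∀ (g : X → ℝ), Continuous g → ∀ x,
      Filter.Tendsto (fun n => conv n g x) Filter.atTop (𝓝 (g x)) := fun g hg x =>
    ContDiffBump.convolution_tendsto_right_of_continuous hη0 hg x
  -- The derivative falls on φ: the derivative of the mollification is the mollification of the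
  -- continuous function ∂φ, so the three facts above apply to it as well.
  have hfd : ∀ n x, fderiv ℝ (conv n φ) x e = conv n (fun y => fderiv ℝ φ y e) x := by
    intro n x
    have hloc : LocallyIntegrable ((η n).normed μ) μ :=
      (η n).continuous_normed.locallyIntegrable
    rw [(hc.hasFDerivAt_convolution_right L hloc hφ x).fderiv]
    exact convolution_precompR_apply L hloc (hc.fderiv ℝ) (hφ.continuous_fderiv (by norm_num)) x e
  have hcφ := hφ.continuous
  have hcd : Continuous fun y => fderiv ℝ φ y e :=
    (hφ.continuous_fderiv (by norm_num)).clm_apply continuous_const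
  have hd0 : ∀ x, x ∉ tsupport φ → fderiv ℝ φ x e = 0 := fun x hx => by
    rw [fderiv_of_notMem_tsupport (𝕜 := ℝ) hx]; rfl
  obtain ⟨C₁, hC₁⟩ := hc.exists_bound_of_continuous hcφ
  obtain ⟨C₂, hC₂⟩ := (hc.fderiv_apply ℝ e).exists_bound_of_continuous hcd
  refine ⟨fun n => conv n φ, Metric.cthickening 1 (tsupport φ), 3 * max C₁ C₂,
    hc.isCompact.cthickening, fun n => ⟨?_, ?_⟩, fun n x hx => ⟨?_, ?_⟩, fun n x => ⟨?_, ?_⟩,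
    hlim φ hcφ, fun x => ?_⟩
  · exact (η n).hasCompactSupport_normed.contDiff_convolution_left L (η n).contDiff_normed
      hcφ.locallyIntegrable
  · exact (η n).hasCompactSupport_normed.convolution L hc
  · exact hzero φ hcφ (fun x hx => image_eq_zero_of_notMem_tsupport hx) n x hx
  · rw [hfd]; exact hzero _ hcd hd0 n x hx
  · exact hbd φ hcφ _ (fun x => (hC₁ x).trans (le_max_left _ _)) n x
  · rw [hfd]; exact hbd _ hcd _ (fun x => (hC₂ x).trans (le_max_right _ _)) n x
  · simp only [hfd]; exact hlim _ hcd x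

instance isAddHaarMeasure_volume_prod {X Y : Type*} [NormedAddCommGroup X]
    [InnerProductSpace ℝ X] [FiniteDimensional ℝ X] [MeasurableSpace X] [BorelSpace X]
    [NormedAddCommGroup Y] [InnerProductSpace ℝ Y] [FiniteDimensional ℝ Y] [MeasurableSpace Y]
    [BorelSpace Y] : (volume : Measure (X × Y)).IsAddHaarMeasure :=
  Measure.prod.instIsAddHaarMeasure volume volume

/-- The test functions needed later are built from velocity moments weighted by the β_j, which are
only known to be C¹. Mollification has a common compact support and a common bound, so dominated
convergence passes to the limit on both sides. -/
theorem HasWeakDerivZeroBoundary.integral_eq {T : ℝ} {F D : ℝ × E d → ℝ} {e : ℝ × E d}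
    (h : HasWeakDerivZeroBoundary T F D e) {φ : ℝ × E d → ℝ} (hφ : ContDiff ℝ 1 φ)
    (hc : HasCompactSupport φ) :
    ∫ p in slab d T, F p * fderiv ℝ φ p e = -∫ p in slab d T, D p * φ p := by
  obtain ⟨hF, hD, hw⟩ := h
  obtain ⟨ψ, K, C, hK, hψ, h0, hb, hl, hl'⟩ := exists_isTest_approx volume hφ hc e
  have hclosed : IsClosed (slab d T) := isClosed_Icc.prod isClosed_univ
  have key : ∀ (F : ℝ × E d → ℝ), LocallyIntegrableOn F (slab d T) →
      ∀ (a : ℕ → ℝ × E d → ℝ) (b : ℝ × E d → ℝ), (∀ n, Continuous (a n)) →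
      (∀ n x, x ∉ K → a n x = 0) → (∀ n x, |a n x| ≤ C) →
      (∀ x, Filter.Tendsto (fun n => a n x) Filter.atTop (nhds (b x))) →
      Filter.Tendsto (fun n => ∫ p in slab d T, F p * a n p) Filter.atTop
        (nhds (∫ p in slab d T, F p * b p)) := by
    intro F hF a b ha ha0 hab hal
    have hFm : AEStronglyMeasurable F (volume.restrict (slab d T)) := hF.aestronglyMeasurable
    refine tendsto_integral_of_dominated_convergence (K.indicator fun p => |F p| * C)
      (fun n => hFm.mul (ha n).aestronglyMeasurable) ?_ (fun n => .of_forall fun p => ?_)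
      (.of_forall fun p => (hal p).const_mul _)
    · rw [integrable_indicator_iff hK.measurableSet]
      have : IntegrableOn F (K ∩ slab d T) :=
        hF.integrableOn_compact_subset inter_subset_right (hK.inter_right hclosed)
      rw [IntegrableOn, Measure.restrict_restrict hK.measurableSet]
      exact this.abs.mul_const C
    · by_cases hp : p ∈ K
      · rw [indicator_of_mem hp, norm_mul]
        exact mul_le_mul_of_nonneg_left (hab n p) (norm_nonneg _)
      · rw [indicator_of_notMem hp, ha0 n p hp]; simp
  have h1 := key F hF (fun n p => fderiv ℝ (ψ n) p e) (fun p => fderiv ℝ φ p e)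
    (fun n => ((hψ n).1.continuous_fderiv (by simp)).clm_apply continuous_const)
    (fun n x hx => (h0 n x hx).2) (fun n x => (hb n x).2) hl'
  have h2 := key D hD ψ φ (fun n => (hψ n).1.continuous)
    (fun n x hx => (h0 n x hx).1) (fun n x => (hb n x).1) hl
  refine tendsto_nhds_unique h1 ?_
  simp only [fun n => hw (ψ n) (hψ n)]
  exact h2.neg

end Kinetic

end

/-! ### Linearity of the evolution operator, its formal adjoint and the local weak form. -/

noncomputable section

namespace Kinetic

variable {d : ℕ}

/-- The regularity needed to evaluate the evolution operator classically. -/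
structure Regular (L : Collision) (f : E d × E d → ℝ) : Prop where
  contDiff : ContDiff ℝ 1 f
  contDiff_fp : L = .fokkerPlanck → ContDiff ℝ 2 f
  integrable : ∀ x, Integrable fun v => f (x, v)

theorem IsTest.regular {g : E d × E d → ℝ} (hg : IsTest g) (L : Collision) : Regular L g := by
  obtain ⟨R, hR⟩ := exists_velocityBounded hg.2
  exact ⟨hg.1.of_le (by exact_mod_cast le_top), fun _ => hg.1.of_le (by norm_cast),
    hR.integrable hg.1.continuous⟩

theorem IsBackground.integrable {L : Collision} {M : E d × E d → ℝ} (hM : IsBackground L M)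
    (x : E d) : Integrable fun v => M (x, v) := by
  by_contra h
  have := hM.integral_eq_one x
  rw [integral_undef h] at this
  exact zero_ne_one this

section Linear

variable {f g : E d × E d → ℝ}

theorem dX_linear (a b : ℝ) {z : E d × E d} (hf : DifferentiableAt ℝ f z)
    (hg : DifferentiableAt ℝ g z) (i : Fin d) :
    dX i (fun y => a * f y + b * g y) z = a * dX i f z + b * dX i g z := by
  simp [dX, fderiv_fun_add (hf.const_mul a) (hg.const_mul b), fderiv_const_mul hf,
    fderiv_const_mul hg]

theorem dV_linear (a b : ℝ) {z : E d × E d} (hf : DifferentiableAt ℝ f z)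
    (hg : DifferentiableAt ℝ g z) (i : Fin d) :
    dV i (fun y => a * f y + b * g y) z = a * dV i f z + b * dV i g z := by
  simp [dV, fderiv_fun_add (hf.const_mul a) (hg.const_mul b), fderiv_const_mul hf,
    fderiv_const_mul hg]

theorem contDiff_coord {G : E d × E d → E d} {n : WithTop ℕ∞} (hG : ContDiff ℝ n G) (i : Fin d) :
    ContDiff ℝ n fun z => G z i := (contDiff_piLp 2).1 hG i

theorem transportOp_linear {G : E d × E d → E d} (hG : ContDiff ℝ ∞ G) (a b : ℝ)
    (hf : Differentiable ℝ f) (hg : Differentiable ℝ g) (z : E d × E d) :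
    transportOp G (fun y => a * f y + b * g y) z =
      a * transportOp G f z + b * transportOp G g z := by
  have hGd : ∀ i, DifferentiableAt ℝ (fun y => G y i) z := fun i =>
    (contDiff_coord hG i).differentiable (by simp) z
  have hfg : DifferentiableAt ℝ (fun y => a * f y + b * g y) z :=
    ((hf z).const_mul a).add ((hg z).const_mul b)
  rw [transportOp_eq hG hfg, transportOp_eq hG (hf z),
    transportOp_eq hG (hg z)]
  have h2 : ∀ i, dV i (fun y => (a * f y + b * g y) * G y i) z =
      a * dV i (fun y => f y * G y i) z + b * dV i (fun y => g y * G y i) z := fun i => by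
    have h1 : DifferentiableAt ℝ (fun y => f y * G y i) z := (hf z).mul (hGd i)
    have h2 : DifferentiableAt ℝ (fun y => g y * G y i) z := (hg z).mul (hGd i)
    rw [← dV_linear a b h1 h2]
    congr 1; funext y; ring
  simp only [dX_linear a b (hf z) (hg z), h2, mul_add, Finset.mul_sum, Finset.sum_add_distrib]
  have : ∀ i, z.2 i * (a * dX i f z) = a * (z.2 i * dX i f z) := fun i => by ring
  have h' : ∀ i, z.2 i * (b * dX i g z) = b * (z.2 i * dX i g z) := fun i => by ring
  simp only [this, h']; ring

theorem density_linear (a b : ℝ) {x : E d} (hf : Integrable fun v => f (x, v))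
    (hg : Integrable fun v => g (x, v)) :
    density (fun y => a * f y + b * g y) x = a * density f x + b * density g x := by
  rw [density, integral_add (hf.const_mul a) (hg.const_mul b), integral_const_mul,
    integral_const_mul]; rfl

theorem collisionOp_linear {L : Collision} {M : E d × E d → ℝ} (hM : IsBackground L M) (a b : ℝ)
    (hf : Regular L f) (hg : Regular L g) (z : E d × E d) :
    collisionOp L M (fun y => a * f y + b * g y) z =
      a * collisionOp L M f z + b * collisionOp L M g z := by
  cases L with
  | fokkerPlanck =>
    obtain ⟨hM2, hM0⟩ := hM.regular_fp rfl
    have h2f := hf.contDiff_fp rfl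
    have h2g := hg.contDiff_fp rfl
    have hqf : ContDiff ℝ 2 (fun x => f x / M x) := h2f.div hM2 fun x => (hM0 x).ne'
    have hqg : ContDiff ℝ 2 (fun x => g x / M x) := h2g.div hM2 fun x => (hM0 x).ne'
    have hd : ∀ {q : E d × E d → ℝ}, ContDiff ℝ 2 q → ∀ i,
        Differentiable ℝ fun y => M y * dV i q y := fun hq i =>
      ((hM2.of_le (by norm_num)).mul (contDiff_dV (m := 1) hq (by norm_num) i)).differentiable
        (by norm_num)
    rw [collisionOp_fp_eq hM2 hM0 h2f, collisionOp_fp_eq hM2 hM0 h2g, collisionOp_fp_eq hM2 hM0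
      ((contDiff_const.mul h2f).add (contDiff_const.mul h2g)), Finset.mul_sum, Finset.mul_sum,
      ← Finset.sum_add_distrib]
    refine Finset.sum_congr rfl fun i _ => ?_
    rw [← dV_linear a b (hd hqf i z) (hd hqg i z)]
    congr 1; funext y
    have : (fun x => (a * f x + b * g x) / M x) = fun x => a * (f x / M x) + b * (g x / M x) := by
      funext x; ring
    rw [this, dV_linear a b (hqf.differentiable (by norm_num) y)
      (hqg.differentiable (by norm_num) y)]
    ring
  | bgk =>
    simp only [collisionOp, density_linear a b (hf.integrable z.1) (hg.integrable z.1)]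
    ring

theorem evolutionOp_linear {L : Collision} {G : E d × E d → E d} (hG : ContDiff ℝ ∞ G)
    {M : E d × E d → ℝ} (hM : IsBackground L M) (a b : ℝ)
    (hf : Regular L f) (hg : Regular L g) (z : E d × E d) :
    evolutionOp L G M (fun y => a * f y + b * g y) z =
      a * evolutionOp L G M f z + b * evolutionOp L G M g z := by
  simp only [evolutionOp, collisionOp_linear hM a b hf hg,
    transportOp_linear hG a b (hf.contDiff.differentiable (by norm_num))
      (hg.contDiff.differentiable (by norm_num))]
  ring

theorem IsTest.linear {X : Type*} [NormedAddCommGroup X] [NormedSpace ℝ X] {f g : X → ℝ}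
    (hf : IsTest f) (hg : IsTest g) (a b : ℝ) : IsTest fun x => a * f x + b * g x :=
  ⟨(contDiff_const.mul hf.1).add (contDiff_const.mul hg.1),
    (hf.2.mul_left (f := fun _ => a)).add (hg.2.mul_left (f := fun _ => b))⟩

end Linear

/-- The graph of the evolution operator on test functions, as a subspace. -/
def coreSubmodule {L : Collision} {G : E d × E d → E d} (hG : ContDiff ℝ ∞ G)
    {M : E d × E d → ℝ} (hM : IsBackground L M) (fInf : E d × E d → ℝ) :
    Submodule ℝ (WL2 fInf × WL2 fInf) where
  carrier := coreGraph L G M fInf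
  add_mem' := by
    rintro p q ⟨g, hg, hp1, hp2⟩ ⟨k, hk, hq1, hq2⟩
    refine ⟨fun z => 1 * g z + 1 * k z, hg.linear hk 1 1, ?_, ?_⟩
    · filter_upwards [Lp.coeFn_add p.1 q.1, hp1, hq1] with z h h1 h2
      rw [Prod.fst_add, h]; simp [h1, h2]
    · filter_upwards [Lp.coeFn_add p.2 q.2, hp2, hq2] with z h h1 h2
      rw [Prod.snd_add, h, evolutionOp_linear hG hM 1 1 (hg.regular L) (hk.regular L)]
      simp [h1, h2]
  zero_mem' := by
    have h0 : IsTest (fun _ : E d × E d => (0 : ℝ)) := ⟨contDiff_const, HasCompactSupport.zero⟩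
    refine ⟨fun _ => 0, h0, Lp.coeFn_zero _ _ _, ?_⟩
    have h : evolutionOp L G M (fun _ => 0) = fun _ => 0 := by
      funext z
      have := evolutionOp_linear hG hM 0 0 (h0.regular L) (h0.regular L) z
      simpa using this
    rw [h]; exact Lp.coeFn_zero _ _ _
  smul_mem' := by
    rintro c p ⟨g, hg, hp1, hp2⟩
    refine ⟨fun z => c * g z + 0 * g z, hg.linear hg c 0, ?_, ?_⟩
    · filter_upwards [Lp.coeFn_smul c p.1, hp1] with z h h1
      rw [Prod.smul_fst, h]; simp [h1]
    · filter_upwards [Lp.coeFn_smul c p.2, hp2] with z h h1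
      rw [Prod.smul_snd, h, evolutionOp_linear hG hM c 0 (hg.regular L) (hg.regular L)]
      simp [h1]

/-- The formal adjoint of the collision operator. -/
def adjointCollisionOp (L : Collision) (M b : E d × E d → ℝ) (z : E d × E d) : ℝ :=
  match L with
  | .fokkerPlanck => (M z)⁻¹ * ∑ i, dV i (fun y => M y * dV i b y) z
  | .bgk => (∫ v, M (z.1, v) * b (z.1, v)) - b z

/-- The formal adjoint of the evolution operator. -/
def adjointOp (L : Collision) (G : E d × E d → E d) (M b : E d × E d → ℝ) (z : E d × E d) : ℝ :=
  ∑ i, z.2 i * dX i b z + ∑ i, G z i * dV i b z + adjointCollisionOp L M b z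

section Adjoint

variable {L : Collision} {G : E d × E d → E d} {M f b : E d × E d → ℝ} {R : ℝ}

theorem contDiff_velocity (i : Fin d) {n : WithTop ℕ∞} :
    ContDiff ℝ n fun z : E d × E d => z.2 i :=
  contDiff_coord contDiff_snd i

theorem VelocityBounded.exists_bound (hb : Continuous b) (hR : VelocityBounded R b) (x : E d) :
    ∃ C, ∀ v, ‖b (x, v)‖ ≤ C :=
  (hR.hasCompactSupport x).exists_bound_of_continuous
    (hb.comp (by fun_prop : Continuous fun v : E d => (x, v)))

theorem continuous_slice (hb : Continuous b) (x : E d) : Continuous fun v => b (x, v) :=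
  hb.comp (by fun_prop)

theorem IsBackground.integrable_mul (hM : IsBackground L M) (hb : Continuous b)
    (hR : VelocityBounded R b) (x : E d) : Integrable fun v => M (x, v) * b (x, v) := by
  obtain ⟨C, hC⟩ := hR.exists_bound hb x
  exact (hM.integrable x).mul_bdd (c := C) (continuous_slice hb x).aestronglyMeasurable (.of_forall hC)

/-- The Fokker-Planck operator is symmetric after dividing by M, up to a total velocity derivative;
for BGK one exchanges the roles of the two velocity integrals. Only b has bounded velocity support,
since f will also be f∞ itself. -/
theorem integral_collisionOp_mul (hM : IsBackground L M) (hf : Regular L f) (hb : ContDiff ℝ 1 b)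
    (hb2 : ∀ i, ContDiff ℝ 1 (dV i b)) (hR : VelocityBounded R b) (x : E d) :
    Integrable (fun v => collisionOp L M f (x, v) * b (x, v)) ∧
      Integrable (fun v => f (x, v) * adjointCollisionOp L M b (x, v)) ∧
      ∫ v, collisionOp L M f (x, v) * b (x, v) =
        ∫ v, f (x, v) * adjointCollisionOp L M b (x, v) := by
  cases L with
  | fokkerPlanck =>
    obtain ⟨hM2, hM0⟩ := hM.regular_fp rfl
    have h2f := hf.contDiff_fp rfl
    have hq : ContDiff ℝ 2 (fun x => f x / M x) := h2f.div hM2 fun x => (hM0 x).ne'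
    have hM1 : ContDiff ℝ 1 M := hM2.of_le (by norm_num)
    have hq1 : ContDiff ℝ 1 (fun x => f x / M x) := hq.of_le (by norm_num)
    have hqi : ∀ i, ContDiff ℝ 1 (dV i (fun x => f x / M x)) := fun i =>
      contDiff_dV hq (by norm_num) i
    have hA : ∀ i, ContDiff ℝ 1 fun y => M y * dV i (fun x => f x / M x) y := fun i =>
      hM1.mul (hqi i)
    have hB : ∀ i, ContDiff ℝ 1 fun y => M y * dV i b y := fun i => hM1.mul (hb2 i)
    have e1 : (fun v => collisionOp .fokkerPlanck M f (x, v) * b (x, v)) = fun v =>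
        (fun z => (∑ i, dV i (fun y => M y * dV i (fun x => f x / M x) y) z) * b z) (x, v) := by
      funext v; rw [collisionOp_fp_eq hM2 hM0 h2f]
    have e2 : (fun v => f (x, v) * adjointCollisionOp .fokkerPlanck M b (x, v)) = fun v =>
        (fun z => (f z / M z) * ∑ i, dV i (fun y => M y * dV i b y) z) (x, v) := by
      funext v; simp only [adjointCollisionOp]; ring
    have i1 : Integrable fun v => (fun z =>
        (∑ i, dV i (fun y => M y * dV i (fun x => f x / M x) y) z) * b z) (x, v) :=
      (hR.mul_right _).integrable
        ((continuous_finsetSum _ fun i _ => continuous_dV (hA i) i).mul hb.continuous) x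
    have i2 : Integrable fun v => (fun z =>
        (f z / M z) * ∑ i, dV i (fun y => M y * dV i b y) z) (x, v) := by
      refine VelocityBounded.integrable (R := R) (fun z hz => ?_)
        (hq.continuous.mul (continuous_finsetSum _ fun i _ => continuous_dV (hB i) i)) x
      have : ∀ i, dV i (fun y => M y * dV i b y) z = 0 := fun i =>
        ((hR.dV i).mul_right M).dV i z hz
      simp [this]
    refine ⟨e1 ▸ i1, e2 ▸ i2, ?_⟩
    rw [e1, e2, ← sub_eq_zero, ← integral_sub i1 i2]
    -- The flux b M ∂_i(f/M) − (f/M) M ∂_i b: in its derivative the two products of first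
    -- derivatives cancel, leaving the difference of the two integrands.
    have hΨ : ∀ i, ContDiff ℝ 1 fun y =>
        b y * (M y * dV i (fun x => f x / M x) y) + (-1) * ((f y / M y) * (M y * dV i b y)) :=
      fun i => (hb.mul (hA i)).add (contDiff_const.mul (hq1.mul (hB i)))
    have hΨR : ∀ i, VelocityBounded R fun y =>
        b y * (M y * dV i (fun x => f x / M x) y) + (-1) * ((f y / M y) * (M y * dV i b y)) :=
      fun i z hz => by simp [hR z hz, hR.dV i z hz]
    have : ∀ v, (fun z => (∑ i, dV i (fun y => M y * dV i (fun x => f x / M x) y) z) * b z) (x, v)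
        - (fun z => (f z / M z) * ∑ i, dV i (fun y => M y * dV i b y) z) (x, v) =
        ∑ i, dV i (fun y =>
          b y * (M y * dV i (fun x => f x / M x) y) + (-1) * ((f y / M y) * (M y * dV i b y)))
          (x, v) := by
      intro v
      simp only [Finset.sum_mul, Finset.mul_sum, ← Finset.sum_sub_distrib]
      refine Finset.sum_congr rfl fun i _ => ?_
      have db := hb.differentiable (by norm_num) (x, v)
      have dA := (hA i).differentiable (by norm_num) (x, v)
      have dB := (hB i).differentiable (by norm_num) (x, v)
      have dq := hq1.differentiable (by norm_num) (x, v)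
      have h1 := dV_linear (f := fun y => b y * (M y * dV i (fun x => f x / M x) y))
        (g := fun y => (f y / M y) * (M y * dV i b y)) 1 (-1) (db.mul dA) (dq.mul dB) i
      simp only [one_mul] at h1
      rw [h1, dV_mul db dA, dV_mul dq dB]
      ring
    rw [integral_congr_ae (.of_forall this), integral_finsetSum]
    · exact Finset.sum_eq_zero fun i _ => integral_dV_eq_zero (hΨ i) (hΨR i) i x
    · exact fun i _ => ((hΨR i).dV i).integrable (continuous_dV (hΨ i) i) x
  | bgk =>
    have i0 := hM.integrable_mul hb.continuous hR x
    obtain ⟨C, hC⟩ := hR.exists_bound hb.continuous x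
    have i1 : Integrable fun v => f (x, v) * b (x, v) :=
      (hf.integrable x).mul_bdd (c := C) (continuous_slice hb.continuous x).aestronglyMeasurable
        (.of_forall hC)
    have e1 : (fun v => collisionOp .bgk M f (x, v) * b (x, v)) = fun v =>
        density f x * (M (x, v) * b (x, v)) - f (x, v) * b (x, v) := by
      funext v; simp only [collisionOp]; ring
    have e2 : (fun v => f (x, v) * adjointCollisionOp .bgk M b (x, v)) = fun v =>
        f (x, v) * (∫ v, M (x, v) * b (x, v)) - f (x, v) * b (x, v) := by
      funext v; simp only [adjointCollisionOp]; ring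
    rw [e1, e2]
    refine ⟨(i0.const_mul _).sub i1, ((hf.integrable x).mul_const _).sub i1, ?_⟩
    rw [integral_sub (i0.const_mul _) i1, integral_sub ((hf.integrable x).mul_const _) i1,
      integral_const_mul, integral_mul_const]
    rfl

/-- The Leibniz rule; v_i comes out of the x-derivative because it does not depend on x. Taking b =
1 gives the divergence form of transport. -/
theorem transportOp_mul_add (hG : ContDiff ℝ ∞ G) (hf : ContDiff ℝ 1 f) (hb : ContDiff ℝ 1 b)
    (z : E d × E d) :
    transportOp G f z * b z + f z * (∑ i, z.2 i * dX i b z + ∑ i, G z i * dV i b z) =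
      ∑ i, dX i (fun y => y.2 i * b y * f y) z + ∑ i, dV i (fun y => b y * (f y * G y i)) z := by
  have df := hf.differentiable (by norm_num) z
  have db := hb.differentiable (by norm_num) z
  have dG : ∀ i, DifferentiableAt ℝ (fun y => G y i) z := fun i =>
    (contDiff_coord hG i).differentiable (by simp) z
  have dv : ∀ i, DifferentiableAt ℝ (fun y : E d × E d => y.2 i) z := fun i =>
    (contDiff_velocity i (n := 1)).differentiable (by norm_num) z
  have h1 : ∀ i, dX i (fun y => y.2 i * b y * f y) z =
      z.2 i * b z * dX i f z + f z * (z.2 i * dX i b z) := fun i => by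
    have := dX_mul (f := fun y => y.2 i * b y) ((dv i).mul db) df i
    rw [this, dX_mul (dv i) db, dX_velocity_eq_zero]; ring
  have h2 : ∀ i, dV i (fun y => b y * (f y * G y i)) z =
      b z * dV i (fun y => f y * G y i) z + f z * (G z i * dV i b z) := fun i => by
    have hd : DifferentiableAt ℝ (fun y => f y * G y i) z := df.mul (dG i)
    rw [dV_mul db hd]; ring
  simp only [transportOp_eq hG df, h1, h2, Finset.sum_add_distrib, add_mul, mul_add,
    Finset.sum_mul, Finset.mul_sum]
  have h3 : ∀ i, z.2 i * b z * dX i f z = z.2 i * dX i f z * b z := fun i => by ring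
  have h4 : ∀ i, b z * dV i (fun y => f y * G y i) z = dV i (fun y => f y * G y i) z * b z :=
    fun i => by ring
  simp only [h3, h4]; ring

/-- The local weak form of the evolution operator. -/
theorem integral_evolutionOp_mul (hG : ContDiff ℝ ∞ G) (hM : IsBackground L M) (hf : Regular L f)
    (hb : ContDiff ℝ 1 b) (hb2 : ∀ i, ContDiff ℝ 1 (dV i b)) (hR : VelocityBounded R b) (x : E d) :
    Integrable (fun v => f (x, v) * adjointOp L G M b (x, v)) ∧
    ∫ v, evolutionOp L G M f (x, v) * b (x, v) =
      (∫ v, f (x, v) * adjointOp L G M b (x, v)) -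
        ∑ i, fderiv ℝ (density fun z => z.2 i * b z * f z) x (EuclideanSpace.single i 1) := by
  obtain ⟨iL, iL', eL⟩ := integral_collisionOp_mul hM hf hb hb2 hR x
  have hk : ∀ i, ContDiff ℝ 1 fun y : E d × E d => y.2 i * b y * f y := fun i =>
    ((contDiff_velocity i).mul hb).mul hf.contDiff
  have hkR : ∀ i, VelocityBounded R fun y : E d × E d => y.2 i * b y * f y := fun i =>
    (hR.mul_right _).mul_left _
  have hl : ∀ i, ContDiff ℝ 1 fun y : E d × E d => b y * (f y * G y i) := fun i =>
    hb.mul (hf.contDiff.mul ((contDiff_coord hG i).of_le (by exact_mod_cast le_top)))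
  have hlR : ∀ i, VelocityBounded R fun y : E d × E d => b y * (f y * G y i) := fun i =>
    hR.mul_left _
  have iX : ∀ i, Integrable fun v => dX i (fun y => y.2 i * b y * f y) (x, v) := fun i =>
    ((hkR i).dX i).integrable (continuous_dX (hk i) i) x
  have iV : ∀ i, Integrable fun v => dV i (fun y => b y * (f y * G y i)) (x, v) := fun i =>
    ((hlR i).dV i).integrable (continuous_dV (hl i) i) x
  have iT : Integrable fun v => f (x, v) * (∑ i, v i * dX i b (x, v) + ∑ i, G (x, v) i * dV i b (x, v)) := by
    refine VelocityBounded.integrable (R := R) (f := fun z : E d × E d =>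
      f z * (∑ i, z.2 i * dX i b z + ∑ i, G z i * dV i b z)) (fun z hz => ?_) ?_ x
    · have h1 : ∀ i, dX i b z = 0 := fun i => hR.dX i z hz
      have h2 : ∀ i, dV i b z = 0 := fun i => hR.dV i z hz
      simp [h1, h2]
    · refine hf.contDiff.continuous.mul ((continuous_finsetSum _ fun i _ => ?_).add
        (continuous_finsetSum _ fun i _ => ?_))
      · exact (contDiff_velocity i (n := 1)).continuous.mul (continuous_dX hb i)
      · exact (contDiff_coord hG i).continuous.mul (continuous_dV hb i)
  have hsplit : ∀ v, f (x, v) * adjointOp L G M b (x, v) =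
      f (x, v) * (∑ i, v i * dX i b (x, v) + ∑ i, G (x, v) i * dV i b (x, v)) +
        f (x, v) * adjointCollisionOp L M b (x, v) := fun v => by rw [adjointOp, mul_add]
  have hi : Integrable (fun v => f (x, v) * adjointOp L G M b (x, v)) := by
    simp only [hsplit]; exact iT.add iL'
  refine ⟨hi, ?_⟩
  -- Integration is over v only, so the velocity divergence drops out while the position divergence
  -- survives as the derivatives of the moments ⟨v_i b f⟩. Those are later absorbed by the weak
  -- derivatives of F.
  have hpt : ∀ v, evolutionOp L G M f (x, v) * b (x, v) =
      f (x, v) * (∑ i, v i * dX i b (x, v) + ∑ i, G (x, v) i * dV i b (x, v)) -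
        (∑ i, dX i (fun y => y.2 i * b y * f y) (x, v) +
          ∑ i, dV i (fun y => b y * (f y * G y i)) (x, v)) +
        collisionOp L M f (x, v) * b (x, v) := fun v => by
    have := transportOp_mul_add hG hf.contDiff hb (x, v)
    rw [evolutionOp, ← this]; ring
  simp only [hpt, hsplit]
  have iS : Integrable fun v => ∑ i, dX i (fun y => y.2 i * b y * f y) (x, v) +
      ∑ i, dV i (fun y => b y * (f y * G y i)) (x, v) :=
    (integrable_finsetSum _ fun i _ => iX i).add (integrable_finsetSum _ fun i _ => iV i)
  have iTS : Integrable fun v =>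
      f (x, v) * (∑ i, v i * dX i b (x, v) + ∑ i, G (x, v) i * dV i b (x, v)) -
        (∑ i, dX i (fun y => y.2 i * b y * f y) (x, v) +
          ∑ i, dV i (fun y => b y * (f y * G y i)) (x, v)) := iT.sub iS
  rw [integral_add iTS iL, integral_sub iT iS,
    integral_add (integrable_finsetSum _ fun i _ => iX i)
      (integrable_finsetSum _ fun i _ => iV i),
    integral_finsetSum _ fun i _ => iX i, integral_finsetSum _ fun i _ => iV i,
    integral_add iT iL', eL]
  simp only [integral_dV_eq_zero (hl _) (hlR _), fderiv_density_apply (hk _) (hkR _)]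
  simp only [Finset.sum_const_zero]; ring

end Adjoint

end Kinetic

end

/-! ### Energy identity, microscopic coercivity and mass conservation on test functions. -/

noncomputable section

namespace Kinetic

variable {d : ℕ}

section Energy

variable {L : Collision} {G : E d × E d → E d} {M f b fInf g : E d × E d → ℝ} {cInf cM lam1 : ℝ}

/-- A zero density would make the quotient in the lower bound equal to 0, by the convention for
division, and a negative one would make it negative. The same convention for integrals then shows
that the slices of f∞ are integrable. -/
theorem IsStationaryState.density_pos (hS : IsStationaryState L G M fInf cInf cM)
    (hc : 0 < cInf) (x : E d) : 0 < density fInf x := by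
  have h := hc.trans_le (hS.lower_bound x 0 (by simp))
  exact (div_pos_iff_of_pos_left (hS.pos _)).1 h

theorem IsStationaryState.regular (hS : IsStationaryState L G M fInf cInf cM)
    (hc : 0 < cInf) : Regular L fInf := by
  refine ⟨hS.contDiff, hS.contDiff_fp, fun x => ?_⟩
  by_contra h
  have := hS.density_pos hc x
  rw [density, integral_undef h] at this
  exact lt_irrefl _ this

theorem IsStationaryState.integrable (hS : IsStationaryState L G M fInf cInf cM) :
    Integrable fInf := by
  by_contra h
  have := hS.integral_eq_one
  rw [integral_undef h] at this
  exact zero_ne_one this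

theorem IsStationaryState.contDiff_div (hS : IsStationaryState L G M fInf cInf cM)
    (hg : IsTest g) : ContDiff ℝ 1 fun z => g z / fInf z :=
  (hg.1.of_le (by norm_cast)).div hS.contDiff fun z => (hS.pos z).ne'

theorem integral_transportOp_eq_zero (hG : ContDiff ℝ ∞ G) (hf : ContDiff ℝ 1 f)
    (hc : HasCompactSupport f) :
    Integrable (transportOp G f) ∧ ∫ z, transportOp G f z = 0 := by
  have e : transportOp G f = fun z => ∑ i, dX i (fun y => y.2 i * f y) z +
      ∑ i, dV i (fun y => f y * G y i) z := by
    funext z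
    have := transportOp_mul_add hG hf (contDiff_const (c := (1 : ℝ))) z
    have h1 : ∀ i, dX i (fun _ : E d × E d => (1 : ℝ)) z = 0 := fun i => by simp [dX]
    have h2 : ∀ i, dV i (fun _ : E d × E d => (1 : ℝ)) z = 0 := fun i => by simp [dV]
    simpa [h1, h2] using this
  have hk : ∀ i, ContDiff ℝ 1 fun y : E d × E d => y.2 i * f y := fun i =>
    (contDiff_velocity i).mul hf
  have hl : ∀ i, ContDiff ℝ 1 fun y => f y * G y i := fun i =>
    hf.mul ((contDiff_coord hG i).of_le (by norm_cast))
  have ck : ∀ i, HasCompactSupport fun y : E d × E d => y.2 i * f y := fun i => hc.mul_left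
  have cl : ∀ i, HasCompactSupport fun y => f y * G y i := fun i => hc.mul_right
  have ik : ∀ i, Integrable (dX i fun y : E d × E d => y.2 i * f y) := fun i =>
    (continuous_dX (hk i) i).integrable_of_hasCompactSupport ((ck i).fderiv_apply ℝ _)
  have il : ∀ i, Integrable (dV i fun y => f y * G y i) := fun i =>
    (continuous_dV (hl i) i).integrable_of_hasCompactSupport ((cl i).fderiv_apply ℝ _)
  rw [e]
  refine ⟨(integrable_finsetSum _ fun i _ => ik i).add (integrable_finsetSum _ fun i _ => il i), ?_⟩
  rw [integral_add (integrable_finsetSum _ fun i _ => ik i)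
    (integrable_finsetSum _ fun i _ => il i), integral_finsetSum _ fun i _ => ik i,
    integral_finsetSum _ fun i _ => il i, Finset.sum_eq_zero, Finset.sum_eq_zero, add_zero]
  · exact fun i _ => integral_fderiv_eq_zero volume (hl i) (cl i) _
  · exact fun i _ => integral_fderiv_eq_zero volume (hk i) (ck i) _

/-- The divergence form is applied to the pair (f, b) and to the pair (bf, 1); the divergences
agree. -/
theorem transportOp_mul (hG : ContDiff ℝ ∞ G) (hf : ContDiff ℝ 1 f) (hb : ContDiff ℝ 1 b)
    (z : E d × E d) :
    transportOp G (fun y => b y * f y) z =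
      b z * transportOp G f z + f z * (∑ i, z.2 i * dX i b z + ∑ i, G z i * dV i b z) := by
  have h := transportOp_mul_add hG hf hb z
  have hd : DifferentiableAt ℝ (fun y => b y * f y) z := (hb.mul hf).differentiable (by norm_num) z
  have h1 := transportOp_mul_add hG (hb.mul hf) (contDiff_const (c := (1 : ℝ))) z
  have e1 : ∀ i, dX i (fun _ : E d × E d => (1 : ℝ)) z = 0 := fun i => by simp [dX]
  have e2 : ∀ i, dV i (fun _ : E d × E d => (1 : ℝ)) z = 0 := fun i => by simp [dV]
  simp only [e1, e2, mul_zero, Finset.sum_const_zero, add_zero, mul_one, one_mul] at h1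
  rw [h1]
  rw [mul_comm (b z), h]
  congr 1 <;> refine Finset.sum_congr rfl fun i _ => ?_ <;> congr 1 <;> funext y <;> ring

/-- The transport part only contributes a multiple of `Tf∞` to the energy. -/
theorem div_mul_transportOp (hG : ContDiff ℝ ∞ G) (hS : IsStationaryState L G M fInf cInf cM)
    (hg : IsTest g) (z : E d × E d) :
    g z / fInf z * transportOp G g z =
      1 / 2 * transportOp G (fun y => g y / fInf y * g y) z +
        1 / 2 * (g z / fInf z) ^ 2 * transportOp G fInf z := by
  have hh := hS.contDiff_div hg
  -- With h = g/f∞ and X = v·∇_x + G·∇_v, one has T(hg) = h Tg + g Xh and Tg = h Tf∞ + f∞ Xh.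
  -- Eliminating Xh gives the claim.
  have h1 := transportOp_mul hG (hg.1.of_le (by norm_cast)) hh z
  have h2 := transportOp_mul hG hS.contDiff hh z
  have e : (fun y => g y / fInf y * fInf y) = g := by
    funext y; exact div_mul_cancel₀ _ (hS.pos y).ne'
  have e' : g z / fInf z * fInf z = g z := div_mul_cancel₀ _ (hS.pos z).ne'
  rw [e] at h2
  rw [h1]
  linear_combination (1 / 2 : ℝ) * (g z / fInf z) * h2 + 1 / 2 *
    (∑ i, z.2 i * dX i (fun y => g y / fInf y) z + ∑ i, G z i * dV i (fun y => g y / fInf y) z) * e'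

/-- A compactly supported continuous function times `M` is integrable. -/
theorem IsBackground.integrable_mul_of_hasCompactSupport (hM : IsBackground L M)
    (hf : Continuous f) (hc : HasCompactSupport f) : Integrable fun z => f z * M z := by
  obtain ⟨C, hC⟩ := hc.exists_bound_of_continuous hf
  have hK : IsCompact (Prod.fst '' tsupport f) := hc.isCompact.image continuous_fst
  set K := Prod.fst '' tsupport f with hKdef
  -- M may be unbounded but has unit mass in each velocity fibre. The indicator of the projected
  -- support times M is therefore integrable by Fubini, and it dominates.
  have hI : Integrable fun z : E d × E d => K.indicator (fun _ => (1 : ℝ)) z.1 * M z := by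
    have hm : AEStronglyMeasurable (fun z : E d × E d => K.indicator (fun _ => (1 : ℝ)) z.1 * M z)
        (volume.prod volume) :=
      (((measurable_const.indicator hK.measurableSet).comp measurable_fst).mul
        hM.measurable).aestronglyMeasurable
    rw [Measure.volume_eq_prod, integrable_prod_iff hm]
    refine ⟨.of_forall fun x => (hM.integrable x).const_mul (K.indicator (fun _ => (1 : ℝ)) x), ?_⟩
    have : (fun x => ∫ v, ‖K.indicator (fun _ => (1 : ℝ)) x * M (x, v)‖) =
        K.indicator fun _ => (1 : ℝ) := by
      funext x
      simp only [norm_mul, Real.norm_of_nonneg (hM.nonneg _)]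
      rw [integral_const_mul, hM.integral_eq_one]
      by_cases hx : x ∈ K <;> simp [hx]
    rw [this, integrable_indicator_iff hK.measurableSet]
    exact integrableOn_const hK.measure_ne_top
  refine (hI.const_mul C).mono' (hf.measurable.mul hM.measurable).aestronglyMeasurable
    (.of_forall fun z => ?_)
  rw [norm_mul, Real.norm_of_nonneg (hM.nonneg z), ← mul_assoc]
  refine mul_le_mul_of_nonneg_right ?_ (hM.nonneg z)
  by_cases hz : z ∈ tsupport f
  · rw [indicator_of_mem (mem_image_of_mem Prod.fst hz : z.1 ∈ K), mul_one]
    exact hC z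
  · rw [image_eq_zero_of_notMem_tsupport hz, norm_zero]
    have hC0 : 0 ≤ C := (norm_nonneg _).trans (hC z)
    exact mul_nonneg hC0 (indicator_nonneg (fun _ _ => zero_le_one) _)

theorem hasCompactSupport_density_mul (hg : HasCompactSupport g) :
    HasCompactSupport fun x => density g x := by
  refine HasCompactSupport.intro (hg.isCompact.image continuous_fst) fun x hx => ?_
  have : ∀ v, g (x, v) = 0 := fun v =>
    image_eq_zero_of_notMem_tsupport fun h => hx ⟨(x, v), h, rfl⟩
  simp [density, this]

theorem continuous_density_of_isTest (hg : IsTest g) : Continuous (density g) := by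
  obtain ⟨R, hR⟩ := exists_velocityBounded hg.2
  exact continuous_density hg.1.continuous hR

theorem hasCompactSupport_of_eq_zero {X Y : Type*} [TopologicalSpace X] [T2Space X] [Zero Y]
    {f : X → ℝ} {k : X → Y}
    (hf : HasCompactSupport f) (h : ∀ x, x ∉ tsupport f → k x = 0) : HasCompactSupport k :=
  HasCompactSupport.intro hf.isCompact h

theorem dV_eq_zero_of_notMem {f k : E d × E d → ℝ} (hk : ∀ z, z ∉ tsupport f → k z = 0) (i : Fin d)
    {z : E d × E d} (hz : z ∉ tsupport f) : dV i k z = 0 := by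
  have : k =ᶠ[nhds z] fun _ => 0 := by
    filter_upwards [(isClosed_tsupport f).isOpen_compl.mem_nhds hz] with y hy using hk y hy
  rw [dV, this.fderiv_eq]; simp

/-- The contribution of the collision operator to the energy. -/
theorem collision_energy (hM : IsBackground L M) (hS : IsStationaryState L G M fInf cInf cM)
    (hc : 0 < cInf) (hg : IsTest g) :
    Integrable (fun z => g z / fInf z * collisionOp L M g z -
      1 / 2 * (g z / fInf z) ^ 2 * collisionOp L M fInf z) ∧
    ∀ x, (∫ v, (g (x, v) / fInf (x, v) * collisionOp L M g (x, v) -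
      1 / 2 * (g (x, v) / fInf (x, v)) ^ 2 * collisionOp L M fInf (x, v))) =
        -velocityDissipation L M fInf x fun v => g (x, v) := by
  have hh := hS.contDiff_div hg
  obtain ⟨R, hR⟩ := exists_velocityBounded hg.2
  have hhR : VelocityBounded R fun z => g z / fInf z := fun z hz => by simp [hR z hz]
  have hhc : HasCompactSupport fun z => g z / fInf z :=
    hasCompactSupport_of_eq_zero hg.2 fun z hz => by simp [image_eq_zero_of_notMem_tsupport hz]
  have hgh : ∀ z, g z / fInf z * fInf z = g z := fun z => div_mul_cancel₀ _ (hS.pos z).ne'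
  cases L with
  | fokkerPlanck =>
    obtain ⟨hM2, hM0⟩ := hM.regular_fp rfl
    have h2f := hS.contDiff_fp rfl
    have h2g : ContDiff ℝ 2 g := hg.1.of_le (by norm_cast)
    have hM1 : ContDiff ℝ 1 M := hM2.of_le (by norm_num)
    have hqf : ContDiff ℝ 2 (fun x => fInf x / M x) := h2f.div hM2 fun x => (hM0 x).ne'
    have hqg : ContDiff ℝ 2 (fun x => g x / M x) := h2g.div hM2 fun x => (hM0 x).ne'
    have hA : ∀ i, ContDiff ℝ 1 fun y => M y * dV i (fun x => g x / M x) y := fun i =>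
      hM1.mul (contDiff_dV hqg (by norm_num) i)
    have hB : ∀ i, ContDiff ℝ 1 fun y => M y * dV i (fun x => fInf x / M x) y := fun i =>
      hM1.mul (contDiff_dV hqf (by norm_num) i)
    -- The flux h A_i − ½ h² B_i with h = g/f∞, A_i = M ∂_i(g/M), B_i = M ∂_i(f∞/M). Since A_i = h
    -- B_i + f∞ ∂_i h, removing its divergence leaves exactly −f∞ |∂_i h|².
    have hΨ : ∀ i, ContDiff ℝ 1 fun y =>
        g y / fInf y * (M y * dV i (fun x => g x / M x) y) + (-(1 / 2)) *
          ((g y / fInf y * (g y / fInf y)) * (M y * dV i (fun x => fInf x / M x) y)) := fun i =>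
      (hh.mul (hA i)).add (contDiff_const.mul ((hh.mul hh).mul (hB i)))
    have hΨR : ∀ i, VelocityBounded R fun y =>
        g y / fInf y * (M y * dV i (fun x => g x / M x) y) + (-(1 / 2)) *
          ((g y / fInf y * (g y / fInf y)) * (M y * dV i (fun x => fInf x / M x) y)) :=
      fun i z hz => by simp [hR z hz]
    have hpt : ∀ z, g z / fInf z * collisionOp .fokkerPlanck M g z -
        1 / 2 * (g z / fInf z) ^ 2 * collisionOp .fokkerPlanck M fInf z =
        ∑ i, dV i (fun y => g y / fInf y * (M y * dV i (fun x => g x / M x) y) + (-(1 / 2)) *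
          ((g y / fInf y * (g y / fInf y)) * (M y * dV i (fun x => fInf x / M x) y))) z -
        ∑ i, (dV i (fun y => g y / fInf y) z) ^ 2 * fInf z := by
      intro z
      rw [collisionOp_fp_eq hM2 hM0 h2g, collisionOp_fp_eq hM2 hM0 h2f, Finset.mul_sum,
        Finset.mul_sum, ← Finset.sum_sub_distrib, ← Finset.sum_sub_distrib]
      refine Finset.sum_congr rfl fun i _ => ?_
      have dh := hh.differentiable (by norm_num) z
      have dhh : DifferentiableAt ℝ (fun y => g y / fInf y * (g y / fInf y)) z := dh.mul dh
      have dA := (hA i).differentiable (by norm_num) z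
      have dB := (hB i).differentiable (by norm_num) z
      have dq := hqf.differentiable (by norm_num) z
      have h1 := dV_linear (f := fun y => g y / fInf y * (M y * dV i (fun x => g x / M x) y))
        (g := fun y => (g y / fInf y * (g y / fInf y)) * (M y * dV i (fun x => fInf x / M x) y))
        1 (-(1 / 2)) (dh.mul dA) (dhh.mul dB) i
      simp only [one_mul] at h1
      have h2 : dV i (fun x => g x / M x) z = g z / fInf z * dV i (fun x => fInf x / M x) z +
          fInf z / M z * dV i (fun y => g y / fInf y) z := by
        rw [← dV_mul dh dq]
        congr 1; funext y
        have := (hS.pos y).ne'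
        have := (hM0 y).ne'
        field_simp
      rw [h1, dV_mul dh dA, dV_mul dhh dB, dV_mul dh dh, h2]
      have := (hM0 z).ne'
      field_simp
      ring
    have hD : Continuous fun z => ∑ i, (dV i (fun y => g y / fInf y) z) ^ 2 * fInf z :=
      continuous_finsetSum _ fun i _ => ((continuous_dV hh i).pow 2).mul hS.contDiff.continuous
    have hDR : VelocityBounded R fun z => ∑ i, (dV i (fun y => g y / fInf y) z) ^ 2 * fInf z :=
      fun z hz => by
        have : ∀ i, dV i (fun y => g y / fInf y) z = 0 := fun i => hhR.dV i z hz
        simp [this]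
    simp only [hpt]
    constructor
    · refine Continuous.integrable_of_hasCompactSupport
        ((continuous_finsetSum _ fun i _ => continuous_dV (hΨ i) i).sub hD)
        (hasCompactSupport_of_eq_zero hg.2 fun z hz => ?_)
      have h1 : ∀ i, dV i (fun y => g y / fInf y) z = 0 := fun i =>
        dV_eq_zero_of_notMem (fun y hy => by simp [image_eq_zero_of_notMem_tsupport hy]) i hz
      have h2 : ∀ i, dV i (fun y => g y / fInf y * (M y * dV i (fun x => g x / M x) y) +
          (-(1 / 2)) * ((g y / fInf y * (g y / fInf y)) *
            (M y * dV i (fun x => fInf x / M x) y))) z = 0 := fun i =>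
        dV_eq_zero_of_notMem (fun y hy => by simp [image_eq_zero_of_notMem_tsupport hy]) i hz
      simp only [h1, h2]; simp
    · intro x
      have iΨ : ∀ i, Integrable fun v => dV i (fun y =>
          g y / fInf y * (M y * dV i (fun x => g x / M x) y) + (-(1 / 2)) *
          ((g y / fInf y * (g y / fInf y)) * (M y * dV i (fun x => fInf x / M x) y))) (x, v) :=
        fun i => ((hΨR i).dV i).integrable (continuous_dV (hΨ i) i) x
      rw [integral_sub (integrable_finsetSum _ fun i _ => iΨ i) (hDR.integrable hD x),
        integral_finsetSum _ fun i _ => iΨ i,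
        Finset.sum_eq_zero fun i _ => integral_dV_eq_zero (hΨ i) (hΨR i) i x, zero_sub,
        velocityDissipation]
      congr 1
      refine integral_congr_ae (.of_forall fun v => ?_)
      have := EuclideanSpace.real_norm_sq_eq
        (gradient (fun u => g (x, u) / fInf (x, u)) v)
      simp only [this, Finset.sum_mul]
      refine Finset.sum_congr rfl fun i _ => ?_
      rw [← gradV_apply (hh.differentiable (by norm_num) (x, v))]
      rfl
  | bgk =>
    have hρ := continuous_density_of_isTest hg
    have hρi : Continuous (density fInf) := hS.contDiff_density.continuous
    have hfc := hS.contDiff.continuous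
    have hhc' := hh.continuous
    have hpt : ∀ z, g z / fInf z * collisionOp .bgk M g z -
        1 / 2 * (g z / fInf z) ^ 2 * collisionOp .bgk M fInf z =
        (g z / fInf z) * (density g z.1 - 1 / 2 * (g z / fInf z) * density fInf z.1) * M z -
          1 / 2 * (g z / fInf z * g z) := by
      intro z
      simp only [collisionOp]
      linear_combination (1 / 2 * (g z / fInf z)) * hgh z
    simp only [hpt]
    constructor
    · refine (hM.integrable_mul_of_hasCompactSupport ?_ hhc.mul_right).sub
        ((Continuous.integrable_of_hasCompactSupport (hhc'.mul hg.1.continuous)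
          hhc.mul_right).const_mul _)
      exact hhc'.mul ((hρ.comp continuous_fst).sub
        ((continuous_const.mul hhc').mul (hρi.comp continuous_fst)))
    · intro x
      have iM := hM.integrable x
      have iF := (hS.regular hc).integrable x
      set h : E d → ℝ := fun v => g (x, v) / fInf (x, v) with hhdef
      obtain ⟨C, hC⟩ := hhR.exists_bound hhc' x
      have hhm : AEStronglyMeasurable h := (continuous_slice hhc' x).aestronglyMeasurable
      have iMh : Integrable fun v => h v * M (x, v) :=
        iM.bdd_mul hhm (.of_forall hC)
      have iMhh : Integrable fun v => h v ^ 2 * M (x, v) := by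
        refine (iMh.bdd_mul hhm (.of_forall hC)).congr (.of_forall fun v => ?_)
        simp only; ring
      have iFh : Integrable fun v => h v * fInf (x, v) := iF.bdd_mul hhm (.of_forall hC)
      have iFhh : Integrable fun v => h v ^ 2 * fInf (x, v) := by
        refine (iFh.bdd_mul hhm (.of_forall hC)).congr (.of_forall fun v => ?_)
        simp only; ring
      have eg : ∫ v, h v * fInf (x, v) = density g x :=
        integral_congr_ae (.of_forall fun v => hgh (x, v))
      have lhs : ∀ v, g (x, v) / fInf (x, v) * (density g x -
          1 / 2 * (g (x, v) / fInf (x, v)) * density fInf x) * M (x, v) -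
          1 / 2 * (g (x, v) / fInf (x, v) * g (x, v)) =
          density g x * (h v * M (x, v)) - (1 / 2 * density fInf x) * (h v ^ 2 * M (x, v)) -
            1 / 2 * (h v ^ 2 * fInf (x, v)) := fun v => by
        simp only [hhdef]
        linear_combination (1 / 2 * (g (x, v) / fInf (x, v))) * hgh (x, v)
      simp only [lhs]
      rw [integral_sub (f := fun v => density g x * (h v * M (x, v)) -
          (1 / 2 * density fInf x) * (h v ^ 2 * M (x, v)))
          ((iMh.const_mul _).sub (iMhh.const_mul _)) (iFhh.const_mul _),
        integral_sub (iMh.const_mul _) (iMhh.const_mul _), integral_const_mul, integral_const_mul,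
        integral_const_mul, velocityDissipation]
      -- Expanding the square turns the double integral into three products of single integrals.
      -- With ∫ M = 1 and ∫ h f∞ = ⟨g⟩ they match the three terms on the other side.
      have rhs : ∀ p : E d × E d, (g (x, p.1) / fInf (x, p.1) - g (x, p.2) / fInf (x, p.2)) ^ 2 *
          (fInf (x, p.1) * M (x, p.2)) = (h p.1 ^ 2 * fInf (x, p.1)) * M (x, p.2) -
            2 * ((h p.1 * fInf (x, p.1)) * (h p.2 * M (x, p.2))) +
            fInf (x, p.1) * (h p.2 ^ 2 * M (x, p.2)) := fun p => by
        simp only [hhdef]; ring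
      simp only [rhs]
      rw [Measure.volume_eq_prod]
      have j1 := iFhh.mul_prod iM
      have j2 := (iFh.mul_prod iMh).const_mul 2
      have j3 := iF.mul_prod iMhh
      rw [integral_add (f := fun p : E d × E d => (h p.1 ^ 2 * fInf (x, p.1)) * M (x, p.2) -
            2 * ((h p.1 * fInf (x, p.1)) * (h p.2 * M (x, p.2)))) (j1.sub j2) j3,
        integral_sub j1 j2, integral_const_mul,
        integral_prod_mul (fun v => h v ^ 2 * fInf (x, v)) (fun v => M (x, v)),
        integral_prod_mul (fun v => h v * fInf (x, v)) (fun v => h v * M (x, v)),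
        integral_prod_mul (fun v => fInf (x, v)) (fun v => h v ^ 2 * M (x, v)),
        hM.integral_eq_one, eg]
      change _ = -(1 / 2 * (_ + density fInf x * _))
      ring

/-- By stationarity, the defect ½ h² Tf∞ of skewness is the term ½ h² Lf∞ subtracted in
`collision_energy`. The rest of the transport contribution is a compactly supported divergence. -/
theorem integral_evolutionOp_energy (hG : ContDiff ℝ ∞ G) (hM : IsBackground L M)
    (hS : IsStationaryState L G M fInf cInf cM) (hc : 0 < cInf) (hg : IsTest g) :
    Integrable (fun x => velocityDissipation L M fInf x fun v => g (x, v)) ∧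
    ∫ z, g z / fInf z * evolutionOp L G M g z =
      -∫ x, velocityDissipation L M fInf x fun v => g (x, v) := by
  obtain ⟨hi, he⟩ := collision_energy hM hS hc hg
  have hgh : ContDiff ℝ 1 fun y => g y / fInf y * g y :=
    (hS.contDiff_div hg).mul (hg.1.of_le (by norm_cast))
  obtain ⟨hTi, hT⟩ := integral_transportOp_eq_zero hG hgh hg.2.mul_left
  have hpt : ∀ z, g z / fInf z * evolutionOp L G M g z =
      -(1 / 2) * transportOp G (fun y => g y / fInf y * g y) z +
      (g z / fInf z * collisionOp L M g z -
        1 / 2 * (g z / fInf z) ^ 2 * collisionOp L M fInf z) := fun z => by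
    rw [evolutionOp, ← hS.stationary z]
    linear_combination -div_mul_transportOp hG hS hg z
  constructor
  · have := hi.integral_prod_left
    simp only [he] at this
    simpa using this.neg
  · simp only [hpt]
    rw [integral_add (hTi.const_mul _) hi, integral_const_mul, hT, mul_zero, zero_add,
      Measure.volume_eq_prod, integral_prod _ hi]
    simp only [he, integral_neg]

/-- Microscopic coercivity on test functions. -/
theorem core_coercive (hG : ContDiff ℝ ∞ G) (hM : IsBackground L M)
    (hS : IsStationaryState L G M fInf cInf cM) (hc : 0 < cInf)
    (hLC : LocalCoercivity L M fInf lam1) (hg : IsTest g) :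
    (∫ z, g z ^ 2 / fInf z) - ∫ x, density g x ^ 2 / density fInf x ≤
      -lam1 * ∫ z, g z / fInf z * evolutionOp L G M g z := by
  obtain ⟨hi, he⟩ := integral_evolutionOp_energy hG hM hS hc hg
  have hfc := hS.contDiff.continuous
  obtain ⟨R, hR⟩ := exists_velocityBounded hg.2
  have hqc : Continuous fun z => g z ^ 2 / fInf z :=
    (hg.1.continuous.pow 2).div hfc fun z => (hS.pos z).ne'
  have hq : Integrable fun z => g z ^ 2 / fInf z :=
    hqc.integrable_of_hasCompactSupport (hasCompactSupport_of_eq_zero hg.2 fun z hz => by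
      simp [image_eq_zero_of_notMem_tsupport hz])
  have hqR : VelocityBounded R fun z => g z ^ 2 / fInf z := fun z hz => by simp [hR z hz]
  have hr : Integrable fun x => density g x ^ 2 / density fInf x := by
    refine Continuous.integrable_of_hasCompactSupport ?_
      (hasCompactSupport_of_eq_zero (hasCompactSupport_density_mul hg.2) fun x hx => ?_)
    · exact ((continuous_density_of_isTest hg).pow 2).div hS.contDiff_density.continuous
        fun x => (hS.density_pos hc x).ne'
    · have : density g x = 0 := image_eq_zero_of_notMem_tsupport hx
      simp [this]
  rw [Measure.volume_eq_prod, integral_prod _ hq, ← Measure.volume_eq_prod,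
    ← integral_sub hq.integral_prod_left hr, he, neg_mul_neg, ← integral_const_mul]
  refine integral_mono (hq.integral_prod_left.sub hr) (hi.const_mul _) fun x => ?_
  have hgx : IsTest fun v => g (x, v) :=
    ⟨hg.1.comp (by fun_prop : ContDiff ℝ ∞ fun v : E d => (x, v)), hR.hasCompactSupport x⟩
  -- At fixed x, expanding the square in (H2) around the local equilibrium leaves ∫ g²/f∞ dv −
  -- ⟨g⟩²/⟨f∞⟩.
  refine le_of_eq_of_le ?_ (hLC x _ hgx)
  have hρ := (hS.density_pos hc x).ne'
  have ig := hR.integrable hg.1.continuous x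
  have iq := hqR.integrable hqc x
  have iF := (hS.regular hc).integrable x
  have hpt : ∀ v, (g (x, v) - (∫ u, g (x, u)) * (fInf (x, v) / density fInf x)) ^ 2 / fInf (x, v) =
      g (x, v) ^ 2 / fInf (x, v) - (2 * density g x / density fInf x) * g (x, v) +
        (density g x / density fInf x) ^ 2 * fInf (x, v) := fun v => by
    have := (hS.pos (x, v)).ne'
    change (g (x, v) - density g x * (fInf (x, v) / density fInf x)) ^ 2 / fInf (x, v) = _
    field_simp
    ring
  simp only [hpt]
  rw [integral_add (f := fun v => g (x, v) ^ 2 / fInf (x, v) -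
      (2 * density g x / density fInf x) * g (x, v)) (iq.sub (ig.const_mul _)) (iF.const_mul _),
    integral_sub iq (ig.const_mul _), integral_const_mul, integral_const_mul]
  change _ = _ - 2 * density g x / density fInf x * density g x +
    (density g x / density fInf x) ^ 2 * density fInf x
  field_simp
  ring

/-- Conservation of mass on test functions. -/
theorem integral_evolutionOp_eq_zero (hG : ContDiff ℝ ∞ G) (hM : IsBackground L M)
    (hg : IsTest g) : ∫ z, evolutionOp L G M g z = 0 := by
  obtain ⟨hTi, hT⟩ := integral_transportOp_eq_zero hG (hg.1.of_le (by norm_cast)) hg.2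
  have hcoll : Integrable (collisionOp L M g) ∧ ∫ z, collisionOp L M g z = 0 := by
    cases L with
    | fokkerPlanck =>
      obtain ⟨hM2, hM0⟩ := hM.regular_fp rfl
      have h2g : ContDiff ℝ 2 g := hg.1.of_le (by norm_cast)
      have hqg : ContDiff ℝ 2 (fun x => g x / M x) := h2g.div hM2 fun x => (hM0 x).ne'
      have hA : ∀ i, ContDiff ℝ 1 fun y => M y * dV i (fun x => g x / M x) y := fun i =>
        (hM2.of_le (by norm_num)).mul (contDiff_dV hqg (by norm_num) i)
      have hAc : ∀ i, HasCompactSupport fun y => M y * dV i (fun x => g x / M x) y := fun i =>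
        hasCompactSupport_of_eq_zero hg.2 fun z hz => by
          rw [dV_eq_zero_of_notMem (fun y hy => by simp [image_eq_zero_of_notMem_tsupport hy]) i hz,
            mul_zero]
      have e : collisionOp .fokkerPlanck M g = fun z =>
          ∑ i, dV i (fun y => M y * dV i (fun x => g x / M x) y) z := by
        funext z; rw [collisionOp_fp_eq hM2 hM0 h2g]
      have hi : ∀ i, Integrable (dV i fun y => M y * dV i (fun x => g x / M x) y) := fun i =>
        (continuous_dV (hA i) i).integrable_of_hasCompactSupport ((hAc i).fderiv_apply ℝ _)
      rw [e]
      refine ⟨integrable_finsetSum _ fun i _ => hi i, ?_⟩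
      rw [integral_finsetSum _ fun i _ => hi i]
      exact Finset.sum_eq_zero fun i _ => integral_fderiv_eq_zero volume (hA i) (hAc i) _
    | bgk =>
      have hρ := continuous_density_of_isTest hg
      have hm : AEStronglyMeasurable (fun z : E d × E d => density g z.1 * M z)
          (volume.prod volume) :=
        ((hρ.measurable.comp measurable_fst).mul hM.measurable).aestronglyMeasurable
      have i1 : Integrable fun z : E d × E d => density g z.1 * M z := by
        rw [Measure.volume_eq_prod, integrable_prod_iff hm]
        refine ⟨.of_forall fun x => (hM.integrable x).const_mul (density g x), ?_⟩
        have : (fun x => ∫ v, ‖density g x * M (x, v)‖) = fun x => ‖density g x‖ := by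
          funext x
          simp only [norm_mul, Real.norm_of_nonneg (hM.nonneg _)]
          rw [integral_const_mul, hM.integral_eq_one, mul_one]
        rw [this]
        exact (hρ.integrable_of_hasCompactSupport (hasCompactSupport_density_mul hg.2)).norm
      have i2 : Integrable g := hg.1.continuous.integrable_of_hasCompactSupport hg.2
      refine ⟨i1.sub i2, ?_⟩
      change ∫ z : E d × E d, (density g z.1 * M z - g z) = 0
      rw [integral_sub i1 i2, Measure.volume_eq_prod, integral_prod _ i1, integral_prod _ i2,
        sub_eq_zero]
      refine integral_congr_ae (.of_forall fun x => ?_)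
      simp only
      rw [integral_const_mul, hM.integral_eq_one, mul_one]; rfl
  change ∫ z, (-transportOp G g z + collisionOp L M g z) = 0
  rw [integral_add (f := fun z => -transportOp G g z) hTi.neg hcoll.1, integral_neg, hT, hcoll.2]
  simp

end Energy

end Kinetic

end

/-! ### The velocity moment matrix of f∞ and its inverse. -/

noncomputable section

namespace Kinetic

variable {d : ℕ}

/-- Inversion of a uniformly coercive matrix depending on a parameter. -/
theorem exists_inverse_matrix {n : ℕ} {X : Type*} [NormedAddCommGroup X] [NormedSpace ℝ X]
    {N : Fin n → Fin n → X → ℝ} (hN : ∀ i k, ContDiff ℝ 1 (N i k)) {c : ℝ} (hc : 0 < c)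
    (hpos : ∀ x (ξ : Fin n → ℝ), c * ∑ i, ξ i ^ 2 ≤ ∑ i, ∑ k, N i k x * (ξ i * ξ k)) :
    ∃ b : Fin n → Fin n → X → ℝ, (∀ k j, ContDiff ℝ 1 (b k j)) ∧
      (∀ x i j, ∑ k, N i k x * b k j x = if i = j then 1 else 0) ∧
      (∀ x k j, |b k j x| ≤ 1 / c) ∧
      ∀ x y k j, |fderiv ℝ (b k j) x y| ≤ 1 / c ^ 2 * ∑ i, ∑ k, |fderiv ℝ (N i k) x y| := by
  let R : Fin n → Fin n → E n →L[ℝ] E n := fun i k =>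
    (EuclideanSpace.proj k : E n →L[ℝ] ℝ).smulRight (EuclideanSpace.single i 1)
  have hR : ∀ i k, ‖R i k‖ ≤ 1 := fun i k => by
    refine ContinuousLinearMap.opNorm_le_bound _ zero_le_one fun ξ => ?_
    have : ‖(EuclideanSpace.single i 1 : E n)‖ = 1 := by simp
    rw [ContinuousLinearMap.smulRight_apply, norm_smul, this, mul_one, one_mul]
    exact PiLp.norm_apply_le ξ k
  let K : X → E n →L[ℝ] E n := fun x => ∑ i, ∑ k, N i k x • R i k
  have hKc : ContDiff ℝ 1 K := ContDiff.sum fun i _ => ContDiff.sum fun k _ =>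
    (hN i k).smul contDiff_const
  have hKapp : ∀ x ξ i, K x ξ i = ∑ k, N i k x * ξ k := fun x ξ i => by
    simp [K, R, Finset.sum_apply, Pi.single_apply]
  -- Coercivity of the quadratic form and Cauchy-Schwarz bound K(x) from below; symmetry of the
  -- matrix is not needed.
  have hcoer : ∀ x ξ, c * ‖ξ‖ ≤ ‖K x ξ‖ := fun x ξ => by
    have h1 : c * ‖ξ‖ ^ 2 ≤ inner ℝ (K x ξ) ξ := by
      rw [EuclideanSpace.real_norm_sq_eq]
      refine (hpos x ξ).trans (le_of_eq ?_)
      rw [PiLp.inner_apply]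
      refine Finset.sum_congr rfl fun i _ => ?_
      rw [hKapp]
      simp only [RCLike.inner_apply, conj_trivial, Finset.mul_sum]
      exact Finset.sum_congr rfl fun k _ => by ring
    rcases eq_or_ne ξ 0 with rfl | hξ
    · simp
    · have h2 := real_inner_le_norm (K x ξ) ξ
      have h3 : 0 < ‖ξ‖ := norm_pos_iff.2 hξ
      refine le_of_mul_le_mul_right ?_ h3
      calc c * ‖ξ‖ * ‖ξ‖ = c * ‖ξ‖ ^ 2 := by ring
        _ ≤ _ := h1.trans h2
  have hunit : ∀ x, IsUnit (K x) := fun x => by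
    have hinj : Function.Injective (K x).toLinearMap := by
      rw [← LinearMap.ker_eq_bot, LinearMap.ker_eq_bot']
      intro ξ hξ
      have h := hcoer x ξ
      have h0 : K x ξ = 0 := hξ
      rw [h0, norm_zero] at h
      have : ‖ξ‖ ≤ 0 := by
        by_contra hcon
        exact absurd h (not_le.2 (mul_pos hc (not_le.1 hcon)))
      exact norm_le_zero_iff.1 this
    exact ContinuousLinearMap.isUnit_iff_bijective.2
      ⟨hinj, LinearMap.injective_iff_surjective.1 hinj⟩
  let B : X → E n →L[ℝ] E n := fun x => Ring.inverse (K x)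
  have hKB : ∀ x ξ, K x (B x ξ) = ξ := fun x ξ => by
    have := Ring.mul_inverse_cancel _ (hunit x)
    exact DFunLike.congr_fun this ξ
  have hB : ∀ x, ‖B x‖ ≤ 1 / c := fun x =>
    ContinuousLinearMap.opNorm_le_bound _ (by positivity) fun ξ => by
      have := hcoer x (B x ξ)
      rw [hKB] at this
      rw [one_div, inv_mul_eq_div, le_div_iff₀ hc]; linarith
  -- The derivative of the inverse is −K⁻¹ (DK) K⁻¹; the two inverse factors produce 1/c².
  have hBd : ∀ x, ∃ D, HasFDerivAt B D x ∧ ∀ y, D y = -(B x * fderiv ℝ K x y * B x) :=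
    fun x => by
    obtain ⟨u, hu⟩ := hunit x
    have h1 := hasFDerivAt_ringInverse (𝕜 := ℝ) u
    have h2 : B x = ↑u⁻¹ := by simp only [B, ← hu, Ring.inverse_unit]
    rw [hu] at h1
    refine ⟨_, h1.comp x (hKc.differentiable (by norm_num) x).hasFDerivAt, fun y => ?_⟩
    rw [h2]; rfl
  have hBc : ContDiff ℝ 1 B := contDiff_iff_contDiffAt.2 fun x => by
    obtain ⟨u, hu⟩ := hunit x
    have h1 := contDiffAt_ringInverse ℝ (n := 1) u
    rw [hu] at h1
    exact h1.comp x hKc.contDiffAt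
  let P : Fin n → Fin n → (E n →L[ℝ] E n) →L[ℝ] ℝ := fun k j =>
    (EuclideanSpace.proj k : E n →L[ℝ] ℝ).comp
      (ContinuousLinearMap.apply ℝ (E n) (EuclideanSpace.single j (1 : ℝ)))
  have hP : ∀ k j S, |P k j S| ≤ ‖S‖ := fun k j S => by
    refine (PiLp.norm_apply_le (S (EuclideanSpace.single j 1)) k).trans ?_
    refine (S.le_opNorm _).trans ?_
    simp
  refine ⟨fun k j x => P k j (B x), fun k j => (P k j).contDiff.comp (f := B) hBc, fun x i j => ?_,
    fun x k j => (hP k j _).trans (hB x), fun x y k j => ?_⟩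
  · have := congrArg (fun w : E n => w i) (hKB x (EuclideanSpace.single j 1))
    simp only [hKapp] at this
    refine Eq.trans ?_ (this.trans ?_)
    · rfl
    · simp
  · obtain ⟨D, hD, hDy⟩ := hBd x
    have h := ((P k j).hasFDerivAt.comp x hD).fderiv
    have h' : fderiv ℝ (fun x => P k j (B x)) x = _ := h
    have hK' : ‖fderiv ℝ K x y‖ ≤ ∑ i, ∑ k, |fderiv ℝ (N i k) x y| := by
      have : fderiv ℝ K x y = ∑ i, ∑ k, fderiv ℝ (N i k) x y • R i k := by
        have hd : HasFDerivAt K (∑ i, ∑ k, (fderiv ℝ (N i k) x).smulRight (R i k)) x :=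
          HasFDerivAt.fun_sum fun i _ => HasFDerivAt.fun_sum fun k _ =>
            ((hN i k).differentiable (by norm_num) x).hasFDerivAt.smul_const (R i k)
        rw [hd.fderiv]
        simp
      rw [this]
      refine (norm_sum_le _ _).trans (Finset.sum_le_sum fun i _ => (norm_sum_le _ _).trans
        (Finset.sum_le_sum fun k _ => ?_))
      rw [norm_smul]
      exact mul_le_of_le_one_right (norm_nonneg _) (hR i k)
    rw [h']
    refine (hP k j (D y)).trans ?_
    rw [hDy]
    calc ‖-(B x * fderiv ℝ K x y * B x)‖ ≤ ‖B x‖ * ‖fderiv ℝ K x y‖ * ‖B x‖ := by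
          rw [norm_neg]
          exact (norm_mul_le _ _).trans (mul_le_mul_of_nonneg_right (norm_mul_le _ _)
            (norm_nonneg _))
      _ ≤ 1 / c * ‖fderiv ℝ K x y‖ * (1 / c) := by
          have := hB x
          gcongr
      _ = 1 / c ^ 2 * ‖fderiv ℝ K x y‖ := by ring
      _ ≤ _ := by gcongr

/-- The velocity cut-off. -/
def velBump (d : ℕ) : ContDiffBump (0 : E d) := ⟨1 / 2, 1, by norm_num, by norm_num⟩

/-- The space-time velocity `(1, v)`. -/
def vel (v : E d) (i : Fin (d + 1)) : ℝ := Fin.cases 1 (fun j => v j) i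

/-- The components of `(1, v)` cut off in velocity. -/
def velTest (i : Fin (d + 1)) (v : E d) : ℝ := vel v i * velBump d v

theorem contDiff_vel (i : Fin (d + 1)) {n : WithTop ℕ∞} : ContDiff ℝ n fun v : E d => vel v i := by
  refine Fin.cases contDiff_const (fun j => ?_) i
  exact (contDiff_piLp 2).1 contDiff_id j

theorem contDiff_velTest (i : Fin (d + 1)) : ContDiff ℝ ∞ (velTest i : E d → ℝ) :=
  (contDiff_vel i).mul (velBump d).contDiff

theorem velBump_eq_zero {v : E d} (hv : 1 ≤ ‖v‖) : velBump d v = 0 :=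
  (velBump d).zero_of_le_dist (by simpa [velBump] using hv)

theorem velTest_eq_zero {v : E d} (hv : 1 ≤ ‖v‖) (i : Fin (d + 1)) : velTest i v = 0 := by
  simp [velTest, velBump_eq_zero hv]

theorem abs_vel_le {v : E d} (hv : ‖v‖ ≤ 1) (i : Fin (d + 1)) : |vel v i| ≤ 1 := by
  refine Fin.cases ?_ (fun j => ?_) i
  · simp [vel]
  · exact (PiLp.norm_apply_le v j).trans hv

theorem abs_velTest_le (v : E d) (i : Fin (d + 1)) : |velTest i v| ≤ 1 := by
  rcases le_total ‖v‖ 1 with hv | hv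
  · rw [velTest, abs_mul, abs_of_nonneg (velBump d).nonneg]
    exact mul_le_one₀ (abs_vel_le hv i) (velBump d).nonneg (velBump d).le_one
  · simp [velTest_eq_zero hv]

theorem integrable_velBump_mul {f : E d → ℝ} (hf : Continuous f) :
    Integrable fun v => velBump d v * f v :=
  ((velBump d).continuous.mul hf).integrable_of_hasCompactSupport
    ((velBump d).hasCompactSupport.mul_right)

/-- Nondegeneracy of the moments `1, v` on the unit ball. -/
theorem exists_moment_coercive (d : ℕ) : ∃ κ : ℝ, 0 < κ ∧ ∀ ξ : Fin (d + 1) → ℝ,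
    κ * ∑ i, ξ i ^ 2 ≤ ∫ v : E d, velBump d v * (∑ i, ξ i * vel v i) ^ 2 := by
  let q : (Fin (d + 1) → ℝ) → ℝ := fun ξ => ∫ v : E d, velBump d v * (∑ i, ξ i * vel v i) ^ 2
  have hvc : ∀ i, Continuous fun v : E d => vel v i := fun i => (contDiff_vel i (n := 0)).continuous
  have hqexp : q = fun ξ => ∑ i, ∑ k, (∫ v : E d, velBump d v * (vel v i * vel v k)) *
      (ξ i * ξ k) := by
    funext ξ
    have : ∀ v : E d, velBump d v * (∑ i, ξ i * vel v i) ^ 2 =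
        ∑ i, ∑ k, (velBump d v * (vel v i * vel v k)) * (ξ i * ξ k) := fun v => by
      rw [pow_two, Finset.sum_mul_sum, Finset.mul_sum]
      refine Finset.sum_congr rfl fun i _ => ?_
      rw [Finset.mul_sum]
      exact Finset.sum_congr rfl fun k _ => by ring
    simp only [q, this]
    have hint : ∀ i k, Integrable fun v : E d =>
        (velBump d v * (vel v i * vel v k)) * (ξ i * ξ k) := fun i k =>
      (integrable_velBump_mul ((hvc i).mul (hvc k))).mul_const _
    rw [integral_finsetSum _ fun i _ => integrable_finsetSum _ fun k _ => hint i k]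
    refine Finset.sum_congr rfl fun i _ => ?_
    rw [integral_finsetSum _ fun k _ => hint i k]
    exact Finset.sum_congr rfl fun k _ => integral_mul_const _ _
  have hqc : Continuous q := by rw [hqexp]; fun_prop
  -- If the form vanishes at ξ, the affine function ξ_0 + ∑ ξ_j v_j is zero on the open unit ball.
  -- Its values at 0 and at half the coordinate vectors give ξ = 0.
  have hq0 : ∀ ξ, ξ ≠ 0 → 0 < q ξ := by
    intro ξ hξ
    have hcont : Continuous fun v : E d => velBump d v * (∑ i, ξ i * vel v i) ^ 2 :=
      (velBump d).continuous.mul ((continuous_finsetSum _ fun i _ =>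
        continuous_const.mul (hvc i)).pow 2)
    have hnn : ∀ v : E d, 0 ≤ velBump d v * (∑ i, ξ i * vel v i) ^ 2 := fun v =>
      mul_nonneg (velBump d).nonneg (sq_nonneg _)
    by_contra hcon
    have hz : q ξ = 0 := le_antisymm (not_lt.1 hcon) (integral_nonneg hnn)
    have hall : ∀ v : E d, velBump d v * (∑ i, ξ i * vel v i) ^ 2 = 0 := by
      intro v
      by_contra hv
      exact (hcont.integral_pos_of_hasCompactSupport_nonneg_nonzero
        ((velBump d).hasCompactSupport.mul_right) hnn (μ := volume) hv).ne' hz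
    have hlin : ∀ v : E d, ‖v‖ < 1 → ∑ i, ξ i * vel v i = 0 := fun v hv => by
      have hb : 0 < velBump d v := (velBump d).pos_of_mem_ball (by simpa [velBump] using hv)
      have := hall v
      rcases mul_eq_zero.1 this with h | h
      · exact absurd h hb.ne'
      · exact pow_eq_zero_iff (two_ne_zero) |>.1 h
    have h0 : ξ 0 = 0 := by
      have := hlin 0 (by simp)
      rw [Fin.sum_univ_succ] at this
      simpa [vel] using this
    apply hξ
    funext i
    refine Fin.cases h0 (fun j => ?_) i
    have := hlin (EuclideanSpace.single j (1 / 2)) (by simp; norm_num)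
    rw [Fin.sum_univ_succ, h0] at this
    simpa [vel, Pi.single_apply] using this
  have hS : IsCompact (Metric.sphere (0 : Fin (d + 1) → ℝ) 1) := isCompact_sphere 0 1
  have hne : (Metric.sphere (0 : Fin (d + 1) → ℝ) 1).Nonempty :=
    NormedSpace.sphere_nonempty.2 zero_le_one
  obtain ⟨ξ₀, hξ₀, hmin⟩ := hS.exists_isMinOn hne hqc.continuousOn
  have hξ₀' : ξ₀ ≠ 0 := by
    rintro rfl; simp at hξ₀
  -- The minimum is over the sphere of the sup norm, and ∑ ξ_i² ≤ (d + 1)‖ξ‖² for that norm.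
  refine ⟨q ξ₀ / (d + 1), div_pos (hq0 _ hξ₀') (by positivity), fun ξ => ?_⟩
  rcases eq_or_ne ξ 0 with rfl | hξ
  · simp
  · have hn : 0 < ‖ξ‖ := norm_pos_iff.2 hξ
    have hsph : ‖ξ‖⁻¹ • ξ ∈ Metric.sphere (0 : Fin (d + 1) → ℝ) 1 := by
      simp [norm_smul, hn.ne']
    have h1 : q ξ₀ ≤ q (‖ξ‖⁻¹ • ξ) := hmin hsph
    have h2 : q (‖ξ‖⁻¹ • ξ) = ‖ξ‖⁻¹ ^ 2 * q ξ := by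
      simp only [q]
      rw [← integral_const_mul]
      congr 1; funext v
      have : ∑ i, (‖ξ‖⁻¹ • ξ) i * vel v i = ‖ξ‖⁻¹ * ∑ i, ξ i * vel v i := by
        rw [Finset.mul_sum]
        exact Finset.sum_congr rfl fun i _ => by simp [mul_assoc]
      rw [this]; ring
    have h3 : ∑ i, ξ i ^ 2 ≤ (d + 1) * ‖ξ‖ ^ 2 := by
      calc ∑ i, ξ i ^ 2 ≤ ∑ _i : Fin (d + 1), ‖ξ‖ ^ 2 := Finset.sum_le_sum fun i _ => by
            rw [← sq_abs]
            exact pow_le_pow_left₀ (abs_nonneg _) (norm_le_pi_norm ξ i) 2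
        _ = _ := by simp
    have h4 : q ξ₀ * ‖ξ‖ ^ 2 ≤ q ξ := by
      rw [h2] at h1
      calc q ξ₀ * ‖ξ‖ ^ 2 ≤ (‖ξ‖⁻¹ ^ 2 * q ξ) * ‖ξ‖ ^ 2 := by gcongr
        _ = q ξ := by field_simp
    calc q ξ₀ / (d + 1) * ∑ i, ξ i ^ 2 ≤ q ξ₀ / (d + 1) * ((d + 1) * ‖ξ‖ ^ 2) :=
          mul_le_mul_of_nonneg_left h3 (div_pos (hq0 _ hξ₀') (by positivity)).le
      _ = q ξ₀ * ‖ξ‖ ^ 2 := by field_simp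
      _ ≤ q ξ := h4

/-- The quotient rule for an entry p of the inverse matrix divided by r = ⟨f∞⟩. I will be the
profile variation, W the logarithmic gradient, and D counts matrix entries. -/
theorem abs_quotient_derivative_le {r p p' q' c D I W : ℝ} (hr : 0 < r) (hc : 0 < c) (hD : 0 ≤ D)
    (hI : 0 ≤ I) (hW : 0 ≤ W) (hp : |p| ≤ 1 / c) (hp' : |p'| ≤ 1 / c ^ 2 * (D * I))
    (hq' : |q'| ≤ r * W) :
    |p' / r - p * q' / r ^ 2| ≤ (1 / c + 1 / c ^ 2 * D) / r * (I + W) := by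
  have h1 : 0 ≤ 1 / c * I := by positivity
  have h2 : 0 ≤ 1 / c ^ 2 * D * W := by positivity
  calc |p' / r - p * q' / r ^ 2| ≤ |p' / r| + |p * q' / r ^ 2| := abs_sub _ _
    _ ≤ 1 / c ^ 2 * (D * I) / r + 1 / c * (r * W) / r ^ 2 := by
        rw [abs_div, abs_div, abs_mul, abs_of_pos hr, abs_of_pos (pow_pos hr 2)]
        gcongr
    _ = (1 / c ^ 2 * D * I + 1 / c * W) / r := by field_simp
    _ ≤ ((1 / c + 1 / c ^ 2 * D) * (I + W)) / r := by
        refine div_le_div_of_nonneg_right ?_ hr.le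
        linarith
    _ = _ := by ring

/-- The moments of `f∞ / ⟨f∞⟩` on the unit ball. -/
def momentKernel (fInf : E d × E d → ℝ) (i k : Fin (d + 1)) (z : E d × E d) : ℝ :=
  fInf z / density fInf z.1 * (vel z.2 i * velTest k z.2)

/-- Coefficients dual to the velocity moments of `f∞`, with uniform bounds. -/
theorem exists_dual_coeffs (d : ℕ) {cInf : ℝ} (hc : 0 < cInf) : ∃ C : ℝ, 0 < C ∧
    ∀ (L : Collision) (G : E d × E d → E d) (M fInf : E d × E d → ℝ) (cM : ℝ),
      IsStationaryState L G M fInf cInf cM →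
      ∃ a : Fin (d + 1) → Fin (d + 1) → E d → ℝ, (∀ j k, ContDiff ℝ 1 (a j k)) ∧
        (∀ x i j, ∑ k, a j k x * ∫ v, fInf (x, v) * (vel v i * velTest k v) =
          if i = j then 1 else 0) ∧
        (∀ x j k, |a j k x| ≤ C / density fInf x) ∧
        ∀ x j k (i : Fin d), |fderiv ℝ (a j k) x (EuclideanSpace.single i 1)| ≤
          C / density fInf x * ((∫ v in Metric.closedBall (0 : E d) 1,
            ‖gradX (fun z => fInf z / density fInf z.1) (x, v)‖) +
            ‖(density fInf x)⁻¹ • gradient (density fInf) x‖) := by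
  obtain ⟨κ, hκ, hmom⟩ := exists_moment_coercive d
  -- On the unit ball f∞/⟨f∞⟩ is at least c∞, so its moment matrix dominates c∞ times that of the
  -- bump alone.
  set c := cInf * κ with hcdef
  have hcpos : 0 < c := mul_pos hc hκ
  refine ⟨1 / c + 1 / c ^ 2 * ((d + 1) * (d + 1)), by positivity, fun L G M fInf cM hS => ?_⟩
  have hρ := hS.density_pos hc
  have hm : ContDiff ℝ 1 fun z : E d × E d => fInf z / density fInf z.1 :=
    hS.contDiff.div (hS.contDiff_density.comp contDiff_fst) fun z => (hρ z.1).ne'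
  have hφ : ∀ i k, ContDiff ℝ 1 fun z : E d × E d => vel z.2 i * velTest k z.2 := fun i k =>
    ((contDiff_vel i).comp contDiff_snd).mul (((contDiff_velTest k).of_le (by norm_cast)).comp
      contDiff_snd)
  have hk : ∀ i k, ContDiff ℝ 1 (momentKernel fInf i k) := fun i k => hm.mul (hφ i k)
  have hkR : ∀ i k, VelocityBounded 1 (momentKernel fInf i k) := fun i k z hz => by
    simp [momentKernel, velTest_eq_zero hz.le]
  let N : Fin (d + 1) → Fin (d + 1) → E d → ℝ := fun i k => density (momentKernel fInf i k)
  have hN : ∀ i k, ContDiff ℝ 1 (N i k) := fun i k => contDiff_density (hk i k) (hkR i k)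
  have hpos : ∀ x (ξ : Fin (d + 1) → ℝ), c * ∑ i, ξ i ^ 2 ≤
      ∑ i, ∑ k, N i k x * (ξ i * ξ k) := by
    intro x ξ
    have hint : ∀ i k, Integrable fun v => momentKernel fInf i k (x, v) * (ξ i * ξ k) := fun i k =>
      ((hkR i k).integrable (hk i k).continuous x).mul_const _
    have e : ∑ i, ∑ k, N i k x * (ξ i * ξ k) = ∫ v,
        fInf (x, v) / density fInf x * (velBump d v * (∑ i, ξ i * vel v i) ^ 2) := by
      have : ∀ v, fInf (x, v) / density fInf x * (velBump d v * (∑ i, ξ i * vel v i) ^ 2) =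
          ∑ i, ∑ k, momentKernel fInf i k (x, v) * (ξ i * ξ k) := fun v => by
        rw [pow_two, Finset.sum_mul_sum, Finset.mul_sum, Finset.mul_sum]
        refine Finset.sum_congr rfl fun i _ => ?_
        rw [Finset.mul_sum, Finset.mul_sum]
        exact Finset.sum_congr rfl fun k _ => by simp only [momentKernel, velTest]; ring
      simp only [this]
      rw [integral_finsetSum _ fun i _ => integrable_finsetSum _ fun k _ => hint i k]
      refine Finset.sum_congr rfl fun i _ => ?_
      rw [integral_finsetSum _ fun k _ => hint i k]
      exact Finset.sum_congr rfl fun k _ => (integral_mul_const _ _).symm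
    have hvc : Continuous fun v : E d => (∑ i, ξ i * vel v i) ^ 2 :=
      (continuous_finsetSum _ fun i _ => continuous_const.mul
        (contDiff_vel i (n := 0)).continuous).pow 2
    rw [e, hcdef, mul_assoc]
    refine (mul_le_mul_of_nonneg_left (hmom ξ) hc.le).trans ?_
    rw [← integral_const_mul]
    have hc2 : Continuous fun v => fInf (x, v) / density fInf x *
        (velBump d v * (∑ i, ξ i * vel v i) ^ 2) :=
      (continuous_slice hm.continuous x).mul ((velBump d).continuous.mul hvc)
    refine integral_mono ((integrable_velBump_mul hvc).const_mul _)
      (hc2.integrable_of_hasCompactSupport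
        ((velBump d).hasCompactSupport.mul_right.mul_left)) fun v => ?_
    rcases le_total ‖v‖ 1 with hv | hv
    · exact mul_le_mul_of_nonneg_right (hS.lower_bound x v hv)
        (mul_nonneg (velBump d).nonneg (sq_nonneg _))
    · simp [velBump_eq_zero hv]
  obtain ⟨b, hb, hinv, hbb, hbd⟩ := exists_inverse_matrix hN hcpos hpos
  -- Dividing the transposed inverse by ⟨f∞⟩ passes from moments of f∞/⟨f∞⟩ to moments of f∞.
  refine ⟨fun j k x => b k j x / density fInf x,
    fun j k => (hb k j).div hS.contDiff_density fun x => (hρ x).ne', fun x i j => ?_,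
    fun x j k => ?_, fun x j k i => ?_⟩
  · rw [← hinv x i j]
    refine Finset.sum_congr rfl fun k _ => ?_
    have : N i k x = (density fInf x)⁻¹ * ∫ v, fInf (x, v) * (vel v i * velTest k v) := by
      rw [← integral_const_mul]
      refine integral_congr_ae (.of_forall fun v => ?_)
      simp only [momentKernel]; ring
    rw [this]; ring
  · rw [abs_div, abs_of_pos (hρ x)]
    refine div_le_div_of_nonneg_right ((hbb x k j).trans ?_) (hρ x).le
    have : 0 ≤ 1 / c ^ 2 * (((d : ℝ) + 1) * (d + 1)) := by positivity
    linarith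
  · set I := ∫ v in Metric.closedBall (0 : E d) 1,
      ‖gradX (fun z => fInf z / density fInf z.1) (x, v)‖ with hI
    have hI0 : 0 ≤ I := integral_nonneg fun v => norm_nonneg _
    have hgm : Continuous fun v : E d => gradX (fun z => fInf z / density fInf z.1) (x, v) := by
      have : (fun v : E d => gradX (fun z => fInf z / density fInf z.1) (x, v)) = fun v =>
          WithLp.toLp 2 fun i => dX i (fun z => fInf z / density fInf z.1) (x, v) := by
        funext v; ext i; exact gradX_apply (hm.differentiable (by norm_num) _) i
      rw [this]
      exact (PiLp.continuous_toLp 2 _).comp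
        (continuous_pi fun i => continuous_slice (continuous_dX hm i) x)
    -- In the moment kernel only f∞/⟨f∞⟩ depends on x. Its velocity factor is at most 1 on the ball
    -- and vanishes outside.
    have hNd : ∀ l k, |fderiv ℝ (N l k) x (EuclideanSpace.single i 1)| ≤ I := by
      intro l k
      rw [fderiv_density_apply (hk l k) (hkR l k), ← setIntegral_eq_integral_of_forall_compl_eq_zero
        (s := Metric.closedBall (0 : E d) 1)
        (fun v hv => ((hkR l k).dX i) (x, v) (by simpa using hv))]
      refine (norm_integral_le_integral_norm (G := ℝ) _).trans ?_
      refine setIntegral_mono_on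
        ((continuous_slice (continuous_dX (hk l k) i) x).norm.continuousOn.integrableOn_compact
          (isCompact_closedBall _ _))
        (hgm.norm.continuousOn.integrableOn_compact (isCompact_closedBall _ _))
        measurableSet_closedBall fun v hv => ?_
      have hv1 : ‖v‖ ≤ 1 := by simpa using hv
      have e : dX i (momentKernel fInf l k) (x, v) =
          (vel v l * velTest k v) * dX i (fun z => fInf z / density fInf z.1) (x, v) := by
        have h0 : dX i (fun z : E d × E d => vel z.2 l * velTest k z.2) (x, v) = 0 := by
          have := (hasFDerivAt_sliceX (z := (x, v))
            ((hφ l k).differentiable (by norm_num) (x, v))).unique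
              (hasFDerivAt_const (vel v l * velTest k v) x)
          have h2 := DFunLike.congr_fun this (EuclideanSpace.single i (1 : ℝ))
          simpa [dX] using h2
        have := dX_mul (hm.differentiable (by norm_num) (x, v))
          ((hφ l k).differentiable (by norm_num) (x, v)) i
        rw [h0, mul_zero, zero_add] at this
        exact this
      rw [e, norm_mul, ← gradX_apply (hm.differentiable (by norm_num) _)]
      calc _ ≤ 1 * ‖gradX (fun z => fInf z / density fInf z.1) (x, v)‖ := by
            refine mul_le_mul ?_ (PiLp.norm_apply_le _ i) (norm_nonneg _) zero_le_one
            rw [Real.norm_eq_abs, abs_mul]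
            exact mul_le_one₀ (abs_vel_le hv1 l) (abs_nonneg _) (abs_velTest_le v k)
        _ = _ := one_mul _
    have hsum : ∑ l, ∑ k, |fderiv ℝ (N l k) x (EuclideanSpace.single i 1)| ≤
        (d + 1) * (d + 1) * I := by
      refine (Finset.sum_le_sum fun l _ => Finset.sum_le_sum fun k _ => hNd l k).trans ?_
      simp [mul_assoc]
    have hbd' := (hbd x (EuclideanSpace.single i 1) k j).trans
      (mul_le_mul_of_nonneg_left hsum (by positivity))
    have hgrad : |fderiv ℝ (density fInf) x (EuclideanSpace.single i 1)| ≤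
        density fInf x * ‖(density fInf x)⁻¹ • gradient (density fInf) x‖ := by
      rw [norm_smul, norm_inv, Real.norm_of_nonneg (hρ x).le, ← mul_assoc,
        mul_inv_cancel₀ (hρ x).ne', one_mul, ← gradient_apply]
      exact PiLp.norm_apply_le (gradient (density fInf) x) i
    have hder : fderiv ℝ (fun x => b k j x / density fInf x) x (EuclideanSpace.single i 1) =
        fderiv ℝ (b k j) x (EuclideanSpace.single i 1) / density fInf x -
        b k j x * fderiv ℝ (density fInf) x (EuclideanSpace.single i 1) / density fInf x ^ 2 := by
      have hq : DifferentiableAt ℝ (fun x => b k j x / density fInf x) x :=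
        ((hb k j).div hS.contDiff_density fun x => (hρ x).ne').differentiable (by norm_num) x
      have h2 := fderiv_fun_mul hq (hS.contDiff_density.differentiable (by norm_num) x)
      have e : (fun y => b k j y / density fInf y * density fInf y) = b k j := by
        funext y; exact div_mul_cancel₀ _ (hρ y).ne'
      rw [e] at h2
      rw [h2]
      have := (hρ x).ne'
      simp only [add_apply, smul_apply, smul_eq_mul]
      field_simp
      ring
    rw [hder]
    exact abs_quotient_derivative_le (hρ x) hcpos (by positivity) hI0 (norm_nonneg _) (hbb x k j)
      hbd' hgrad

end Kinetic

end

/-! ### The weighted space, the projection onto local equilibria, and passage to the closed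
operator. -/

noncomputable section

namespace Kinetic

variable {d : ℕ}

/-- A positive continuous integrable function with a positive continuous spatial density. -/
structure IsEquilibrium (fInf : E d × E d → ℝ) : Prop where
  pos : ∀ z, 0 < fInf z
  continuous : Continuous fInf
  integrable : Integrable fInf
  integrable_slice : ∀ x, Integrable fun v => fInf (x, v)
  density_pos : ∀ x, 0 < density fInf x
  continuous_density : Continuous (density fInf)

theorem IsStationaryState.isEquilibrium {L : Collision} {G : E d × E d → E d}
    {M fInf : E d × E d → ℝ} {cInf cM : ℝ} (hS : IsStationaryState L G M fInf cInf cM)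
    (hc : 0 < cInf) : IsEquilibrium fInf :=
  ⟨hS.pos, hS.contDiff.continuous, hS.integrable, (hS.regular hc).integrable,
    hS.density_pos hc, hS.contDiff_density.continuous⟩

namespace IsEquilibrium

variable {fInf : E d × E d → ℝ}

theorem measurable_weight (hE : IsEquilibrium fInf) :
    Measurable fun z => ENNReal.ofReal (1 / fInf z) :=
  (measurable_const.div hE.continuous.measurable).ennreal_ofReal

instance sigmaFinite_weightedMeasure : SigmaFinite (weightedMeasure fInf) :=
  SigmaFinite.withDensity_of_ne_top
    (.of_forall fun _ => ENNReal.ofReal_ne_top)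

theorem absolutelyContinuous : weightedMeasure fInf ≪ volume :=
  withDensity_absolutelyContinuous _ _

theorem absolutelyContinuous' (hE : IsEquilibrium fInf) : volume ≪ weightedMeasure fInf :=
  withDensity_absolutelyContinuous' hE.measurable_weight.aemeasurable
    (.of_forall fun z => by simpa using hE.pos z)

theorem integral_weighted (hE : IsEquilibrium fInf) (F : E d × E d → ℝ) :
    ∫ z, F z ∂weightedMeasure fInf = ∫ z, F z / fInf z := by
  rw [weightedMeasure, integral_withDensity_eq_integral_toReal_smul hE.measurable_weight
    (.of_forall fun _ => ENNReal.ofReal_lt_top)]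
  refine integral_congr_ae (.of_forall fun z => ?_)
  simp only
  rw [ENNReal.toReal_ofReal (one_div_nonneg.2 (hE.pos z).le), smul_eq_mul]; ring

theorem integrable_weighted (hE : IsEquilibrium fInf) (F : E d × E d → ℝ) :
    Integrable F (weightedMeasure fInf) ↔ Integrable fun z => F z / fInf z := by
  rw [weightedMeasure, integrable_withDensity_iff hE.measurable_weight
    (.of_forall fun _ => ENNReal.ofReal_lt_top)]
  refine integrable_congr (.of_forall fun z => ?_)
  simp only
  rw [ENNReal.toReal_ofReal (one_div_nonneg.2 (hE.pos z).le)]; ring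

theorem memLp_iff (hE : IsEquilibrium fInf) {F : E d × E d → ℝ}
    (hF : AEStronglyMeasurable F volume) :
    MemLp F 2 (weightedMeasure fInf) ↔ Integrable fun z => F z ^ 2 / fInf z := by
  rw [memLp_two_iff_integrable_sq (hF.mono_ac absolutelyContinuous), hE.integrable_weighted]

theorem inner_eq (hE : IsEquilibrium fInf) (u w : WL2 fInf) :
    inner ℝ u w = ∫ z, u z * w z / fInf z := by
  rw [L2.inner_def, ← hE.integral_weighted]
  refine integral_congr_ae (.of_forall fun z => ?_)
  simp [mul_comm]

theorem integrable_mul (hE : IsEquilibrium fInf) (u w : WL2 fInf) :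
    Integrable fun z => u z * w z / fInf z := by
  rw [← hE.integrable_weighted]
  refine (L2.integrable_inner (𝕜 := ℝ) u w).congr (.of_forall fun z => ?_)
  simp [mul_comm]

/-- The equilibrium as an element of the weighted space. -/
def toWL2 (hE : IsEquilibrium fInf) : WL2 fInf :=
  MemLp.toLp fInf ((hE.memLp_iff hE.continuous.aestronglyMeasurable).2
    (hE.integrable.congr (.of_forall fun z => by
      have := (hE.pos z).ne'
      field_simp)))

theorem toWL2_coeFn (hE : IsEquilibrium fInf) : hE.toWL2 =ᵐ[weightedMeasure fInf] fInf :=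
  MemLp.coeFn_toLp _

/-- Since f∞ itself lies in the weighted space, pairing with it loses the weight: u f∞/f∞ = u. So
the weighted space embeds in L¹, and total mass is a continuous functional. -/
theorem integrable_coe (hE : IsEquilibrium fInf) (u : WL2 fInf) : Integrable u := by
  refine (hE.integrable_mul u hE.toWL2).congr ?_
  filter_upwards [hE.absolutelyContinuous'.ae_le hE.toWL2_coeFn] with z hz
  rw [hz, mul_div_assoc, div_self (hE.pos z).ne', mul_one]

theorem inner_toWL2 (hE : IsEquilibrium fInf) (u : WL2 fInf) :
    inner ℝ u hE.toWL2 = ∫ z, u z := by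
  rw [hE.inner_eq]
  refine integral_congr_ae ?_
  filter_upwards [hE.absolutelyContinuous'.ae_le hE.toWL2_coeFn] with z hz
  rw [hz, mul_div_assoc, div_self (hE.pos z).ne', mul_one]

theorem measurable_density (u : WL2 fInf) : Measurable (density u) :=
  ((Lp.stronglyMeasurable u).integral_prod_right' (ν := volume)).measurable

theorem density_congr {f g : E d × E d → ℝ} (h : f =ᵐ[volume] g) :
    density f =ᵐ[volume] density g := by
  rw [Measure.volume_eq_prod] at h
  filter_upwards [Measure.ae_ae_of_ae_prod h] with x hx
  exact integral_congr_ae hx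

/-- The macroscopic part of the Cauchy-Schwarz inequality. -/
theorem density_sq_div_le (hE : IsEquilibrium fInf) {f : E d × E d → ℝ} {x : E d}
    (h1 : Integrable fun v => f (x, v)) (h2 : Integrable fun v => f (x, v) ^ 2 / fInf (x, v)) :
    density f x ^ 2 / density fInf x ≤ ∫ v, f (x, v) ^ 2 / fInf (x, v) := by
  set r := density f x / density fInf x with hr
  -- Expanding the square around the multiple r f∞ of the same density gives Cauchy-Schwarz in the
  -- fibre.
  have h0 : 0 ≤ ∫ v, (f (x, v) - r * fInf (x, v)) ^ 2 / fInf (x, v) :=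
    integral_nonneg fun v => div_nonneg (sq_nonneg _) (hE.pos _).le
  have hpt : ∀ v, (f (x, v) - r * fInf (x, v)) ^ 2 / fInf (x, v) =
      f (x, v) ^ 2 / fInf (x, v) - (2 * r) * f (x, v) + r ^ 2 * fInf (x, v) := fun v => by
    have := (hE.pos (x, v)).ne'
    field_simp
    ring
  simp only [hpt] at h0
  rw [integral_add (f := fun v => f (x, v) ^ 2 / fInf (x, v) - (2 * r) * f (x, v))
    (h2.sub (h1.const_mul _)) ((hE.integrable_slice x).const_mul _),
    integral_sub h2 (h1.const_mul _), integral_const_mul, integral_const_mul] at h0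
  have h3 : (∫ v, f (x, v)) = r * density fInf x := by
    rw [hr, div_mul_cancel₀ _ (hE.density_pos x).ne']; rfl
  have h4 : (∫ v, fInf (x, v)) = density fInf x := rfl
  have h5 : density f x = r * density fInf x := h3
  rw [h3, h4] at h0
  have h6 : (r * density fInf x) ^ 2 / density fInf x = r ^ 2 * density fInf x := by
    have := (hE.density_pos x).ne'
    field_simp
  rw [h5, h6]
  linarith

theorem integrable_density_sq (hE : IsEquilibrium fInf) (u : WL2 fInf) :
    Integrable fun x => density u x ^ 2 / density fInf x := by
  have h1 : Integrable u (volume.prod volume) := hE.integrable_coe u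
  have h2 : Integrable (fun z => u z * u z / fInf z) (volume.prod volume) := hE.integrable_mul u u
  refine h2.integral_prod_left.mono' (((measurable_density u).pow_const 2).div
    hE.continuous_density.measurable).aestronglyMeasurable ?_
  filter_upwards [h1.prod_right_ae, h2.prod_right_ae] with x hx1 hx2
  rw [Real.norm_of_nonneg (div_nonneg (sq_nonneg _) (hE.density_pos x).le)]
  simp only [← pow_two] at hx2 ⊢
  exact hE.density_sq_div_le hx1 hx2

/-- The local equilibrium with the same spatial density. -/
def localEquilibrium (fInf f : E d × E d → ℝ) (z : E d × E d) : ℝ :=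
  density f z.1 * (fInf z / density fInf z.1)

theorem measurable_localEquilibrium (hE : IsEquilibrium fInf) (u : WL2 fInf) :
    Measurable (localEquilibrium fInf u) :=
  ((measurable_density u).comp measurable_fst).mul (hE.continuous.measurable.div
    (hE.continuous_density.measurable.comp measurable_fst))

/-- The squared fibre norm is ⟨u⟩²/⟨f∞⟩, which is integrable by the fibrewise Cauchy-Schwarz
inequality. -/
theorem memLp_localEquilibrium (hE : IsEquilibrium fInf) (u : WL2 fInf) :
    MemLp (localEquilibrium fInf u) 2 (weightedMeasure fInf) := by
  have hm := hE.measurable_localEquilibrium u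
  rw [hE.memLp_iff hm.aestronglyMeasurable, Measure.volume_eq_prod]
  have hpt : ∀ x v, localEquilibrium fInf u (x, v) ^ 2 / fInf (x, v) =
      (density u x / density fInf x) ^ 2 * fInf (x, v) := fun x v => by
    have := (hE.pos (x, v)).ne'
    simp only [localEquilibrium]
    field_simp
  have hm2 : AEStronglyMeasurable (fun z => localEquilibrium fInf u z ^ 2 / fInf z)
      (volume.prod volume) :=
    ((hm.pow_const 2).div hE.continuous.measurable).aestronglyMeasurable
  rw [integrable_prod_iff hm2]
  constructor
  · refine .of_forall fun x => ?_
    simp only [hpt]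
    exact (hE.integrable_slice x).const_mul _
  · refine (hE.integrable_density_sq u).congr (.of_forall fun x => ?_)
    simp only [hpt, norm_mul, Real.norm_of_nonneg (hE.pos _).le]
    rw [integral_const_mul, Real.norm_of_nonneg (sq_nonneg _)]
    change _ = _ * density fInf x
    have := (hE.density_pos x).ne'
    field_simp

theorem inner_localEquilibrium (hE : IsEquilibrium fInf) (u w : WL2 fInf) :
    inner ℝ (hE.memLp_localEquilibrium u).toLp w =
      ∫ x, density u x * density w x / density fInf x := by
  have hi := hE.integrable_mul (hE.memLp_localEquilibrium u).toLp w
  have hco := hE.absolutelyContinuous'.ae_le (hE.memLp_localEquilibrium u).coeFn_toLp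
  have hae : (fun z => MemLp.toLp _ (hE.memLp_localEquilibrium u) z * w z / fInf z) =ᵐ[volume]
      fun z => density u z.1 / density fInf z.1 * w z := by
    filter_upwards [hco] with z hz
    rw [hz, localEquilibrium]
    have := (hE.pos z).ne'
    have := (hE.density_pos z.1).ne'
    field_simp
  rw [hE.inner_eq, integral_congr_ae hae, Measure.volume_eq_prod, integral_prod _ (hi.congr hae)]
  refine integral_congr_ae (.of_forall fun x => ?_)
  simp only
  rw [integral_const_mul]
  change _ * density w x = _
  ring

theorem density_localEquilibrium (hE : IsEquilibrium fInf) (u : WL2 fInf) (x : E d) :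
    density (localEquilibrium fInf u) x = density u x := by
  simp only [density, localEquilibrium]
  rw [integral_const_mul, integral_div]
  change _ * (density fInf x / density fInf x) = _
  rw [div_self (hE.density_pos x).ne', mul_one]

theorem density_toLp_localEquilibrium (hE : IsEquilibrium fInf) (u : WL2 fInf) :
    density (hE.memLp_localEquilibrium u).toLp =ᵐ[volume] density u := by
  refine (density_congr (hE.absolutelyContinuous'.ae_le
    (hE.memLp_localEquilibrium u).coeFn_toLp)).trans (.of_forall fun x => ?_)
  exact hE.density_localEquilibrium u x

theorem norm_sq_localEquilibrium (hE : IsEquilibrium fInf) (u : WL2 fInf) :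
    ‖(hE.memLp_localEquilibrium u).toLp‖ ^ 2 = ∫ x, density u x ^ 2 / density fInf x := by
  rw [← real_inner_self_eq_norm_sq, hE.inner_localEquilibrium]
  refine integral_congr_ae ?_
  filter_upwards [hE.density_toLp_localEquilibrium u] with x hx
  rw [hx]; ring

theorem density_linear_coe (hE : IsEquilibrium fInf) (a b : ℝ) (u w : WL2 fInf) :
    density (a • u + b • w : WL2 fInf) =ᵐ[volume] fun x => a * density u x + b * density w x := by
  have h1 : Integrable u (volume.prod volume) := hE.integrable_coe u
  have h2 : Integrable w (volume.prod volume) := hE.integrable_coe w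
  have h3 : (a • u + b • w : WL2 fInf) =ᵐ[volume] fun z => a * u z + b * w z := by
    filter_upwards [hE.absolutelyContinuous'.ae_le (Lp.coeFn_add (a • u) (b • w)),
      hE.absolutelyContinuous'.ae_le (Lp.coeFn_smul a u),
      hE.absolutelyContinuous'.ae_le (Lp.coeFn_smul b w)] with z h1 h2 h3
    rw [h1, Pi.add_apply, h2, h3]; rfl
  filter_upwards [density_congr h3, h1.prod_right_ae, h2.prod_right_ae] with x hx hx1 hx2
  rw [hx, density_linear a b hx1 hx2]

/-- The orthogonal projection onto local equilibria. -/
def proj (hE : IsEquilibrium fInf) : WL2 fInf →L[ℝ] WL2 fInf :=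
  LinearMap.mkContinuous
    { toFun := fun u => (hE.memLp_localEquilibrium u).toLp
      map_add' := fun u w => by
        rw [← MemLp.toLp_add, MemLp.toLp_eq_toLp_iff]
        have h := hE.density_linear_coe 1 1 u w
        simp only [one_smul, one_mul] at h
        refine absolutelyContinuous.ae_le ?_
        have h' := (Measure.quasiMeasurePreserving_fst (μ := (volume : Measure (E d)))
          (ν := (volume : Measure (E d)))).ae h
        filter_upwards [h'] with z hz
        simp only [Pi.add_apply, localEquilibrium, hz]; ring
      map_smul' := fun a u => by
        rw [RingHom.id_apply, ← MemLp.toLp_const_smul, MemLp.toLp_eq_toLp_iff]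
        have h := hE.density_linear_coe a 0 u u
        simp only [zero_smul, add_zero, zero_mul] at h
        refine absolutelyContinuous.ae_le ?_
        have h' := (Measure.quasiMeasurePreserving_fst (μ := (volume : Measure (E d)))
          (ν := (volume : Measure (E d)))).ae h
        filter_upwards [h'] with z hz
        simp only [Pi.smul_apply, localEquilibrium, hz, smul_eq_mul]; ring }
    1 fun u => by
      simp only [LinearMap.coe_mk, AddHom.coe_mk, one_mul]
      set p := (hE.memLp_localEquilibrium u).toLp
      -- A local equilibrium has the same inner product with u as with itself, so Cauchy-Schwarz
      -- gives norm at most 1.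
      have h : ‖p‖ ^ 2 = inner ℝ p u := by
        rw [hE.norm_sq_localEquilibrium, hE.inner_localEquilibrium]
        exact integral_congr_ae (.of_forall fun x => by simp only; ring)
      rcases eq_or_ne p 0 with h0 | h0
      · rw [h0, norm_zero]; exact norm_nonneg _
      · have h1 := real_inner_le_norm p u
        rw [← h, pow_two] at h1
        exact le_of_mul_le_mul_left h1 (norm_pos_iff.2 h0)

theorem proj_coeFn (hE : IsEquilibrium fInf) (u : WL2 fInf) :
    hE.proj u =ᵐ[weightedMeasure fInf] localEquilibrium fInf u :=
  (hE.memLp_localEquilibrium u).coeFn_toLp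

theorem inner_proj (hE : IsEquilibrium fInf) (u w : WL2 fInf) :
    inner ℝ (hE.proj u) w = ∫ x, density u x * density w x / density fInf x :=
  hE.inner_localEquilibrium u w

theorem norm_sq_proj (hE : IsEquilibrium fInf) (u : WL2 fInf) :
    ‖hE.proj u‖ ^ 2 = inner ℝ (hE.proj u) u := by
  rw [inner_proj]
  refine (hE.norm_sq_localEquilibrium u).trans (integral_congr_ae (.of_forall fun x => ?_))
  simp only; ring

theorem norm_sq_sub_proj (hE : IsEquilibrium fInf) (u : WL2 fInf) :
    ‖u - hE.proj u‖ ^ 2 = ‖u‖ ^ 2 - ‖hE.proj u‖ ^ 2 := by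
  rw [norm_sub_sq_real, real_inner_comm, ← hE.norm_sq_proj]; ring

/-- Microscopic coercivity on the closure of the graph. -/
theorem coercive {L : Collision} {G : E d × E d → E d} {M : E d × E d → ℝ} {cInf cM lam1 : ℝ}
    (hE : IsEquilibrium fInf) (hG : ContDiff ℝ ∞ G) (hM : IsBackground L M)
    (hS : IsStationaryState L G M fInf cInf cM) (hc : 0 < cInf)
    (hLC : LocalCoercivity L M fInf lam1) {p : WL2 fInf × WL2 fInf}
    (hp : p ∈ closure (coreGraph L G M fInf)) :
    ‖p.1 - hE.proj p.1‖ ^ 2 ≤ -lam1 * inner ℝ p.1 p.2 := by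
  -- Both sides are continuous in the graph norm, so the estimate on test functions extends to the
  -- whole closed graph.
  have hclosed : IsClosed {p : WL2 fInf × WL2 fInf |
      ‖p.1 - hE.proj p.1‖ ^ 2 ≤ -lam1 * inner ℝ p.1 p.2} :=
    isClosed_le (by fun_prop) (by fun_prop)
  refine closure_minimal ?_ hclosed hp
  rintro ⟨u, w⟩ ⟨g, hg, hu, hw⟩
  have hu' := hE.absolutelyContinuous'.ae_le hu
  have hw' := hE.absolutelyContinuous'.ae_le hw
  have h := core_coercive hG hM hS hc hLC hg
  have h1 : ‖u‖ ^ 2 = ∫ z, g z ^ 2 / fInf z := by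
    rw [← real_inner_self_eq_norm_sq, hE.inner_eq]
    refine integral_congr_ae ?_
    filter_upwards [hu'] with z hz
    rw [hz]; ring
  have h2 : ‖hE.proj u‖ ^ 2 = ∫ x, density g x ^ 2 / density fInf x := by
    rw [hE.norm_sq_proj, inner_proj]
    refine integral_congr_ae ?_
    filter_upwards [density_congr hu'] with x hx
    rw [hx]; ring
  have h3 : inner ℝ u w = ∫ z, g z / fInf z * evolutionOp L G M g z := by
    rw [hE.inner_eq]
    refine integral_congr_ae ?_
    filter_upwards [hu', hw'] with z hz hz'
    rw [hz, hz']; ring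
  simp only [mem_ofPred_eq]
  rw [norm_sq_sub_proj, h1, h2, h3]
  exact h

/-- The inner product with f∞ is total mass; it vanishes on the images of test functions and is
continuous, hence vanishes on the range of the closed operator. -/
theorem mass_conservation {L : Collision} {G : E d × E d → E d} {M : E d × E d → ℝ}
    (hE : IsEquilibrium fInf) (hG : ContDiff ℝ ∞ G) (hM : IsBackground L M)
    {p : WL2 fInf × WL2 fInf} (hp : p ∈ closure (coreGraph L G M fInf)) :
    inner ℝ p.2 hE.toWL2 = 0 := by
  have hclosed : IsClosed {p : WL2 fInf × WL2 fInf | inner ℝ p.2 hE.toWL2 = 0} :=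
    isClosed_eq (by fun_prop) continuous_const
  refine closure_minimal ?_ hclosed hp
  rintro ⟨u, w⟩ ⟨g, hg, hu, hw⟩
  simp only [mem_ofPred_eq]
  rw [hE.inner_toWL2, integral_congr_ae (hE.absolutelyContinuous'.ae_le hw)]
  exact integral_evolutionOp_eq_zero hG hM hg

end IsEquilibrium

end Kinetic

end

/-! ### The space-time Hilbert space: products θ(t)u and pairings with fields. -/

noncomputable section

namespace Kinetic

variable {d : ℕ}

/-- Lebesgue measure on `[0, T]`. -/
abbrev timeMeasure (T : ℝ) : Measure ℝ := volume.restrict (Icc 0 T)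

/-- The weighted space-time-velocity measure. -/
abbrev spaceTimeMeasure (T : ℝ) (fInf : E d × E d → ℝ) : Measure (ℝ × E d × E d) :=
  (timeMeasure T).prod (weightedMeasure fInf)

/-- The weighted space on `[0, T] × ℝ^d × ℝ^d`. -/
abbrev STL2 (T : ℝ) (fInf : E d × E d → ℝ) : Type := Lp ℝ 2 (spaceTimeMeasure T fInf)

theorem volume_restrict_slab (T : ℝ) :
    (volume : Measure (ℝ × E d)).restrict (slab d T) = (timeMeasure T).prod volume := by
  rw [slab, Measure.volume_eq_prod, ← Measure.prod_restrict, Measure.restrict_univ]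

namespace IsEquilibrium

variable {fInf : E d × E d → ℝ} {T : ℝ}

section Tensor

theorem memLp_tensor (θ : C(ℝ, ℝ)) (u : WL2 fInf) :
    MemLp (fun y : ℝ × E d × E d => θ y.1 * u y.2) 2 (spaceTimeMeasure T fInf) := by
  have hm : AEStronglyMeasurable (fun y : ℝ × E d × E d => θ y.1 * u y.2)
      (spaceTimeMeasure T fInf) :=
    ((θ.continuous.stronglyMeasurable.comp_measurable measurable_fst).mul
      ((Lp.stronglyMeasurable u).comp_measurable measurable_snd)).aestronglyMeasurable
  rw [memLp_two_iff_integrable_sq hm]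
  have h1 : Integrable (fun t => θ t ^ 2) (timeMeasure T) :=
    (θ.continuous.pow 2).integrableOn_Icc
  refine (h1.mul_prod (Lp.memLp u).integrable_sq).congr (.of_forall fun y => ?_)
  simp only; ring

theorem inner_tensor_toLp (θ η : C(ℝ, ℝ)) (u w : WL2 fInf) :
    inner ℝ ((memLp_tensor (T := T) θ u).toLp) ((memLp_tensor (T := T) η w).toLp) =
      (∫ t in Icc 0 T, θ t * η t) * inner ℝ u w := by
  rw [L2.inner_def, L2.inner_def]
  have h := integral_prod_mul (μ := timeMeasure T) (ν := weightedMeasure fInf)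
    (fun t => θ t * η t) (fun z => inner ℝ (u z) (w z))
  rw [← h]
  refine integral_congr_ae ?_
  filter_upwards [(memLp_tensor (T := T) θ u).coeFn_toLp,
    (memLp_tensor (T := T) η w).coeFn_toLp] with y h1 h2
  rw [h1, h2]
  simp only [RCLike.inner_apply, conj_trivial]; ring

/-- The product of a function of time and an element of the weighted space. -/
def tensor (T : ℝ) (θ : C(ℝ, ℝ)) : WL2 fInf →L[ℝ] STL2 T fInf :=
  LinearMap.mkContinuous
    { toFun := fun u => (memLp_tensor θ u).toLp
      map_add' := fun u w => by
        rw [← MemLp.toLp_add, MemLp.toLp_eq_toLp_iff]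
        filter_upwards [(Measure.quasiMeasurePreserving_snd (μ := timeMeasure T)
          (ν := weightedMeasure fInf)).ae (Lp.coeFn_add u w)] with y hy
        rw [hy]; simp only [Pi.add_apply]; ring
      map_smul' := fun a u => by
        rw [RingHom.id_apply, ← MemLp.toLp_const_smul, MemLp.toLp_eq_toLp_iff]
        filter_upwards [(Measure.quasiMeasurePreserving_snd (μ := timeMeasure T)
          (ν := weightedMeasure fInf)).ae (Lp.coeFn_smul a u)] with y hy
        rw [hy]; simp only [Pi.smul_apply, smul_eq_mul]; ring }
    (Real.sqrt (∫ t in Icc 0 T, θ t * θ t)) fun u => by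
      simp only [LinearMap.coe_mk, AddHom.coe_mk]
      have h := inner_tensor_toLp (T := T) θ θ u u
      rw [real_inner_self_eq_norm_sq, real_inner_self_eq_norm_sq] at h
      rw [← Real.sqrt_sq (norm_nonneg (MemLp.toLp _ (memLp_tensor (T := T) θ u))), h,
        Real.sqrt_mul' _ (sq_nonneg _), Real.sqrt_sq (norm_nonneg _)]

theorem tensor_coeFn (θ : C(ℝ, ℝ)) (u : WL2 fInf) :
    tensor T θ u =ᵐ[spaceTimeMeasure T fInf] fun y => θ y.1 * u y.2 :=
  (memLp_tensor θ u).coeFn_toLp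

theorem inner_tensor (θ η : C(ℝ, ℝ)) (u w : WL2 fInf) :
    inner ℝ (tensor T θ u) (tensor T η w) = (∫ t in Icc 0 T, θ t * η t) * inner ℝ u w :=
  inner_tensor_toLp θ η u w

/-- Finite sums of products are identified isometrically with curves t ↦ ∑ θ_i(t) u_i in L²(0, T;
H), where H is the weighted space. General curves then need no jointly measurable representative. -/
theorem inner_sum_tensor {ι κ : Type*} [Fintype ι] [Fintype κ] (θ : ι → C(ℝ, ℝ))
    (η : κ → C(ℝ, ℝ)) (u : ι → WL2 fInf) (w : κ → WL2 fInf) :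
    inner ℝ (∑ i, tensor T (θ i) (u i)) (∑ k, tensor T (η k) (w k)) =
      ∫ t in Icc 0 T, inner ℝ (∑ i, θ i t • u i) (∑ k, η k t • w k) := by
  have hi : ∀ k i, IntegrableOn (fun t => η k t * (θ i t * inner ℝ (u i) (w k))) (Icc 0 T) :=
    fun k i => Continuous.integrableOn_Icc (by fun_prop)
  simp only [sum_inner, inner_sum, real_inner_smul_left, real_inner_smul_right, inner_tensor]
  rw [integral_finsetSum _ fun k _ => integrable_finsetSum _ fun i _ => hi k i]
  refine Finset.sum_congr rfl fun k _ => ?_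
  rw [integral_finsetSum _ fun i _ => hi k i]
  refine Finset.sum_congr rfl fun i _ => ?_
  rw [← integral_mul_const]
  refine integral_congr_ae (.of_forall fun t => ?_)
  simp only; ring

theorem norm_sq_sum_tensor {ι : Type*} [Fintype ι] (θ : ι → C(ℝ, ℝ)) (u : ι → WL2 fInf) :
    ‖∑ i, tensor T (θ i) (u i)‖ ^ 2 = ∫ t in Icc 0 T, ‖∑ i, θ i t • u i‖ ^ 2 := by
  rw [← real_inner_self_eq_norm_sq, inner_sum_tensor]
  simp only [real_inner_self_eq_norm_sq]

end Tensor

section Field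

/-- F depends on (t, x), while the operator and its domain live over (x, v); reassociation lets
Fubini be used with either grouping. -/
theorem measurePreserving_assoc (T : ℝ) :
    MeasurePreserving (MeasurableEquiv.prodAssoc : (ℝ × E d) × E d ≃ᵐ ℝ × E d × E d)
      (((volume : Measure (ℝ × E d)).restrict (slab d T)).prod volume)
      ((timeMeasure T).prod volume) := by
  rw [volume_restrict_slab]
  exact measurePreserving_prodAssoc (timeMeasure T) volume volume

theorem quasiMeasurePreserving_timeSpace (T : ℝ) :
    Measure.QuasiMeasurePreserving (fun y : ℝ × E d × E d => (y.1, y.2.1))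
      ((timeMeasure T).prod volume) ((volume : Measure (ℝ × E d)).restrict (slab d T)) :=
  (Measure.quasiMeasurePreserving_fst (μ := (volume : Measure (ℝ × E d)).restrict (slab d T))
    (ν := (volume : Measure (E d)))).comp
    ((measurePreserving_assoc T).symm _).quasiMeasurePreserving

theorem spaceTime_absolutelyContinuous :
    spaceTimeMeasure T fInf ≪ (timeMeasure T).prod volume :=
  Measure.AbsolutelyContinuous.rfl.prod absolutelyContinuous

theorem measurable_weight_snd (hE : IsEquilibrium fInf) :
    Measurable fun y : ℝ × E d × E d => ENNReal.ofReal (1 / fInf y.2) :=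
  hE.measurable_weight.comp measurable_snd

theorem spaceTime_eq_withDensity (hE : IsEquilibrium fInf) :
    spaceTimeMeasure T fInf =
      ((timeMeasure T).prod volume).withDensity fun y => ENNReal.ofReal (1 / fInf y.2) :=
  prod_withDensity_right hE.measurable_weight

theorem integral_spaceTime (hE : IsEquilibrium fInf) (F : ℝ × E d × E d → ℝ) :
    ∫ y, F y ∂spaceTimeMeasure T fInf = ∫ y, F y / fInf y.2 ∂(timeMeasure T).prod volume := by
  rw [hE.spaceTime_eq_withDensity, integral_withDensity_eq_integral_toReal_smul
    hE.measurable_weight_snd (.of_forall fun _ => ENNReal.ofReal_lt_top)]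
  refine integral_congr_ae (.of_forall fun y => ?_)
  simp only
  rw [ENNReal.toReal_ofReal (one_div_nonneg.2 (hE.pos _).le), smul_eq_mul]; ring

theorem integrable_spaceTime (hE : IsEquilibrium fInf) (F : ℝ × E d × E d → ℝ) :
    Integrable F (spaceTimeMeasure T fInf) ↔
      Integrable (fun y => F y / fInf y.2) ((timeMeasure T).prod volume) := by
  rw [hE.spaceTime_eq_withDensity, integrable_withDensity_iff
    hE.measurable_weight_snd (.of_forall fun _ => ENNReal.ofReal_lt_top)]
  refine integrable_congr (.of_forall fun y => ?_)
  simp only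
  rw [ENNReal.toReal_ofReal (one_div_nonneg.2 (hE.pos _).le)]; ring

/-- Iterated form of integrals over space-time-velocity. -/
theorem integral_iterated {F : ℝ × E d × E d → ℝ}
    (hF : Integrable F ((timeMeasure T).prod volume)) :
    IntegrableOn (fun p : ℝ × E d => ∫ v, F (p.1, p.2, v)) (slab d T) ∧
      ∫ y, F y ∂(timeMeasure T).prod volume =
        ∫ p in slab d T, ∫ v, F (p.1, p.2, v) := by
  have h := measurePreserving_assoc (d := d) T
  have hF' : Integrable (fun q : (ℝ × E d) × E d => F (q.1.1, q.1.2, q.2))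
      (((volume : Measure (ℝ × E d)).restrict (slab d T)).prod volume) :=
    h.integrable_comp_of_integrable hF
  refine ⟨hF'.integral_prod_left, ?_⟩
  rw [← integral_prod _ hF', ← h.integral_comp' F]
  rfl

theorem lintegral_iterated {F : ℝ × E d × E d → ENNReal}
    (hF : AEMeasurable F ((timeMeasure T).prod volume)) :
    ∫⁻ y, F y ∂(timeMeasure T).prod volume =
      ∫⁻ p in slab d T, ∫⁻ v, F (p.1, p.2, v) := by
  have h := measurePreserving_assoc (d := d) T
  rw [← h.lintegral_comp_emb (MeasurableEquiv.measurableEmbedding _)]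
  exact lintegral_prod _ (hF.comp_quasiMeasurePreserving h.quasiMeasurePreserving)

/-- A criterion for a field `Y` to define an element of the dual of the space-time space. -/
theorem memLp_field (hE : IsEquilibrium fInf) {Y : ℝ × E d × E d → ℝ}
    (hY : AEStronglyMeasurable Y ((timeMeasure T).prod volume)) {B : ℝ} (hB : 0 ≤ B)
    (h : ∫⁻ p in slab d T, ∫⁻ v, ENNReal.ofReal (fInf (p.2, v) * Y (p.1, p.2, v) ^ 2) ≤
      ENNReal.ofReal B) :
    ∃ hm : MemLp (fun y => Y y * fInf y.2) 2 (spaceTimeMeasure T fInf),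
      ‖hm.toLp‖ ^ 2 ≤ B := by
  have hf : AEStronglyMeasurable (fun y : ℝ × E d × E d => fInf y.2)
      ((timeMeasure T).prod volume) :=
    (hE.continuous.comp continuous_snd).aestronglyMeasurable
  have hsq : AEStronglyMeasurable (fun y : ℝ × E d × E d => fInf y.2 * Y y ^ 2)
      ((timeMeasure T).prod volume) := hf.mul (hY.pow 2)
  have hnn : ∀ y : ℝ × E d × E d, 0 ≤ fInf y.2 * Y y ^ 2 := fun y =>
    mul_nonneg (hE.pos _).le (sq_nonneg _)
  have hlin : ∫⁻ y, ENNReal.ofReal (fInf y.2 * Y y ^ 2) ∂(timeMeasure T).prod volume ≤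
      ENNReal.ofReal B := by
    rwa [lintegral_iterated hsq.aemeasurable.ennreal_ofReal]
  have hint : Integrable (fun y : ℝ × E d × E d => fInf y.2 * Y y ^ 2)
      ((timeMeasure T).prod volume) := by
    refine ⟨hsq, (hasFiniteIntegral_iff_ofReal (.of_forall hnn)).2 ?_⟩
    exact hlin.trans_lt ENNReal.ofReal_lt_top
  have hpt : ∀ y : ℝ × E d × E d, (Y y * fInf y.2) ^ 2 / fInf y.2 = fInf y.2 * Y y ^ 2 :=
    fun y => by
    have := (hE.pos y.2).ne'
    field_simp
  have hm : MemLp (fun y => Y y * fInf y.2) 2 (spaceTimeMeasure T fInf) := by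
    have hYf : AEStronglyMeasurable (fun y => Y y * fInf y.2) (spaceTimeMeasure T fInf) :=
      (hY.mul hf).mono_ac spaceTime_absolutelyContinuous
    rw [memLp_two_iff_integrable_sq hYf, hE.integrable_spaceTime]
    simpa only [hpt] using hint
  refine ⟨hm, ?_⟩
  have hn : ‖hm.toLp‖ ^ 2 = ∫ y, fInf y.2 * Y y ^ 2 ∂(timeMeasure T).prod volume := by
    rw [← real_inner_self_eq_norm_sq, L2.inner_def]
    simp only [← hpt]
    rw [← hE.integral_spaceTime]
    refine integral_congr_ae ?_
    filter_upwards [hm.coeFn_toLp] with y hy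
    rw [hy, real_inner_self_eq_norm_sq, Real.norm_eq_abs, sq_abs]
  rw [hn, integral_eq_lintegral_of_nonneg_ae (.of_forall hnn) hsq]
  exact ENNReal.toReal_le_of_le_ofReal hB hlin

/-- Pairing of a field with a product of functions of time and of position and velocity. -/
theorem inner_field_tensor (hE : IsEquilibrium fInf) {Y : ℝ × E d × E d → ℝ}
    (hm : MemLp (fun y => Y y * fInf y.2) 2 (spaceTimeMeasure T fInf)) (θ : C(ℝ, ℝ))
    {u : WL2 fInf} {g : E d × E d → ℝ} (hu : u =ᵐ[weightedMeasure fInf] g) :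
    IntegrableOn (fun p : ℝ × E d => θ p.1 * ∫ v, Y (p.1, p.2, v) * g (p.2, v)) (slab d T) ∧
    inner ℝ hm.toLp (tensor T θ u) =
      ∫ p in slab d T, θ p.1 * ∫ v, Y (p.1, p.2, v) * g (p.2, v) := by
  have hae : (fun y => inner ℝ (MemLp.toLp _ hm y) (tensor T θ u y)) =ᵐ[spaceTimeMeasure T fInf]
      fun y => (θ y.1 * (Y y * g y.2)) * fInf y.2 := by
    filter_upwards [hm.coeFn_toLp, tensor_coeFn (T := T) θ u,
      (Measure.quasiMeasurePreserving_snd (μ := timeMeasure T)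
          (ν := weightedMeasure fInf)).ae hu] with y h1 h2 h3
    rw [h1, h2, h3]; simp; ring
  have hpt : ∀ y : ℝ × E d × E d, (θ y.1 * (Y y * g y.2)) * fInf y.2 / fInf y.2 =
      θ y.1 * (Y y * g y.2) := fun y => mul_div_cancel_right₀ _ (hE.pos _).ne'
  have hi := (L2.integrable_inner (𝕜 := ℝ) hm.toLp (tensor T θ u)).congr hae
  rw [hE.integrable_spaceTime] at hi
  simp only [hpt] at hi
  obtain ⟨h1, h2⟩ := integral_iterated hi
  simp only [integral_const_mul] at h1 h2
  refine ⟨h1, ?_⟩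
  rw [L2.inner_def, integral_congr_ae hae, hE.integral_spaceTime]
  simp only [hpt]
  exact h2

end Field

end IsEquilibrium

end Kinetic

end

/-! ### The dual family β_j and bounds on its adjoint images. -/

noncomputable section

namespace Kinetic

variable {d : ℕ}

/-- `∫_{|v| ≤ 1} |∇_x (f∞ / ⟨f∞⟩)| dv`. -/
def profileVariation (fInf : E d × E d → ℝ) (x : E d) : ℝ :=
  ∫ v in Metric.closedBall (0 : E d) 1, ‖gradX (fun z => fInf z / density fInf z.1) (x, v)‖

/-- `|∇ log ⟨f∞⟩|`. -/
def logGradient (fInf : E d × E d → ℝ) (x : E d) : ℝ :=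
  ‖(density fInf x)⁻¹ • gradient (density fInf) x‖

theorem profileVariation_nonneg (fInf : E d × E d → ℝ) (x : E d) : 0 ≤ profileVariation fInf x :=
  integral_nonneg fun _ => norm_nonneg _

theorem logGradient_nonneg (fInf : E d × E d → ℝ) (x : E d) : 0 ≤ logGradient fInf x :=
  norm_nonneg _

/-- The force restricted to velocities in the unit ball. -/
def localForce (G : E d × E d → E d) (z : E d × E d) : ℝ :=
  (Metric.closedBall (0 : E d) 1).indicator (fun v => ‖G (z.1, v)‖) z.2

theorem localForce_nonneg (G : E d × E d → E d) (z : E d × E d) : 0 ≤ localForce G z :=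
  indicator_nonneg (fun _ _ => norm_nonneg _) _

/-- Test functions dual to `1, v_1, …, v_d` with respect to `f∞`. -/
structure IsDualFamily (L : Collision) (G : E d × E d → E d) (M fInf : E d × E d → ℝ) (C : ℝ)
    (β : Fin (d + 1) → E d × E d → ℝ) : Prop where
  contDiff : ∀ j, ContDiff ℝ 1 (β j)
  contDiff_dV : ∀ j i, ContDiff ℝ 1 (dV i (β j))
  velocityBounded : ∀ j, VelocityBounded 1 (β j)
  dual : ∀ x i j, ∫ v, fInf (x, v) * (vel v i * β j (x, v)) = if i = j then 1 else 0
  bound : ∀ z i j, |vel z.2 i * β j z| ≤ C / density fInf z.1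
  bound_adjoint : ∀ z j, |adjointOp L G M (β j) z| ≤ C / density fInf z.1 *
    (1 + profileVariation fInf z.1 + logGradient fInf z.1 + localForce G z)

theorem dX_eq_fderiv_slice {f : E d × E d → ℝ} {z : E d × E d} (hf : DifferentiableAt ℝ f z)
    (i : Fin d) :
    dX i f z = fderiv ℝ (fun x => f (x, z.2)) z.1 (EuclideanSpace.single i 1) := by
  rw [(hasFDerivAt_sliceX hf).fderiv]; simp [dX]

section Separated

variable {n : ℕ} {a : Fin n → E d → ℝ} {χ : Fin n → E d → ℝ}

theorem contDiff_separated {m : WithTop ℕ∞} (ha : ∀ k, ContDiff ℝ m (a k))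
    (hχ : ∀ k, ContDiff ℝ m (χ k)) :
    ContDiff ℝ m fun z : E d × E d => ∑ k, a k z.1 * χ k z.2 :=
  ContDiff.sum fun k _ => ((ha k).comp contDiff_fst).mul ((hχ k).comp contDiff_snd)

theorem dX_separated (ha : ∀ k, ContDiff ℝ 1 (a k)) (hχ : ∀ k, ContDiff ℝ 1 (χ k))
    (i : Fin d) (z : E d × E d) :
    dX i (fun z => ∑ k, a k z.1 * χ k z.2) z =
      ∑ k, fderiv ℝ (a k) z.1 (EuclideanSpace.single i 1) * χ k z.2 := by
  rw [dX_eq_fderiv_slice ((contDiff_separated ha hχ).differentiable (by norm_num) z)]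
  have hd : ∀ k, DifferentiableAt ℝ (a k) z.1 := fun k => (ha k).differentiable (by norm_num) _
  dsimp only
  rw [fderiv_fun_sum fun k _ => (hd k).mul_const _, sum_apply]
  refine Finset.sum_congr rfl fun k _ => ?_
  rw [fderiv_mul_const (hd k)]; simp [mul_comm]

theorem dV_separated (ha : ∀ k, ContDiff ℝ 1 (a k)) (hχ : ∀ k, ContDiff ℝ 1 (χ k))
    (i : Fin d) (z : E d × E d) :
    dV i (fun z => ∑ k, a k z.1 * χ k z.2) z =
      ∑ k, a k z.1 * fderiv ℝ (χ k) z.2 (EuclideanSpace.single i 1) := by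
  rw [← fderiv_sliceV ((contDiff_separated ha hχ).differentiable (by norm_num) z)]
  have hd : ∀ k, DifferentiableAt ℝ (χ k) z.2 := fun k => (hχ k).differentiable (by norm_num) _
  dsimp only
  rw [fderiv_fun_sum fun k _ => (hd k).const_mul _, sum_apply]
  refine Finset.sum_congr rfl fun k _ => ?_
  rw [fderiv_const_mul (hd k)]; simp

end Separated

theorem exists_uniform_bound {ι X : Type*} [Fintype ι] {f : ι → X → ℝ}
    (h : ∀ i, ∃ C, ∀ x, |f i x| ≤ C) : ∃ C, 0 ≤ C ∧ ∀ i x, |f i x| ≤ C := by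
  choose C hC using h
  refine ⟨∑ i, |C i|, Finset.sum_nonneg fun i _ => abs_nonneg _, fun i x => ?_⟩
  exact ((hC i x).trans (le_abs_self _)).trans
    (Finset.single_le_sum (f := fun i => |C i|) (fun i _ => abs_nonneg _) (Finset.mem_univ i))

theorem hasCompactSupport_velTest (k : Fin (d + 1)) : HasCompactSupport (velTest k : E d → ℝ) :=
  (velBump d).hasCompactSupport.mul_left

/-- The cut-off is fixed, so the bound depends on d alone. Only pure second derivatives are needed,
because only the velocity Laplacian enters the adjoint. -/
theorem exists_bound_velTest (d : ℕ) : ∃ C, 0 ≤ C ∧ ∀ (k : Fin (d + 1)) (i : Fin d) (v : E d),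
    |fderiv ℝ (velTest k) v (EuclideanSpace.single i 1)| ≤ C ∧
    |fderiv ℝ (fun v => fderiv ℝ (velTest k) v (EuclideanSpace.single i 1)) v
      (EuclideanSpace.single i 1)| ≤ C := by
  have h1 : ∀ (k : Fin (d + 1)) (i : Fin d), ContDiff ℝ ∞ fun v : E d =>
      fderiv ℝ (velTest k) v (EuclideanSpace.single i 1) := fun k i =>
    ((contDiff_velTest k).fderiv_right (m := ∞) (by simp)).clm_apply contDiff_const
  have c1 : ∀ (k : Fin (d + 1)) (i : Fin d), HasCompactSupport fun v : E d =>
      fderiv ℝ (velTest k) v (EuclideanSpace.single i 1) := fun k i =>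
    (hasCompactSupport_velTest k).fderiv_apply ℝ _
  obtain ⟨C₁, hC₁0, hC₁⟩ := exists_uniform_bound (ι := Fin (d + 1) × Fin d)
    (f := fun p (v : E d) => fderiv ℝ (velTest p.1) v (EuclideanSpace.single p.2 1))
    fun p => (c1 p.1 p.2).exists_bound_of_continuous (h1 p.1 p.2).continuous
  obtain ⟨C₂, hC₂0, hC₂⟩ := exists_uniform_bound (ι := Fin (d + 1) × Fin d)
    (f := fun p (v : E d) => fderiv ℝ (fun v => fderiv ℝ (velTest p.1) v
      (EuclideanSpace.single p.2 1)) v (EuclideanSpace.single p.2 1))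
    fun p => ((c1 p.1 p.2).fderiv_apply ℝ _).exists_bound_of_continuous
      (((h1 p.1 p.2).continuous_fderiv (by simp)).clm_apply continuous_const)
  exact ⟨C₁ + C₂, by positivity, fun k i v => ⟨(hC₁ (k, i) v).trans (by linarith),
    (hC₂ (k, i) v).trans (by linarith)⟩⟩

theorem abs_sum_mul_le {n : ℕ} {p q : Fin n → ℝ} {P Q : ℝ} (hp : ∀ k, |p k| ≤ P)
    (hq : ∀ k, |q k| ≤ Q) (hP : 0 ≤ P) : |∑ k, p k * q k| ≤ n * (P * Q) := by
  refine (Finset.abs_sum_le_sum_abs _ _).trans ?_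
  calc ∑ k, |p k * q k| ≤ ∑ _k : Fin n, P * Q := Finset.sum_le_sum fun k _ => by
        rw [abs_mul]
        exact mul_le_mul (hp k) (hq k) (abs_nonneg _) hP
    _ = _ := by simp

/-- The dual family, with bounds depending only on the structural constants. -/
theorem exists_isDualFamily (d : ℕ) (cM : ℝ) {cInf : ℝ} (hc : 0 < cInf) :
    ∃ C : ℝ, 0 < C ∧ ∀ (L : Collision) (G : E d × E d → E d) (M fInf : E d × E d → ℝ),
      IsBackground L M → IsStationaryState L G M fInf cInf cM →
      ∃ β, IsDualFamily L G M fInf C β := by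
  obtain ⟨Ca, hCa, hcoef⟩ := exists_dual_coeffs d hc
  obtain ⟨Cχ, hCχ, hχ⟩ := exists_bound_velTest d
  set n : ℝ := ((d + 1 : ℕ) : ℝ) with hn
  have hn0 : 0 ≤ n := by positivity
  set c0 := n * Ca with hc0
  have hc0p : 0 ≤ c0 := by positivity
  set c1 := n * Ca * Cχ with hc1
  have hc1p : 0 ≤ c1 := by positivity
  -- Up to the factor 1/⟨f∞⟩, c0 bounds β_j and c1 its velocity derivatives. 2 c0 serves BGK, d c0
  -- the position derivatives, and d c1 (2 + |cM|) the force and Fokker-Planck terms.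
  refine ⟨1 + 2 * c0 + d * c0 + d * c1 * (2 + |cM|), by positivity, fun L G M fInf hM hS => ?_⟩
  obtain ⟨a, ha, hdual, hab, had⟩ := hcoef L G M fInf cM hS
  have hρ := hS.density_pos hc
  have hχ1 : ∀ k, ContDiff ℝ 1 (velTest k : E d → ℝ) := fun k =>
    (contDiff_velTest k).of_le (by norm_cast)
  have hχ2 : ∀ (k : Fin (d + 1)) (i : Fin d), ContDiff ℝ 1 fun v : E d =>
      fderiv ℝ (velTest k) v (EuclideanSpace.single i 1) := fun k i =>
    ((contDiff_velTest k).fderiv_right (m := 1) (by norm_cast)).clm_apply contDiff_const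
  let β : Fin (d + 1) → E d × E d → ℝ := fun j z => ∑ k, a j k z.1 * velTest k z.2
  have hβ : ∀ j, ContDiff ℝ 1 (β j) := fun j => contDiff_separated (ha j) hχ1
  have hβV : ∀ j i, dV i (β j) = fun z => ∑ k, a j k z.1 *
      fderiv ℝ (velTest k) z.2 (EuclideanSpace.single i 1) := fun j i =>
    funext fun z => dV_separated (ha j) hχ1 i z
  have hβ2 : ∀ j i, ContDiff ℝ 1 (dV i (β j)) := fun j i => by
    rw [hβV]; exact contDiff_separated (ha j) fun k => hχ2 k i
  have hβR : ∀ j, VelocityBounded 1 (β j) := fun j z hz => by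
    simp [β, velTest_eq_zero hz.le]
  have hρC : ∀ z : E d × E d, 0 ≤ Ca / density fInf z.1 := fun z => (div_pos hCa (hρ _)).le
  have b0 : ∀ j z, |β j z| ≤ c0 / density fInf z.1 := fun j z => by
    refine (abs_sum_mul_le (fun k => hab z.1 j k) (fun k => abs_velTest_le z.2 k) (hρC z)).trans
      (le_of_eq ?_)
    rw [hc0]; ring
  have bX : ∀ j i z, |dX i (β j) z| ≤ c0 / density fInf z.1 *
      (profileVariation fInf z.1 + logGradient fInf z.1) := fun j i z => by
    have e : dX i (β j) z = _ := dX_separated (ha j) hχ1 i z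
    rw [e]
    refine (abs_sum_mul_le (fun k => had z.1 j k i) (fun k => abs_velTest_le z.2 k)
      (mul_nonneg (hρC z) (add_nonneg (profileVariation_nonneg _ _)
        (logGradient_nonneg _ _)))).trans (le_of_eq ?_)
    rw [hc0]
    simp only [profileVariation, logGradient]
    ring
  have bV : ∀ j i z, |dV i (β j) z| ≤ c1 / density fInf z.1 := fun j i z => by
    rw [hβV]
    refine (abs_sum_mul_le (fun k => hab z.1 j k) (fun k => (hχ k i z.2).1) (hρC z)).trans
      (le_of_eq ?_)
    rw [hc1]; ring
  have bVV : ∀ j i z, |dV i (dV i (β j)) z| ≤ c1 / density fInf z.1 := fun j i z => by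
    rw [hβV, dV_separated (ha j) (fun k => hχ2 k i)]
    refine (abs_sum_mul_le (fun k => hab z.1 j k) (fun k => (hχ k i z.2).2) (hρC z)).trans
      (le_of_eq ?_)
    rw [hc1]; ring
  -- the collision part
  have bColl : ∀ j z, |adjointCollisionOp L M (β j) z| ≤
      (2 * c0 + d * c1 * (1 + |cM|)) / density fInf z.1 := by
    intro j z
    cases L with
    | fokkerPlanck =>
      obtain ⟨hM2, hM0⟩ := hM.regular_fp rfl
      -- M⁻¹ ∇·(M∇β) = Δβ + (∇M/M)·∇β, so M enters only through |∇_v M|/M on the support of β_j.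
      have e : adjointCollisionOp .fokkerPlanck M (β j) z =
          ∑ i, (dV i (dV i (β j)) z + dV i M z / M z * dV i (β j) z) := by
        simp only [adjointCollisionOp, Finset.mul_sum]
        refine Finset.sum_congr rfl fun i _ => ?_
        rw [dV_mul (hM2.differentiable (by norm_num) z)
          ((hβ2 j i).differentiable (by norm_num) z)]
        have := (hM0 z).ne'
        field_simp
      rw [e]
      have hterm : ∀ i, |dV i (dV i (β j)) z + dV i M z / M z * dV i (β j) z| ≤
          c1 * (1 + |cM|) / density fInf z.1 := by
        intro i
        by_cases hz : 1 < ‖z.2‖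
        · rw [(hβR j).dV i |>.dV i z hz, (hβR j).dV i z hz]
          simpa using div_nonneg (by positivity) (hρ _).le
        · have hM' : |dV i M z / M z| ≤ |cM| := by
            have h1 := hS.bound_fp rfl z.1 z.2 (not_lt.1 hz)
            rw [abs_div, abs_of_pos (hM0 z), ← gradV_apply (hM2.differentiable (by norm_num) z)]
            exact ((div_le_div_of_nonneg_right (PiLp.norm_apply_le (gradV M z) i)
              (hM0 z).le).trans h1).trans (le_abs_self _)
          calc _ ≤ |dV i (dV i (β j)) z| + |dV i M z / M z| * |dV i (β j) z| := by
                rw [← abs_mul]; exact abs_add_le _ _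
            _ ≤ c1 / density fInf z.1 + |cM| * (c1 / density fInf z.1) := by
                have := bVV j i z
                have := bV j i z
                gcongr
            _ = _ := by ring
      calc _ ≤ ∑ _i : Fin d, c1 * (1 + |cM|) / density fInf z.1 :=
            (Finset.abs_sum_le_sum_abs _ _).trans (Finset.sum_le_sum fun i _ => hterm i)
        _ = (d * c1 * (1 + |cM|)) / density fInf z.1 := by
            simp; ring
        _ ≤ _ := div_le_div_of_nonneg_right (by linarith) (hρ _).le
    | bgk =>
      -- M(x, ·) is a probability density and the bound on β_j at x is uniform in v, so the average
      -- obeys the same bound.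
      have h1 : |∫ v, M (z.1, v) * β j (z.1, v)| ≤ c0 / density fInf z.1 := by
        have := norm_integral_le_of_norm_le ((hM.integrable z.1).mul_const (c0 / density fInf z.1))
          (f := fun v => M (z.1, v) * β j (z.1, v)) (.of_forall fun v => by
            rw [norm_mul, Real.norm_of_nonneg (hM.nonneg _)]
            exact mul_le_mul_of_nonneg_left (b0 j (z.1, v)) (hM.nonneg _))
        rwa [integral_mul_const, hM.integral_eq_one, one_mul] at this
      simp only [adjointCollisionOp]
      calc _ ≤ c0 / density fInf z.1 + c0 / density fInf z.1 :=
            (abs_sub _ _).trans (add_le_add h1 (b0 j z))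
        _ = (2 * c0) / density fInf z.1 := by ring
        _ ≤ _ := div_le_div_of_nonneg_right
            (le_add_of_nonneg_right (by positivity)) (hρ _).le
  refine ⟨β, hβ, hβ2, hβR, fun x i j => ?_, fun z i j => ?_, fun z j => ?_⟩
  · rw [← hdual x i j]
    have hint : ∀ k, Integrable fun v => a j k x * (fInf (x, v) * (vel v i * velTest k v)) :=
      fun k => by
      have hc : Continuous fun v => a j k x * (fInf (x, v) * (vel v i * velTest k v)) :=
        continuous_const.mul ((continuous_slice hS.contDiff.continuous x).mul
          ((contDiff_vel i (n := 0)).continuous.mul (contDiff_velTest k).continuous))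
      exact hc.integrable_of_hasCompactSupport
        ((hasCompactSupport_velTest k).mul_left.mul_left.mul_left)
    simp only [← integral_const_mul]
    rw [← integral_finsetSum _ fun k _ => hint k]
    refine integral_congr_ae (.of_forall fun v => ?_)
    simp only [β, Finset.mul_sum]
    exact Finset.sum_congr rfl fun k _ => by ring
  · have hC : c0 / density fInf z.1 ≤
        (1 + 2 * c0 + d * c0 + d * c1 * (2 + |cM|)) / density fInf z.1 := by
      refine div_le_div_of_nonneg_right ?_ (hρ _).le
      have h1 : 0 ≤ (d : ℝ) * c0 := by positivity
      have h2 : 0 ≤ (d : ℝ) * c1 * (2 + |cM|) := by positivity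
      linarith
    refine le_trans ?_ hC
    by_cases hz : 1 < ‖z.2‖
    · rw [hβR j z hz, mul_zero, abs_zero]; exact div_nonneg hc0p (hρ _).le
    · rw [abs_mul]
      calc _ ≤ 1 * (c0 / density fInf z.1) :=
            mul_le_mul (abs_vel_le (not_lt.1 hz) i) (b0 j z) (abs_nonneg _) zero_le_one
        _ = _ := one_mul _
  · set I := profileVariation fInf z.1
    set W := logGradient fInf z.1
    have hI : 0 ≤ I := profileVariation_nonneg _ _
    have hW : 0 ≤ W := logGradient_nonneg _ _
    have hF := localForce_nonneg G z
    have hr := hρ z.1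
    have t1 : |∑ i, z.2 i * dX i (β j) z| ≤ d * (c0 / density fInf z.1 * (I + W)) := by
      by_cases hz : 1 < ‖z.2‖
      · have : ∀ i, dX i (β j) z = 0 := fun i => (hβR j).dX i z hz
        simp only [this, mul_zero, Finset.sum_const_zero, abs_zero]; positivity
      · refine (abs_sum_mul_le (P := 1) (fun i => (PiLp.norm_apply_le z.2 i).trans (not_lt.1 hz))
          (fun i => bX j i z) zero_le_one).trans (le_of_eq (by ring))
    have t2 : |∑ i, G z i * dV i (β j) z| ≤ d * (localForce G z * (c1 / density fInf z.1)) := by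
      by_cases hz : 1 < ‖z.2‖
      · have : ∀ i, dV i (β j) z = 0 := fun i => (hβR j).dV i z hz
        simp only [this, mul_zero, Finset.sum_const_zero, abs_zero]; positivity
      · have e : localForce G z = ‖G z‖ := indicator_of_mem (by simpa using not_lt.1 hz) _
        rw [e]
        exact abs_sum_mul_le (fun i => PiLp.norm_apply_le (G z) i) (fun i => bV j i z)
          (norm_nonneg _)
    have t3 := bColl j z
    calc |adjointOp L G M (β j) z| ≤ |∑ i, z.2 i * dX i (β j) z| + |∑ i, G z i * dV i (β j) z| +
          |adjointCollisionOp L M (β j) z| := abs_add_three _ _ _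
      _ ≤ d * (c0 / density fInf z.1 * (I + W)) + d * (localForce G z * (c1 / density fInf z.1)) +
          (2 * c0 + d * c1 * (1 + |cM|)) / density fInf z.1 := by gcongr
      _ = (d * c0 * (I + W) + d * c1 * localForce G z + (2 * c0 + d * c1 * (1 + |cM|))) /
          density fInf z.1 := by ring
      _ ≤ ((1 + 2 * c0 + d * c0 + d * c1 * (2 + |cM|)) * (1 + I + W + localForce G z)) /
          density fInf z.1 := by
          refine div_le_div_of_nonneg_right ?_ hr.le
          have hA : 0 ≤ (d : ℝ) * c0 := by positivity
          have hB : 0 ≤ (d : ℝ) * c1 := by positivity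
          have hD : 0 ≤ (d : ℝ) * c1 * |cM| := by positivity
          set A := (d : ℝ) * c0
          set B := (d : ℝ) * c1
          set m := |cM|
          have hm : 0 ≤ m := abs_nonneg _
          have e1 : A * (I + W) ≤ A * (1 + I + W + localForce G z) :=
            mul_le_mul_of_nonneg_left (by linarith) hA
          have e2 : B * localForce G z ≤ B * (1 + I + W + localForce G z) :=
            mul_le_mul_of_nonneg_left (by linarith) hB
          have e3 : (2 * c0 + B * (1 + m)) * 1 ≤
              (2 * c0 + B * (1 + m)) * (1 + I + W + localForce G z) := by
            have : 0 ≤ 2 * c0 + B * (1 + m) := by positivity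
            gcongr; linarith
          have e4 : 0 ≤ 1 + I + W + localForce G z := by positivity
          linarith
      _ = _ := by ring

end Kinetic

end

/-! ### The fields Y, ∂_t Y and the spatial part of A*Y, and their norms. -/

noncomputable section

namespace Kinetic

variable {d : ℕ}

theorem measurable_adjointOp {L : Collision} {G : E d × E d → E d} {M b : E d × E d → ℝ}
    (hG : ContDiff ℝ ∞ G) (hM : IsBackground L M) (hb : ContDiff ℝ 1 b)
    (hb2 : ∀ i, ContDiff ℝ 1 (dV i b)) : Measurable (adjointOp L G M b) := by
  have h1 : Measurable fun z : E d × E d => ∑ i, z.2 i * dX i b z :=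
    (continuous_finsetSum _ fun i _ =>
      (contDiff_velocity i (n := 0)).continuous.mul (continuous_dX hb i)).measurable
  have h2 : Measurable fun z : E d × E d => ∑ i, G z i * dV i b z :=
    (continuous_finsetSum _ fun i _ =>
      (contDiff_coord hG i).continuous.mul (continuous_dV hb i)).measurable
  refine (h1.add h2).add ?_
  cases L with
  | fokkerPlanck =>
    obtain ⟨hM2, hM0⟩ := hM.regular_fp rfl
    refine hM.measurable.inv.mul (continuous_finsetSum _ fun i _ => continuous_dV ?_ i).measurable
    exact (hM2.of_le (by norm_num)).mul (hb2 i)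
  | bgk =>
    exact ((hM.measurable.mul hb.continuous.measurable).stronglyMeasurable.integral_prod_right'
      (ν := volume)).measurable.comp measurable_fst |>.sub hb.continuous.measurable

/-- The field `∑ F_j β_j`. -/
def fluxField (F : Fin (d + 1) → ℝ × E d → ℝ) (β : Fin (d + 1) → E d × E d → ℝ)
    (y : ℝ × E d × E d) : ℝ :=
  ∑ j, F j (y.1, y.2.1) * β j y.2

/-- The field `∑ ∂_t F_j β_j`. -/
def timeField (D : Fin (d + 1) → Fin (d + 1) → ℝ × E d → ℝ) (β : Fin (d + 1) → E d × E d → ℝ)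
    (y : ℝ × E d × E d) : ℝ :=
  ∑ j, D j 0 (y.1, y.2.1) * β j y.2

/-- The field `∑ (v · ∇ F_j β_j + F_j A^* β_j)`. -/
def spaceField (L : Collision) (G : E d × E d → E d) (M : E d × E d → ℝ)
    (F : Fin (d + 1) → ℝ × E d → ℝ) (D : Fin (d + 1) → Fin (d + 1) → ℝ × E d → ℝ)
    (β : Fin (d + 1) → E d × E d → ℝ) (y : ℝ × E d × E d) : ℝ :=
  ∑ j, (∑ i : Fin d, D j i.succ (y.1, y.2.1) * (y.2.2 i * β j y.2) +
    F j (y.1, y.2.1) * adjointOp L G M (β j) y.2)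

theorem LocallyIntegrableOn.aestronglyMeasurable_slab {T : ℝ} {F : ℝ × E d → ℝ}
    (hF : LocallyIntegrableOn F (slab d T)) :
    AEStronglyMeasurable (fun y : ℝ × E d × E d => F (y.1, y.2.1))
      ((timeMeasure T).prod volume) :=
  hF.aestronglyMeasurable.comp_quasiMeasurePreserving
    (IsEquilibrium.quasiMeasurePreserving_timeSpace T)

section Fields

variable {L : Collision} {G : E d × E d → E d} {M fInf : E d × E d → ℝ} {C T : ℝ}
  {β : Fin (d + 1) → E d × E d → ℝ} {F : Fin (d + 1) → ℝ × E d → ℝ}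
  {D : Fin (d + 1) → Fin (d + 1) → ℝ × E d → ℝ}

theorem IsDualFamily.abs_le (hβ : IsDualFamily L G M fInf C β) (z : E d × E d) (j : Fin (d + 1)) :
    |β j z| ≤ C / density fInf z.1 := by
  simpa [vel] using hβ.bound z 0 j

theorem aestronglyMeasurable_fluxField (hβ : IsDualFamily L G M fInf C β)
    (hF : ∀ j, LocallyIntegrableOn (F j) (slab d T)) :
    AEStronglyMeasurable (fluxField F β) ((timeMeasure T).prod volume) :=
  Finset.aestronglyMeasurable_fun_sum _ fun j _ =>
    (LocallyIntegrableOn.aestronglyMeasurable_slab (hF j)).mul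
    ((hβ.contDiff j).continuous.comp continuous_snd).aestronglyMeasurable

theorem aestronglyMeasurable_timeField (hβ : IsDualFamily L G M fInf C β)
    (hD : ∀ i j, LocallyIntegrableOn (D i j) (slab d T)) :
    AEStronglyMeasurable (timeField D β) ((timeMeasure T).prod volume) :=
  Finset.aestronglyMeasurable_fun_sum _ fun j _ =>
    (LocallyIntegrableOn.aestronglyMeasurable_slab (hD j 0)).mul
    ((hβ.contDiff j).continuous.comp continuous_snd).aestronglyMeasurable

theorem aestronglyMeasurable_spaceField (hG : ContDiff ℝ ∞ G) (hM : IsBackground L M)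
    (hβ : IsDualFamily L G M fInf C β) (hF : ∀ j, LocallyIntegrableOn (F j) (slab d T))
    (hD : ∀ i j, LocallyIntegrableOn (D i j) (slab d T)) :
    AEStronglyMeasurable (spaceField L G M F D β) ((timeMeasure T).prod volume) := by
  refine Finset.aestronglyMeasurable_fun_sum _ fun j _ => .add
    (Finset.aestronglyMeasurable_fun_sum _ fun i _ =>
      (LocallyIntegrableOn.aestronglyMeasurable_slab (hD j i.succ)).mul
      (Continuous.aestronglyMeasurable ?_)) ((LocallyIntegrableOn.aestronglyMeasurable_slab
      (hF j)).mul (Measurable.aestronglyMeasurable ?_))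
  · exact ((contDiff_velocity i (n := 0)).continuous.mul (hβ.contDiff j).continuous).comp
      continuous_snd
  · exact (measurable_adjointOp hG hM (hβ.contDiff j) (hβ.contDiff_dV j)).comp measurable_snd

/-- The pointwise bound on the fields at the point `y`. -/
def fieldBound (G : E d × E d → E d) (fInf : E d × E d → ℝ) (F : Fin (d + 1) → ℝ × E d → ℝ)
    (D : Fin (d + 1) → Fin (d + 1) → ℝ × E d → ℝ) (y : ℝ × E d × E d) : ℝ :=
  (∑ i, ∑ j, |D i j (y.1, y.2.1)|) + (∑ j, |F j (y.1, y.2.1)|) *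
    (1 + profileVariation fInf y.2.1 + logGradient fInf y.2.1 + localForce G y.2)

/-- The majorant is generous on purpose: all three fields obey it, so a single norm estimate serves
them all. -/
theorem abs_fluxField_le (hE : IsEquilibrium fInf) (hC : 0 ≤ C) (hβ : IsDualFamily L G M fInf C β)
    (y : ℝ × E d × E d) :
    |fluxField F β y| ≤ C / density fInf y.2.1 * fieldBound G fInf F D y := by
  have hc : 0 ≤ C / density fInf y.2.1 := div_nonneg hC (hE.density_pos _).le
  have h1 := profileVariation_nonneg fInf y.2.1
  have h2 := logGradient_nonneg fInf y.2.1
  have h3 := localForce_nonneg G y.2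
  have hD : 0 ≤ ∑ i, ∑ j, |D i j (y.1, y.2.1)| := by positivity
  have hF : 0 ≤ ∑ j, |F j (y.1, y.2.1)| := by positivity
  calc |fluxField F β y| ≤ ∑ j, |F j (y.1, y.2.1)| * (C / density fInf y.2.1) := by
        refine (Finset.abs_sum_le_sum_abs _ _).trans (Finset.sum_le_sum fun j _ => ?_)
        rw [abs_mul]
        exact mul_le_mul_of_nonneg_left (hβ.abs_le _ _) (abs_nonneg _)
    _ = C / density fInf y.2.1 * ((∑ j, |F j (y.1, y.2.1)|) * 1) := by
        rw [← Finset.sum_mul]; ring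
    _ ≤ _ := by
        refine mul_le_mul_of_nonneg_left ?_ hc
        have := mul_le_mul_of_nonneg_left (show 1 ≤ 1 + profileVariation fInf y.2.1 +
          logGradient fInf y.2.1 + localForce G y.2 by linarith) hF
        rw [fieldBound]; linarith

theorem abs_timeField_le (hE : IsEquilibrium fInf) (hC : 0 ≤ C) (hβ : IsDualFamily L G M fInf C β)
    (y : ℝ × E d × E d) :
    |timeField D β y| ≤ C / density fInf y.2.1 * fieldBound G fInf F D y := by
  have hc : 0 ≤ C / density fInf y.2.1 := div_nonneg hC (hE.density_pos _).le
  have h1 := profileVariation_nonneg fInf y.2.1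
  have h2 := logGradient_nonneg fInf y.2.1
  have h3 := localForce_nonneg G y.2
  have hF : 0 ≤ (∑ j, |F j (y.1, y.2.1)|) * (1 + profileVariation fInf y.2.1 +
    logGradient fInf y.2.1 + localForce G y.2) := by positivity
  calc |timeField D β y| ≤ ∑ j, |D j 0 (y.1, y.2.1)| * (C / density fInf y.2.1) := by
        refine (Finset.abs_sum_le_sum_abs _ _).trans (Finset.sum_le_sum fun j _ => ?_)
        rw [abs_mul]
        exact mul_le_mul_of_nonneg_left (hβ.abs_le _ _) (abs_nonneg _)
    _ = C / density fInf y.2.1 * ∑ j, |D j 0 (y.1, y.2.1)| := by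
        rw [← Finset.sum_mul]; ring
    _ ≤ _ := by
        refine mul_le_mul_of_nonneg_left ?_ hc
        have : ∑ j, |D j 0 (y.1, y.2.1)| ≤ ∑ i, ∑ j, |D i j (y.1, y.2.1)| :=
          Finset.sum_le_sum fun i _ => Finset.single_le_sum
            (f := fun j => |D i j (y.1, y.2.1)|) (fun _ _ => abs_nonneg _) (Finset.mem_univ 0)
        rw [fieldBound]; linarith

theorem abs_spaceField_le (hE : IsEquilibrium fInf) (hC : 0 ≤ C) (hβ : IsDualFamily L G M fInf C β)
    (y : ℝ × E d × E d) :
    |spaceField L G M F D β y| ≤ C / density fInf y.2.1 * fieldBound G fInf F D y := by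
  have hc : 0 ≤ C / density fInf y.2.1 := div_nonneg hC (hE.density_pos _).le
  set s := 1 + profileVariation fInf y.2.1 + logGradient fInf y.2.1 + localForce G y.2 with hs
  calc |spaceField L G M F D β y| ≤ ∑ j, ((∑ i : Fin d, |D j i.succ (y.1, y.2.1)| *
          (C / density fInf y.2.1)) + |F j (y.1, y.2.1)| * (C / density fInf y.2.1 * s)) := by
        refine (Finset.abs_sum_le_sum_abs _ _).trans (Finset.sum_le_sum fun j _ => ?_)
        refine (abs_add_le _ _).trans (add_le_add ((Finset.abs_sum_le_sum_abs _ _).trans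
          (Finset.sum_le_sum fun i _ => ?_)) ?_)
        · rw [abs_mul]
          refine mul_le_mul_of_nonneg_left ?_ (abs_nonneg _)
          simpa [vel] using hβ.bound y.2 i.succ j
        · rw [abs_mul]
          exact mul_le_mul_of_nonneg_left (hβ.bound_adjoint _ _) (abs_nonneg _)
    _ = C / density fInf y.2.1 * ((∑ j, ∑ i : Fin d, |D j i.succ (y.1, y.2.1)|) +
          (∑ j, |F j (y.1, y.2.1)|) * s) := by
        simp only [Finset.sum_add_distrib, ← Finset.sum_mul]; ring
    _ ≤ _ := by
        refine mul_le_mul_of_nonneg_left (add_le_add_left ?_ _) hc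
        refine Finset.sum_le_sum fun j _ => ?_
        rw [Fin.sum_univ_succ (fun i => |D j i (y.1, y.2.1)|)]
        linarith [abs_nonneg (D j 0 (y.1, y.2.1))]

end Fields

section Bound

variable {G : E d × E d → E d} {fInf : E d × E d → ℝ} {C T : ℝ}
  {F : Fin (d + 1) → ℝ × E d → ℝ} {D : Fin (d + 1) → Fin (d + 1) → ℝ × E d → ℝ}

/-- Cauchy-Schwarz for finite sums: 8 is 2 for the two summands times 4 for 1 + p + l + f, and (d +
1)² counts the components of D (d + 1 would do for F). -/
theorem fieldBound_sq_le (y : ℝ × E d × E d) :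
    fieldBound G fInf F D y ^ 2 ≤ 8 * (d + 1) ^ 2 * ((∑ i, ∑ j, D i j (y.1, y.2.1) ^ 2) +
      (∑ j, F j (y.1, y.2.1) ^ 2) * (1 + profileVariation fInf y.2.1 ^ 2 +
      logGradient fInf y.2.1 ^ 2 + localForce G y.2 ^ 2)) := by
  set p := profileVariation fInf y.2.1
  set l := logGradient fInf y.2.1
  set f := localForce G y.2
  have hs : (1 + p + l + f) ^ 2 ≤ 4 * (1 + p ^ 2 + l ^ 2 + f ^ 2) := by
    nlinarith [sq_nonneg (1 - p), sq_nonneg (1 - l), sq_nonneg (1 - f), sq_nonneg (p - l),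
      sq_nonneg (p - f), sq_nonneg (l - f)]
  have hF : (∑ j, |F j (y.1, y.2.1)|) ^ 2 ≤ (d + 1) * ∑ j, F j (y.1, y.2.1) ^ 2 := by
    have := sq_sum_le_card_mul_sum_sq (s := Finset.univ) (f := fun j => |F j (y.1, y.2.1)|)
    simpa [sq_abs] using this
  have hD : (∑ i, ∑ j, |D i j (y.1, y.2.1)|) ^ 2 ≤
      (d + 1) ^ 2 * ∑ i, ∑ j, D i j (y.1, y.2.1) ^ 2 := by
    have := sq_sum_le_card_mul_sum_sq (s := Finset.univ)
      (f := fun q : Fin (d + 1) × Fin (d + 1) => |D q.1 q.2 (y.1, y.2.1)|)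
    simpa [sq_abs, Fintype.sum_prod_type, sq] using this
  have hF0 : 0 ≤ ∑ j, F j (y.1, y.2.1) ^ 2 := by positivity
  have hD0 : 0 ≤ ∑ i, ∑ j, D i j (y.1, y.2.1) ^ 2 := by positivity
  have hd : (1 : ℝ) ≤ d + 1 := by linarith [(Nat.cast_nonneg d : (0 : ℝ) ≤ d)]
  rw [fieldBound]
  set a := ∑ i, ∑ j, |D i j (y.1, y.2.1)|
  set b := ∑ j, |F j (y.1, y.2.1)|
  set a2 := ∑ i, ∑ j, D i j (y.1, y.2.1) ^ 2
  set b2 := ∑ j, F j (y.1, y.2.1) ^ 2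
  have hb2 : b ^ 2 ≤ (d + 1) ^ 2 * b2 := hF.trans (by
    refine mul_le_mul_of_nonneg_right ?_ hF0
    nlinarith)
  calc (a + b * (1 + p + l + f)) ^ 2 ≤ 2 * (a ^ 2 + (b * (1 + p + l + f)) ^ 2) := add_sq_le
    _ = 2 * (a ^ 2 + b ^ 2 * (1 + p + l + f) ^ 2) := by ring
    _ ≤ 2 * ((d + 1) ^ 2 * a2 + ((d + 1) ^ 2 * b2) * (4 * (1 + p ^ 2 + l ^ 2 + f ^ 2))) := by
        gcongr
    _ ≤ _ := by
        have : 0 ≤ ((d : ℝ) + 1) ^ 2 * a2 := by positivity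
        linarith

theorem localForce_sq (z : E d × E d) : localForce G z ^ 2 =
    (Metric.closedBall (0 : E d) 1).indicator (fun v => ‖G (z.1, v)‖ ^ 2) z.2 := by
  by_cases h : z.2 ∈ Metric.closedBall (0 : E d) 1 <;> simp [localForce, h]

theorem integrable_localForce_sq (hE : IsEquilibrium fInf) (hG : ContDiff ℝ ∞ G) (x : E d) :
    Integrable (fun v => fInf (x, v) * localForce G (x, v) ^ 2) ∧
    ∫ v, fInf (x, v) * localForce G (x, v) ^ 2 =
      ∫ v in Metric.closedBall (0 : E d) 1, fInf (x, v) * ‖G (x, v)‖ ^ 2 := by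
  have heq : (fun v => fInf (x, v) * localForce G (x, v) ^ 2) =
      (Metric.closedBall (0 : E d) 1).indicator fun v => fInf (x, v) * ‖G (x, v)‖ ^ 2 := by
    funext v
    rw [localForce_sq]
    by_cases h : v ∈ Metric.closedBall (0 : E d) 1 <;> simp [h]
  have hc : Continuous fun v => fInf (x, v) * ‖G (x, v)‖ ^ 2 := by
    have h1 := hE.continuous
    have h2 := hG.continuous
    fun_prop
  rw [heq, integral_indicator Metric.isClosed_closedBall.measurableSet]
  exact ⟨(hc.continuousOn.integrableOn_compact (isCompact_closedBall _ _)).integrable_indicator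
    Metric.isClosed_closedBall.measurableSet, rfl⟩

/-- This is where the form of w comes from. The square carries 1/⟨f∞⟩²; integrating f∞ over v
restores one power, and the force term integrates to ∫_{|v|≤1} f∞|G|² dv. After division by ⟨f∞⟩,
the coefficients of |F|² add up to w. -/
theorem lintegral_field_slice_le (hE : IsEquilibrium fInf) (hG : ContDiff ℝ ∞ G)
    {Y : ℝ × E d × E d → ℝ}
    (hY : ∀ y, |Y y| ≤ C / density fInf y.2.1 * fieldBound G fInf F D y) (p : ℝ × E d) :
    ∫⁻ v, ENNReal.ofReal (fInf (p.2, v) * Y (p.1, p.2, v) ^ 2) ≤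
      ENNReal.ofReal (8 * C ^ 2 * (d + 1) ^ 2) * ENNReal.ofReal
        (((∑ i, F i p ^ 2) * weight G fInf p.2 + ∑ i, ∑ j, D i j p ^ 2) / density fInf p.2) := by
  obtain ⟨hi, hI⟩ := integrable_localForce_sq hE hG p.2
  set ρ := density fInf p.2 with hρ
  have hρ0 : 0 < ρ := hE.density_pos _
  set a2 := ∑ i, ∑ j, D i j p ^ 2
  set b2 := ∑ j, F j p ^ 2
  have ha : 0 ≤ a2 := by positivity
  have hb : 0 ≤ b2 := by positivity
  set I := profileVariation fInf p.2
  set W := logGradient fInf p.2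
  set K := 8 * C ^ 2 * ((d : ℝ) + 1) ^ 2 with hK
  have hK0 : 0 ≤ K := by positivity
  set S := ∫ v in Metric.closedBall (0 : E d) 1, fInf (p.2, v) * ‖G (p.2, v)‖ ^ 2
  have hw : weight G fInf p.2 = 1 + S / ρ + I ^ 2 + W ^ 2 := rfl
  have hpt : ∀ v, fInf (p.2, v) * Y (p.1, p.2, v) ^ 2 ≤
      K / ρ ^ 2 * ((a2 + b2 * (1 + I ^ 2 + W ^ 2)) * fInf (p.2, v) +
        b2 * (fInf (p.2, v) * localForce G (p.2, v) ^ 2)) := fun v => by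
    have h1 := hY (p.1, p.2, v)
    have h2 := fieldBound_sq_le (G := G) (fInf := fInf) (F := F) (D := D) (p.1, p.2, v)
    have h3 : Y (p.1, p.2, v) ^ 2 ≤ (C / ρ) ^ 2 * fieldBound G fInf F D (p.1, p.2, v) ^ 2 := by
      rw [← mul_pow]; exact sq_le_sq' (by linarith [(abs_le.1 h1).1]) (abs_le.1 h1).2
    have h4 := h3.trans (mul_le_mul_of_nonneg_left h2 (sq_nonneg _))
    refine (mul_le_mul_of_nonneg_left h4 (hE.pos (p.2, v)).le).trans (le_of_eq ?_)
    change fInf (p.2, v) * ((C / ρ) ^ 2 * (8 * (d + 1) ^ 2 * (a2 + b2 * (1 + I ^ 2 + W ^ 2 +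
      localForce G (p.2, v) ^ 2)))) = _
    rw [hK]; ring
  have hint : Integrable fun v => K / ρ ^ 2 * ((a2 + b2 * (1 + I ^ 2 + W ^ 2)) * fInf (p.2, v) +
        b2 * (fInf (p.2, v) * localForce G (p.2, v) ^ 2)) :=
    (((hE.integrable_slice p.2).const_mul _).add (hi.const_mul _)).const_mul _
  refine (lintegral_mono fun v => ENNReal.ofReal_le_ofReal (hpt v)).trans ?_
  rw [← ofReal_integral_eq_lintegral_ofReal hint (.of_forall fun v =>
    le_trans (mul_nonneg (hE.pos _).le (sq_nonneg _)) (hpt v)), ← ENNReal.ofReal_mul hK0]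
  refine ENNReal.ofReal_le_ofReal (le_of_eq ?_)
  rw [integral_const_mul, integral_add ((hE.integrable_slice p.2).const_mul _) (hi.const_mul _),
    integral_const_mul, integral_const_mul, hI, hw]
  change K / ρ ^ 2 * ((a2 + b2 * (1 + I ^ 2 + W ^ 2)) * ρ + b2 * S) = _
  field_simp
  ring

/-- Fields obeying the pointwise bound define elements of the dual space. -/
theorem memLp_field_of_abs_le (hE : IsEquilibrium fInf) (hG : ContDiff ℝ ∞ G)
    {Y : ℝ × E d × E d → ℝ} (hYm : AEStronglyMeasurable Y ((timeMeasure T).prod volume))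
    (hY : ∀ y, |Y y| ≤ C / density fInf y.2.1 * fieldBound G fInf F D y) {B : ℝ} (hB : 0 ≤ B)
    (h : ∫⁻ p in slab d T, ENNReal.ofReal
        (((∑ i, F i p ^ 2) * weight G fInf p.2 + ∑ i, ∑ j, D i j p ^ 2) / density fInf p.2) ≤
      ENNReal.ofReal B) :
    ∃ hm : MemLp (fun y => Y y * fInf y.2) 2 (spaceTimeMeasure T fInf),
      ‖hm.toLp‖ ^ 2 ≤ 8 * C ^ 2 * (d + 1) ^ 2 * B := by
  refine hE.memLp_field hYm (by positivity) ?_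
  refine (lintegral_mono fun p => lintegral_field_slice_le hE hG hY p).trans ?_
  rw [lintegral_const_mul' _ _ ENNReal.ofReal_ne_top, ENNReal.ofReal_mul (q := B) (by positivity)]
  exact mul_le_mul_right h _

end Bound

end Kinetic

end

/-! ### Integration by parts in space-time against F. -/

noncomputable section

namespace Kinetic

variable {d : ℕ}

section WeakDerivative

variable {T : ℝ} {F D : ℝ × E d → ℝ}

theorem LocallyIntegrableOn.integrableOn_mul_of_hasCompactSupport
    (hF : LocallyIntegrableOn F (slab d T)) {a : ℝ × E d → ℝ} (ha : Continuous a)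
    (hc : HasCompactSupport a) : IntegrableOn (fun p => F p * a p) (slab d T) := by
  obtain ⟨C, hC⟩ := hc.exists_bound_of_continuous ha
  have hclosed : IsClosed (slab d T) := isClosed_Icc.prod isClosed_univ
  have h1 : IntegrableOn F (tsupport a ∩ slab d T) :=
    hF.integrableOn_compact_subset inter_subset_right (hc.isCompact.inter_right hclosed)
  have h2 : IntegrableOn (fun p => F p * a p) (tsupport a ∩ slab d T) :=
    Integrable.mul_bdd (c := C) h1 ha.aestronglyMeasurable (.of_forall hC)
  rw [← integrable_indicator_iff (hclosed.measurableSet)]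
  rw [← integrable_indicator_iff ((isClosed_tsupport a).inter hclosed).measurableSet] at h2
  refine h2.congr (.of_forall fun p => ?_)
  by_cases hp : p ∈ tsupport a
  · by_cases hs : p ∈ slab d T <;> simp [hp, hs]
  · by_cases hs : p ∈ slab d T <;> simp [hp, hs, image_eq_zero_of_notMem_tsupport hp]

/-- Products θ(t)φ(x) are not compactly supported in time. Multiplying θ by a function equal to 1
near each point of [0, T] changes neither value nor derivative on the slab and gives an admissible
test function. -/
theorem exists_time_cutoff (T : ℝ) : ∃ ζ : ℝ → ℝ, ContDiff ℝ 1 ζ ∧ HasCompactSupport ζ ∧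
    ∀ t ∈ Icc 0 T, ζ =ᶠ[nhds t] fun _ => 1 := by
  let b : ContDiffBump (0 : ℝ) := ⟨|T| + 1, |T| + 2, by positivity, by linarith⟩
  refine ⟨b, b.contDiff, b.hasCompactSupport, fun t ht => ?_⟩
  refine b.eventuallyEq_one_of_mem_ball ?_
  rw [Metric.mem_ball, dist_zero_right, Real.norm_eq_abs, abs_of_nonneg ht.1]
  exact ht.2.trans_lt (lt_of_le_of_lt (le_abs_self T) (by simp [b]))

variable {θ : ℝ → ℝ} {φ : E d → ℝ}

theorem fderiv_mul_prod (hθ : ContDiff ℝ 1 θ) (hφ : ContDiff ℝ 1 φ) (p e : ℝ × E d) :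
    fderiv ℝ (fun q : ℝ × E d => θ q.1 * φ q.2) p e =
      deriv θ p.1 * e.1 * φ p.2 + θ p.1 * fderiv ℝ φ p.2 e.2 := by
  have h1 : HasFDerivAt (fun q : ℝ × E d => θ q.1) _ p :=
    ((hθ.differentiable (by norm_num)) p.1).hasFDerivAt.comp p hasFDerivAt_fst
  have h2 : HasFDerivAt (fun q : ℝ × E d => φ q.2) _ p :=
    ((hφ.differentiable (by norm_num)) p.2).hasFDerivAt.comp p hasFDerivAt_snd
  have h3 : HasFDerivAt (fun q : ℝ × E d => θ q.1 * φ q.2) _ p := h1.mul h2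
  rw [h3.fderiv]
  simp [fderiv_eq_smul_deriv]
  ring

/-- Testing the weak derivative with products. -/
theorem HasWeakDerivZeroBoundary.integral_mul_prod {e : ℝ × E d}
    (h : HasWeakDerivZeroBoundary T F D e) (hθ : ContDiff ℝ 1 θ) (hφ : ContDiff ℝ 1 φ)
    (hc : HasCompactSupport φ) :
    IntegrableOn (fun p => F p * (deriv θ p.1 * e.1 * φ p.2 + θ p.1 * fderiv ℝ φ p.2 e.2) +
      D p * (θ p.1 * φ p.2)) (slab d T) ∧
    ∫ p in slab d T, (F p * (deriv θ p.1 * e.1 * φ p.2 + θ p.1 * fderiv ℝ φ p.2 e.2) +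
      D p * (θ p.1 * φ p.2)) = 0 := by
  obtain ⟨ζ, hζ, hζc, hζ1⟩ := exists_time_cutoff T
  set ψ : ℝ × E d → ℝ := fun q => (ζ q.1 * θ q.1) * φ q.2 with hψ
  have hψd : ContDiff ℝ 1 ψ :=
    ((hζ.mul hθ).comp contDiff_fst).mul (hφ.comp contDiff_snd)
  have hψc : HasCompactSupport ψ := by
    refine HasCompactSupport.intro (hζc.isCompact.prod hc.isCompact) fun q hq => ?_
    rw [mem_prod, not_and_or] at hq
    rcases hq with hq | hq <;> simp [hψ, image_eq_zero_of_notMem_tsupport hq]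
  have hmeas : MeasurableSet (slab d T) := measurableSet_Icc.prod MeasurableSet.univ
  have hval : ∀ p ∈ slab d T, ψ p = θ p.1 * φ p.2 := fun p hp => by
    simp [hψ, (hζ1 p.1 hp.1).eq_of_nhds]
  have hder : ∀ p ∈ slab d T, fderiv ℝ ψ p e =
      deriv θ p.1 * e.1 * φ p.2 + θ p.1 * fderiv ℝ φ p.2 e.2 := fun p hp => by
    rw [← fderiv_mul_prod hθ hφ]
    have : ψ =ᶠ[nhds p] fun q => θ q.1 * φ q.2 := by
      filter_upwards [continuous_fst.continuousAt.eventually (hζ1 p.1 hp.1)] with q hq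
      simp only [hψ, hq, one_mul]
    rw [this.fderiv_eq]
  have i1 := LocallyIntegrableOn.integrableOn_mul_of_hasCompactSupport h.1
    ((hψd.continuous_fderiv (by norm_num)).clm_apply continuous_const) (hψc.fderiv_apply ℝ e)
  have i2 := LocallyIntegrableOn.integrableOn_mul_of_hasCompactSupport h.2.1 hψd.continuous hψc
  have hcongr : EqOn (fun p => F p * fderiv ℝ ψ p e + D p * ψ p)
      (fun p => F p * (deriv θ p.1 * e.1 * φ p.2 + θ p.1 * fderiv ℝ φ p.2 e.2) +
      D p * (θ p.1 * φ p.2)) (slab d T) := fun p hp => by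
    simp only [hval p hp, hder p hp]
  refine ⟨(integrableOn_congr_fun hcongr hmeas).1 (i1.add i2), ?_⟩
  rw [← setIntegral_congr_fun hmeas hcongr, integral_add i1 i2, h.integral_eq hψd hψc]
  ring

end WeakDerivative

section Identities

variable {L : Collision} {G : E d × E d → E d} {M fInf : E d × E d → ℝ} {C T : ℝ}
  {β : Fin (d + 1) → E d × E d → ℝ} {F : Fin (d + 1) → ℝ × E d → ℝ}
  {D : Fin (d + 1) → Fin (d + 1) → ℝ × E d → ℝ}

/-- For a test function g, the moments ⟨v_i β_j g⟩ are the spatial test functions fed to the weak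
derivatives of F. -/
theorem contDiff_moment (hβ : IsDualFamily L G M fInf C β) {g : E d × E d → ℝ} (hg : IsTest g)
    (j : Fin (d + 1)) (i : Fin (d + 1)) :
    ContDiff ℝ 1 (density fun z => vel z.2 i * β j z * g z) ∧
    HasCompactSupport (density fun z => vel z.2 i * β j z * g z) := by
  constructor
  · refine contDiff_density (R := 1) ?_ ?_
    · exact ((((contDiff_vel i).comp contDiff_snd).mul (hβ.contDiff j)).mul
        (hg.1.of_le (by norm_cast)))
    · exact ((hβ.velocityBounded j).mul_right _).mul_left _
  · refine HasCompactSupport.intro (hg.2.isCompact.image continuous_fst) fun x hx => ?_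
    have : ∀ v, g (x, v) = 0 := fun v => by
      by_contra h
      exact hx ⟨(x, v), subset_tsupport _ h, rfl⟩
    simp [density, this]

theorem integrable_moment (hβ : IsDualFamily L G M fInf C β) {g : E d × E d → ℝ} (hg : Continuous g)
    (i j : Fin (d + 1)) (x : E d) : Integrable fun v => vel v i * β j (x, v) * g (x, v) := by
  refine VelocityBounded.integrable (R := 1) (f := fun z => vel z.2 i * β j z * g z)
    (((hβ.velocityBounded j).mul_right _).mul_left _) ?_ x
  exact (((contDiff_vel i (n := 0)).continuous.comp continuous_snd).mul
    (hβ.contDiff j).continuous).mul hg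

theorem integral_fluxField_mul {g : E d × E d → ℝ}
    (p : ℝ × E d) (hg : ∀ j, Integrable fun v => β j (p.2, v) * g (p.2, v)) :
    ∫ v, fluxField F β (p.1, p.2, v) * g (p.2, v) =
      ∑ j, F j p * ∫ v, β j (p.2, v) * g (p.2, v) := by
  simp only [fluxField, Finset.sum_mul, mul_assoc]
  rw [integral_finsetSum _ fun j _ => (hg j).const_mul _]
  simp only [integral_const_mul]

theorem integral_timeField_mul (hβ : IsDualFamily L G M fInf C β) {g : E d × E d → ℝ}
    (hg : Continuous g) (p : ℝ × E d) :
    ∫ v, timeField D β (p.1, p.2, v) * g (p.2, v) =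
      ∑ j, D j 0 p * density (fun z => vel z.2 0 * β j z * g z) p.2 := by
  have hi : ∀ j, Integrable fun v => β j (p.2, v) * g (p.2, v) := fun j => by
    simpa [vel] using integrable_moment hβ hg 0 j p.2
  simp only [timeField, Finset.sum_mul, mul_assoc]
  rw [integral_finsetSum _ fun j _ => (hi j).const_mul _]
  simp [integral_const_mul, density, vel]

theorem integral_spaceField_mul (hβ : IsDualFamily L G M fInf C β) {g : E d × E d → ℝ}
    (hg : Continuous g) (p : ℝ × E d)
    (ha : ∀ j, Integrable fun v => g (p.2, v) * adjointOp L G M (β j) (p.2, v)) :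
    ∫ v, spaceField L G M F D β (p.1, p.2, v) * g (p.2, v) =
      ∑ j, ((∑ i : Fin d, D j i.succ p * density (fun z => z.2 i * β j z * g z) p.2) +
        F j p * ∫ v, g (p.2, v) * adjointOp L G M (β j) (p.2, v)) := by
  have hi : ∀ (i : Fin d) j, Integrable fun v => v i * β j (p.2, v) * g (p.2, v) := fun i j => by
    simpa [vel] using integrable_moment hβ hg i.succ j p.2
  have hpt : ∀ v, spaceField L G M F D β (p.1, p.2, v) * g (p.2, v) =
      ∑ j, ((∑ i : Fin d, D j i.succ p * (v i * β j (p.2, v) * g (p.2, v))) +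
        F j p * (g (p.2, v) * adjointOp L G M (β j) (p.2, v))) := fun v => by
    simp only [spaceField, Finset.sum_mul, add_mul]
    refine Finset.sum_congr rfl fun j _ => ?_
    congr 1
    · refine Finset.sum_congr rfl fun i _ => ?_
      ring
    · ring
  have h1 : ∀ j, Integrable fun v => ∑ i : Fin d, D j i.succ p * (v i * β j (p.2, v) * g (p.2, v)) :=
    fun j => integrable_finsetSum _ fun i _ => (hi i j).const_mul _
  simp only [hpt]
  have h2 : ∀ j, Integrable fun v =>
      ∑ i : Fin d, D j i.succ p * (v i * β j (p.2, v) * g (p.2, v)) +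
        F j p * (g (p.2, v) * adjointOp L G M (β j) (p.2, v)) := fun j =>
    (h1 j).add ((ha j).const_mul _)
  rw [integral_finsetSum _ fun j _ => h2 j]
  refine Finset.sum_congr rfl fun j _ => ?_
  rw [integral_add (h1 j) ((ha j).const_mul _), integral_finsetSum _ fun i _ => (hi i j).const_mul _]
  simp only [integral_const_mul, density]

theorem integrable_mul_evolutionOp (hG : ContDiff ℝ ∞ G) (hM : IsBackground L M)
    {f b : E d × E d → ℝ} {R : ℝ} (hf : Regular L f)
    (hb : ContDiff ℝ 1 b) (hb2 : ∀ i, ContDiff ℝ 1 (dV i b)) (hR : VelocityBounded R b) (x : E d) :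
    Integrable fun v => b (x, v) * evolutionOp L G M f (x, v) := by
  have hT : Continuous (transportOp G f) := by
    have h : transportOp G f = fun z =>
        ∑ i, z.2 i * dX i f z + ∑ i, dV i (fun y => f y * G y i) z := funext fun z =>
      transportOp_eq hG (hf.contDiff.differentiable (by norm_num) z)
    rw [h]
    refine (continuous_finsetSum _ fun i _ => ?_).add (continuous_finsetSum _ fun i _ => ?_)
    · exact (contDiff_velocity i (n := 1)).continuous.mul (continuous_dX hf.contDiff i)
    · exact continuous_dV (hf.contDiff.mul ((contDiff_coord hG i).of_le
        (by exact_mod_cast le_top))) i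
  have i1 : Integrable fun v => b (x, v) * transportOp G f (x, v) :=
    (hR.mul_left (transportOp G f)).integrable (hb.continuous.mul hT) x
  refine ((integral_collisionOp_mul hM hf hb hb2 hR x).1.sub i1).congr (.of_forall fun v => ?_)
  simp only [evolutionOp, Pi.sub_apply]; ring

/-- The space-time field is adapted to the evolution on the closure of the graph. -/
theorem inner_spaceField_eq (hE : IsEquilibrium fInf) (hG : ContDiff ℝ ∞ G) (hM : IsBackground L M)
    (hβ : IsDualFamily L G M fInf C β)
    (hFD : ∀ i j, HasWeakDerivZeroBoundary T (F i) (D i j) (stDir j))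
    (hP : MemLp (fun y => fluxField F β y * fInf y.2) 2 (spaceTimeMeasure T fInf))
    (hQ : MemLp (fun y => spaceField L G M F D β y * fInf y.2) 2 (spaceTimeMeasure T fInf))
    {θ : C(ℝ, ℝ)} (hθ : ContDiff ℝ 1 θ) {p : WL2 fInf × WL2 fInf}
    (hp : p ∈ closure (coreGraph L G M fInf)) :
    inner ℝ hQ.toLp (IsEquilibrium.tensor T θ p.1) =
      inner ℝ hP.toLp (IsEquilibrium.tensor T θ p.2) := by
  have hclosed : IsClosed {p : WL2 fInf × WL2 fInf |
      inner ℝ hQ.toLp (IsEquilibrium.tensor T θ p.1) =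
      inner ℝ hP.toLp (IsEquilibrium.tensor T θ p.2)} :=
    isClosed_eq (by fun_prop) (by fun_prop)
  refine closure_minimal ?_ hclosed hp
  rintro q ⟨g, hg, hq1, hq2⟩
  rw [Set.mem_ofPred_eq]
  obtain ⟨i1, e1⟩ := hE.inner_field_tensor hQ θ hq1
  obtain ⟨i2, e2⟩ := hE.inner_field_tensor hP θ hq2
  rw [e1, e2, ← sub_eq_zero, ← integral_sub i1 i2]
  have hgr := hg.regular L
  have hadj := fun j (x : E d) => integral_evolutionOp_mul hG hM hgr (hβ.contDiff j)
    (hβ.contDiff_dV j) (hβ.velocityBounded j) x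
  have hint : ∀ j (x : E d), Integrable fun v => β j (x, v) * evolutionOp L G M g (x, v) := fun j x =>
    integrable_mul_evolutionOp hG hM hgr (hβ.contDiff j) (hβ.contDiff_dV j)
      (hβ.velocityBounded j) x
  have hcore := fun j (i : Fin d) => (hFD j i.succ).integral_mul_prod hθ
    (contDiff_moment hβ hg j i.succ).1 (contDiff_moment hβ hg j i.succ).2
  -- By the local weak form the terms with A*β_j cancel. What is left is ∑ (F_j ∂_i m + ∂_i F_j m)
  -- with m the moments of g, and each summand integrates to zero.
  have hpt : ∀ p : ℝ × E d, θ p.1 * (∫ v, spaceField L G M F D β (p.1, p.2, v) * g (p.2, v)) -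
      θ p.1 * ∫ v, fluxField F β (p.1, p.2, v) * evolutionOp L G M g (p.2, v) =
      ∑ j, ∑ i : Fin d, (F j p * (deriv θ p.1 * (stDir (d := d) i.succ).1 *
        density (fun z => vel z.2 i.succ * β j z * g z) p.2 + θ p.1 * fderiv ℝ
        (density (fun z => vel z.2 i.succ * β j z * g z)) p.2 (stDir i.succ).2) +
        D j i.succ p * (θ p.1 * density (fun z => vel z.2 i.succ * β j z * g z) p.2)) := fun p => by
    rw [integral_spaceField_mul hβ hg.1.continuous p fun j => (hadj j p.2).1,
      integral_fluxField_mul p fun j => hint j p.2, ← mul_sub, ← Finset.sum_sub_distrib,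
      Finset.mul_sum]
    refine Finset.sum_congr rfl fun j _ => ?_
    have h2 := (hadj j p.2).2
    have h3 : ∫ v, β j (p.2, v) * evolutionOp L G M g (p.2, v) =
      ∫ v, evolutionOp L G M g (p.2, v) * β j (p.2, v) := by simp only [mul_comm]
    rw [h3, h2]
    simp only [stDir, vel, Fin.cases_succ, mul_zero, zero_mul, zero_add]
    rw [Finset.sum_add_distrib]
    have e1 : ∑ i : Fin d, F j p * (θ p.1 * fderiv ℝ (density fun z => z.2 i * β j z * g z) p.2
        (EuclideanSpace.single i 1)) = θ p.1 * (F j p * ∑ i : Fin d, fderiv ℝ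
        (density fun z => z.2 i * β j z * g z) p.2 (EuclideanSpace.single i 1)) := by
      simp only [Finset.mul_sum]
      exact Finset.sum_congr rfl fun i _ => by ring
    have e2 : ∑ i : Fin d, D j i.succ p * (θ p.1 * density (fun z => z.2 i * β j z * g z) p.2) =
        θ p.1 * ∑ i : Fin d, D j i.succ p * density (fun z => z.2 i * β j z * g z) p.2 := by
      simp only [Finset.mul_sum]
      exact Finset.sum_congr rfl fun i _ => by ring
    rw [e1, e2]; ring
  rw [integral_congr_ae (.of_forall hpt), integral_finsetSum _ fun j _ =>
    integrable_finsetSum _ fun i _ => (hcore j i).1]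
  refine Finset.sum_eq_zero fun j _ => ?_
  rw [integral_finsetSum _ fun i _ => (hcore j i).1]
  exact Finset.sum_eq_zero fun i _ => (hcore j i).2

/-- The time component. -/
theorem inner_timeField_eq (hE : IsEquilibrium fInf)
    (hβ : IsDualFamily L G M fInf C β)
    (hFD : ∀ i j, HasWeakDerivZeroBoundary T (F i) (D i j) (stDir j))
    (hP : MemLp (fun y => fluxField F β y * fInf y.2) 2 (spaceTimeMeasure T fInf))
    (hQ : MemLp (fun y => timeField D β y * fInf y.2) 2 (spaceTimeMeasure T fInf))
    {θ θ' : C(ℝ, ℝ)} (hθ : ∀ t, HasDerivAt θ (θ' t) t) {u : WL2 fInf}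
    (hu : u ∈ closure (Prod.fst '' coreGraph L G M fInf)) :
    inner ℝ hP.toLp (IsEquilibrium.tensor T θ' u) +
      inner ℝ hQ.toLp (IsEquilibrium.tensor T θ u) = 0 := by
  have hθ1 : ContDiff ℝ 1 θ := by
    rw [contDiff_one_iff_deriv]
    refine ⟨fun t => (hθ t).differentiableAt, ?_⟩
    rw [show deriv θ = θ' from funext fun t => (hθ t).deriv]
    exact θ'.continuous
  have hclosed : IsClosed {u : WL2 fInf |
      inner ℝ hP.toLp (IsEquilibrium.tensor T θ' u) +
      inner ℝ hQ.toLp (IsEquilibrium.tensor T θ u) = 0} :=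
    isClosed_eq (by fun_prop) (by fun_prop)
  refine closure_minimal ?_ hclosed hu
  rintro _ ⟨q, ⟨g, hg, hq1, -⟩, rfl⟩
  rw [Set.mem_ofPred_eq]
  obtain ⟨i1, e1⟩ := hE.inner_field_tensor hP θ' hq1
  obtain ⟨i2, e2⟩ := hE.inner_field_tensor hQ θ hq1
  rw [e1, e2, ← integral_add i1 i2]
  have hint : ∀ j (x : E d), Integrable fun v => β j (x, v) * g (x, v) := fun j x => by
    simpa [vel] using integrable_moment hβ hg.1.continuous 0 j x
  have hcore := fun j => (hFD j 0).integral_mul_prod hθ1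
    (contDiff_moment hβ hg j 0).1 (contDiff_moment hβ hg j 0).2
  -- The integrand is ∑ (F_j θ' + ∂_t F_j θ) m_j with m_j = ⟨β_j g⟩. It integrates to zero although
  -- θ is arbitrary at 0 and T, since F has zero traces there.
  have hpt : ∀ p : ℝ × E d, θ' p.1 * (∫ v, fluxField F β (p.1, p.2, v) * g (p.2, v)) +
      θ p.1 * ∫ v, timeField D β (p.1, p.2, v) * g (p.2, v) =
      ∑ j, (F j p * (deriv θ p.1 * (stDir (d := d) 0).1 *
        density (fun z => vel z.2 0 * β j z * g z) p.2 + θ p.1 * fderiv ℝ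
        (density (fun z => vel z.2 0 * β j z * g z)) p.2 (stDir 0).2) +
        D j 0 p * (θ p.1 * density (fun z => vel z.2 0 * β j z * g z) p.2)) := fun p => by
    rw [integral_timeField_mul hβ hg.1.continuous p,
      integral_fluxField_mul p fun j => hint j p.2, Finset.mul_sum, Finset.mul_sum,
      ← Finset.sum_add_distrib]
    refine Finset.sum_congr rfl fun j _ => ?_
    rw [(hθ p.1).deriv]
    simp [stDir, vel, density]
    ring
  rw [integral_congr_ae (.of_forall hpt), integral_finsetSum _ fun j _ => (hcore j).1]
  exact Finset.sum_eq_zero fun j _ => (hcore j).2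

/-- Pairing with local equilibria gives the space-time divergence. -/
theorem inner_field_proj (hE : IsEquilibrium fInf) (hG : ContDiff ℝ ∞ G) (hM : IsBackground L M)
    {cInf cM : ℝ} (hS : IsStationaryState L G M fInf cInf cM) (hc : 0 < cInf)
    (hβ : IsDualFamily L G M fInf C β)
    (hR : MemLp (fun y => timeField D β y * fInf y.2) 2 (spaceTimeMeasure T fInf))
    (hQ : MemLp (fun y => spaceField L G M F D β y * fInf y.2) 2 (spaceTimeMeasure T fInf))
    (θ : C(ℝ, ℝ)) (u : WL2 fInf) :
    inner ℝ hR.toLp (IsEquilibrium.tensor T θ (hE.proj u)) +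
      inner ℝ hQ.toLp (IsEquilibrium.tensor T θ (hE.proj u)) =
      ∫ p in slab d T, θ p.1 * ((∑ i, D i i p) * (density u p.2 / density fInf p.2)) := by
  obtain ⟨i1, e1⟩ := hE.inner_field_tensor hR θ (hE.proj_coeFn u)
  obtain ⟨i2, e2⟩ := hE.inner_field_tensor hQ θ (hE.proj_coeFn u)
  rw [e1, e2, ← integral_add i1 i2]
  refine integral_congr_ae (.of_forall fun p => ?_)
  dsimp only
  have hstat : ∀ z, evolutionOp L G M fInf z = 0 := fun z => by
    rw [evolutionOp, hS.stationary]; ring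
  have hadj := fun j => integral_evolutionOp_mul hG hM (hS.regular hc) (hβ.contDiff j)
    (hβ.contDiff_dV j) (hβ.velocityBounded j) p.2
  have hdens : ∀ j (i : Fin d) x, density (fun z => z.2 i * β j z * fInf z) x =
      if i.succ = j then 1 else 0 := fun j i x => by
    rw [← hβ.dual x i.succ j]
    exact integral_congr_ae (.of_forall fun v => by simp [vel]; ring)
  have hdens0 : ∀ j x, density (fun z => vel z.2 0 * β j z * fInf z) x =
      if 0 = j then 1 else 0 := fun j x => by
    rw [← hβ.dual x 0 j]
    exact integral_congr_ae (.of_forall fun v => by simp [vel]; ring)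
  -- The local weak form is used with f = f∞: the left side is zero by stationarity, and the moments
  -- ⟨v_i β_j f∞⟩ are constants by duality, so their derivatives vanish.
  have hzero : ∀ j, ∫ v, fInf (p.2, v) * adjointOp L G M (β j) (p.2, v) = 0 := fun j => by
    have h := (hadj j).2
    simp only [hstat, zero_mul, integral_zero] at h
    have hk : ∀ i : Fin d, density (fun z => z.2 i * β j z * fInf z) =
        fun _ => if i.succ = j then 1 else 0 := fun i => funext (hdens j i)
    simp only [hk, fderiv_fun_const, Pi.zero_apply, zero_apply, Finset.sum_const_zero,
      sub_zero] at h
    exact h.symm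
  have hr : ∀ Y : E d → ℝ, ∫ v, Y v * IsEquilibrium.localEquilibrium fInf u (p.2, v) =
      (∫ v, Y v * fInf (p.2, v)) * (density u p.2 / density fInf p.2) := fun Y => by
    rw [← integral_mul_const]
    refine integral_congr_ae (.of_forall fun v => ?_)
    simp only [IsEquilibrium.localEquilibrium]; ring
  rw [hr, hr, integral_timeField_mul hβ hE.continuous p,
    integral_spaceField_mul hβ hE.continuous p fun j => (hadj j).1, ← mul_add, ← add_mul]
  simp only [hdens, hdens0, hzero]
  rw [Fin.sum_univ_succ (fun i => D i i p)]
  simp [Finset.sum_comm (s := (Finset.univ : Finset (Fin (d + 1))))]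

end Identities

end Kinetic

end

/-! ### The macroscopic bound for finite sums of products. -/

noncomputable section

namespace Kinetic

variable {d : ℕ}

namespace IsEquilibrium

variable {fInf : E d × E d → ℝ} {T : ℝ} {ι : Type*} [Fintype ι]

theorem coeFn_sum_tensor (b : ι → C(ℝ, ℝ)) (u : ι → WL2 fInf) :
    (∑ k, tensor T (b k) (u k) : STL2 T fInf) =ᵐ[spaceTimeMeasure T fInf]
      fun y => ∑ k, b k y.1 * u k y.2 := by
  have h : ∀ᵐ y ∂spaceTimeMeasure T fInf, ∀ k, tensor T (b k) (u k) y = b k y.1 * u k y.2 :=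
    ae_all_iff.2 fun k => tensor_coeFn (b k) (u k)
  filter_upwards [Lp.coeFn_finsetSum Finset.univ fun k => tensor T (b k) (u k), h] with y h1 h2
  rw [h1, Finset.sum_apply]
  exact Finset.sum_congr rfl fun k _ => h2 k

/-- The density of a finite sum of products. -/
def sumDensity (b : ι → C(ℝ, ℝ)) (u : ι → WL2 fInf) (p : ℝ × E d) : ℝ :=
  ∑ k, b k p.1 * density (u k) p.2

theorem measurable_sumDensity (b : ι → C(ℝ, ℝ)) (u : ι → WL2 fInf) :
    Measurable (sumDensity b u) :=
  Finset.measurable_sum _ fun k _ => ((b k).continuous.measurable.comp measurable_fst).mul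
    ((measurable_density (u k)).comp measurable_snd)

/-- Zero mass of each factor supplies the zero-average condition needed to apply (H3). -/
theorem integral_sumDensity (hE : IsEquilibrium fInf) (b : ι → C(ℝ, ℝ)) (u : ι → WL2 fInf)
    (hu : ∀ k, inner ℝ (u k) hE.toWL2 = 0) : ∫ p in slab d T, sumDensity b u p = 0 := by
  have h1 : ∀ k, Integrable (fun z => u k z) ((volume : Measure (E d)).prod volume) :=
    fun k => hE.integrable_coe (u k)
  have h2 : ∀ k, Integrable (density (u k)) := fun k => (h1 k).integral_prod_left
  have h3 : ∀ k, ∫ x, density (u k) x = 0 := fun k => by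
    rw [← hu k, hE.inner_toWL2, Measure.volume_eq_prod, integral_prod _ (h1 k)]; rfl
  have h4 : ∀ k, Integrable (fun t => b k t) (timeMeasure T) := fun k =>
    (b k).continuous.integrableOn_Icc
  simp only [sumDensity]
  rw [volume_restrict_slab, integral_finsetSum _ fun k _ => (h4 k).mul_prod (h2 k)]
  refine Finset.sum_eq_zero fun k _ => ?_
  rw [integral_prod_mul (μ := timeMeasure T) (fun t => b k t) (density (u k)), h3, mul_zero]

theorem sum_tensor_proj_ae (hE : IsEquilibrium fInf) (b : ι → C(ℝ, ℝ)) (u : ι → WL2 fInf) :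
    (fun y : ℝ × E d × E d => sumDensity b u (y.1, y.2.1) / density fInf y.2.1 * fInf y.2)
      =ᵐ[spaceTimeMeasure T fInf] (∑ k, tensor T (b k) (hE.proj (u k)) : STL2 T fInf) := by
  have h : ∀ᵐ y ∂spaceTimeMeasure T fInf, ∀ k,
      hE.proj (u k) y.2 = localEquilibrium fInf (u k) y.2 := ae_all_iff.2 fun k =>
    (Measure.quasiMeasurePreserving_snd (μ := timeMeasure T)
      (ν := weightedMeasure fInf)).ae (hE.proj_coeFn (u k))
  filter_upwards [h, coeFn_sum_tensor (T := T) b fun k => hE.proj (u k)] with y h1 h2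
  rw [h2, sumDensity, Finset.sum_div, Finset.sum_mul]
  refine Finset.sum_congr rfl fun k _ => ?_
  rw [h1, localEquilibrium]; ring

theorem memLp_macroField (hE : IsEquilibrium fInf) (b : ι → C(ℝ, ℝ)) (u : ι → WL2 fInf) :
    MemLp (fun y : ℝ × E d × E d => sumDensity b u (y.1, y.2.1) / density fInf y.2.1 * fInf y.2) 2
      (spaceTimeMeasure T fInf) :=
  (memLp_congr_ae (hE.sum_tensor_proj_ae b u)).2 (Lp.memLp _)

theorem toLp_macroField (hE : IsEquilibrium fInf) (b : ι → C(ℝ, ℝ)) (u : ι → WL2 fInf) :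
    MemLp.toLp _ (hE.memLp_macroField (T := T) b u) = ∑ k, tensor T (b k) (hE.proj (u k)) :=
  Lp.ext ((MemLp.coeFn_toLp _).trans (hE.sum_tensor_proj_ae b u))

/-- Integrating f∞ (ρ/⟨f∞⟩)² over v gives ρ²/⟨f∞⟩, so the right-hand side of (H3) is exactly the
squared norm of the macroscopic part. -/
theorem lintegral_sumDensity_sq (hE : IsEquilibrium fInf) (b : ι → C(ℝ, ℝ)) (u : ι → WL2 fInf) :
    ∫⁻ p in slab d T, ENNReal.ofReal (sumDensity b u p ^ 2 / density fInf p.2) =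
      ENNReal.ofReal (‖∑ k, tensor T (b k) (hE.proj (u k))‖ ^ 2) := by
  set Y : ℝ × E d × E d → ℝ := fun y => sumDensity b u (y.1, y.2.1) / density fInf y.2.1 with hY
  have hm := hE.memLp_macroField (T := T) b u
  have hYm : Measurable Y :=
    ((measurable_sumDensity b u).comp (by fun_prop : Measurable fun y : ℝ × E d × E d =>
      (y.1, y.2.1))).div (hE.continuous_density.measurable.comp (by fun_prop))
  have hpt : ∀ y : ℝ × E d × E d, (Y y * fInf y.2) ^ 2 / fInf y.2 = fInf y.2 * Y y ^ 2 :=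
    fun y => by
    have := (hE.pos y.2).ne'
    field_simp
  have hn : ‖MemLp.toLp _ hm‖ ^ 2 = ∫ y, fInf y.2 * Y y ^ 2 ∂(timeMeasure T).prod volume := by
    rw [← real_inner_self_eq_norm_sq, L2.inner_def]
    simp only [← hpt]
    rw [← hE.integral_spaceTime]
    refine integral_congr_ae ?_
    filter_upwards [hm.coeFn_toLp] with y hy
    rw [hy, real_inner_self_eq_norm_sq, Real.norm_eq_abs, sq_abs]
  have hint : Integrable (fun y : ℝ × E d × E d => fInf y.2 * Y y ^ 2)
      ((timeMeasure T).prod volume) := by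
    have := hm.integrable_sq
    rw [hE.integrable_spaceTime] at this
    simpa only [← hpt] using this
  rw [← hE.toLp_macroField, hn, ofReal_integral_eq_lintegral_ofReal hint
    (.of_forall fun y => mul_nonneg (hE.pos _).le (sq_nonneg _)),
    lintegral_iterated hint.1.aemeasurable.ennreal_ofReal]
  refine lintegral_congr fun p => ?_
  have hi : Integrable fun v => fInf (p.2, v) * Y (p.1, p.2, v) ^ 2 :=
    (hE.integrable_slice p.2).mul_const ((sumDensity b u p / density fInf p.2) ^ 2)
  rw [← ofReal_integral_eq_lintegral_ofReal hi
    (.of_forall fun y => mul_nonneg (hE.pos _).le (sq_nonneg _))]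
  simp only [hY]
  rw [integral_mul_const]
  change _ = ENNReal.ofReal (density fInf p.2 * _)
  congr 1
  have := (hE.density_pos p.2).ne'
  field_simp

theorem norm_sq_sum_tensor_proj (hE : IsEquilibrium fInf) (b : ι → C(ℝ, ℝ)) (u : ι → WL2 fInf) :
    ‖∑ k, tensor T (b k) (hE.proj (u k))‖ ^ 2 =
      ∑ k, ∫ p in slab d T, b k p.1 *
        (sumDensity b u p * (density (u k) p.2 / density fInf p.2)) := by
  have h : ‖∑ k, tensor T (b k) (hE.proj (u k))‖ ^ 2 = ∑ k,
      inner ℝ (MemLp.toLp _ (hE.memLp_macroField (T := T) b u))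
        (tensor T (b k) (hE.proj (u k))) := by
    rw [hE.toLp_macroField, ← inner_sum, real_inner_self_eq_norm_sq]
  rw [h]
  refine Finset.sum_congr rfl fun k _ => ?_
  rw [(hE.inner_field_tensor (hE.memLp_macroField b u) (b k) (hE.proj_coeFn (u k))).2]
  refine integral_congr_ae (.of_forall fun p => ?_)
  have := hE.density_localEquilibrium (u k) p.2
  rw [density] at this
  simp only [integral_const_mul, this]
  ring

end IsEquilibrium

open IsEquilibrium

/-- The macroscopic part of a finite sum of products is controlled by its microscopic part and
by the error in the evolution equation. -/
theorem exists_macroscopic_bound (d : ℕ) (cM lam2 : ℝ) {cInf : ℝ} (hc : 0 < cInf) :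
    ∃ K : ℝ, 0 < K ∧ ∀ (L : Collision) (G : E d × E d → E d) (M fInf : E d × E d → ℝ) (T : ℝ),
      ContDiff ℝ ∞ G → IsBackground L M → IsStationaryState L G M fInf cInf cM →
      SpatialCoercivity G fInf T lam2 → ∀ (hE : IsEquilibrium fInf) (n : ℕ)
      (a b : Fin n → C(ℝ, ℝ)) (u w : Fin n → WL2 fInf) (u₀ : WL2 fInf),
      (∀ k, ContDiff ℝ 1 (b k)) → (∀ k t, HasDerivAt (a k) (b k t) t) →
      (∀ k, (u k, w k) ∈ closure (coreGraph L G M fInf)) →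
      (∀ k, inner ℝ (u k) hE.toWL2 = 0) →
      (∀ k, w k ∈ closure (Prod.fst '' coreGraph L G M fInf)) →
      u₀ ∈ closure (Prod.fst '' coreGraph L G M fInf) →
      ‖∑ k, tensor T (b k) (hE.proj (u k))‖ ≤
        K * (‖∑ k, tensor T (b k) (u k) - (tensor T 1 u₀ + ∑ k, tensor T (a k) (w k))‖ +
          ‖∑ k, tensor T (b k) (u k - hE.proj (u k))‖) := by
  obtain ⟨C, hC, hβ⟩ := exists_isDualFamily d cM hc
  -- The maximum with 1 keeps the constant positive whatever the sign of lam2.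
  set K₀ := 8 * C ^ 2 * ((d : ℝ) + 1) ^ 2 * max lam2 1 with hK₀
  have hl : 0 < max lam2 1 := lt_max_of_lt_right one_pos
  have hK₀p : 0 < K₀ := by positivity
  refine ⟨2 * Real.sqrt K₀, by positivity, ?_⟩
  intro L G M fInf T hG hM hS hSC hE n a b u w u₀ hb hab huw hu hw hu₀
  obtain ⟨β, hβ⟩ := hβ L G M fInf hM hS
  set S : STL2 T fInf := ∑ k, tensor T (b k) (hE.proj (u k)) with hSdef
  have hlin := hE.lintegral_sumDensity_sq (T := T) b u
  obtain ⟨F, D, hFD, hdiv, hbound⟩ := hSC (sumDensity b u) (measurable_sumDensity b u)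
    (by rw [hlin]; exact ENNReal.ofReal_lt_top) (hE.integral_sumDensity b u hu)
  have hB : 0 ≤ max lam2 1 * ‖S‖ ^ 2 := by positivity
  have hbound' : ∫⁻ p in slab d T, ENNReal.ofReal
        (((∑ i, F i p ^ 2) * weight G fInf p.2 + ∑ i, ∑ j, D i j p ^ 2) / density fInf p.2) ≤
      ENNReal.ofReal (max lam2 1 * ‖S‖ ^ 2) := by
    refine hbound.trans ?_
    rw [hlin, ENNReal.ofReal_mul hl.le]
    exact mul_le_mul_left (ENNReal.ofReal_le_ofReal (le_max_left _ _)) _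
  have hFm := fun j => (hFD j 0).1
  have hDm := fun i j => (hFD i j).2.1
  obtain ⟨hP, -⟩ := memLp_field_of_abs_le hE hG (aestronglyMeasurable_fluxField hβ hFm)
    (abs_fluxField_le (D := D) hE hC.le hβ) hB hbound'
  obtain ⟨hR, nR⟩ := memLp_field_of_abs_le hE hG (aestronglyMeasurable_timeField hβ hDm)
    (abs_timeField_le (F := F) hE hC.le hβ) hB hbound'
  obtain ⟨hQ, nQ⟩ := memLp_field_of_abs_le hE hG (aestronglyMeasurable_spaceField hG hM hβ hFm hDm)
    (abs_spaceField_le hE hC.le hβ) hB hbound'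
  have hsqrt : ∀ x : ℝ, 0 ≤ x → x ^ 2 ≤ 8 * C ^ 2 * ((d : ℝ) + 1) ^ 2 * (max lam2 1 * ‖S‖ ^ 2) →
      x ≤ Real.sqrt K₀ * ‖S‖ := fun x hx h => by
    refine le_of_sq_le_sq ?_ (by positivity)
    rw [mul_pow, Real.sq_sqrt hK₀p.le]; linarith
  replace nR := hsqrt _ (norm_nonneg _) nR
  replace nQ := hsqrt _ (norm_nonneg _) nQ
  set r := MemLp.toLp _ hR
  set q := MemLp.toLp _ hQ
  set g : STL2 T fInf := ∑ k, tensor T (b k) (u k) with hg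
  set e : STL2 T fInf := ∑ k, tensor T (b k) (u k - hE.proj (u k)) with he
  set s : STL2 T fInf := ∑ k, tensor T (a k) (w k) with hs
  have heq : S = g - e := by simp [hSdef, hg, he, map_sub]
  -- r and q represent ∂_t Y and the spatial part of A*Y. On local equilibria their sum acts as div
  -- F, here the density of S itself.
  have h1 : ‖S‖ ^ 2 = inner ℝ r S + inner ℝ q S := by
    rw [hE.norm_sq_sum_tensor_proj, hSdef, inner_sum, inner_sum, ← Finset.sum_add_distrib]
    refine Finset.sum_congr rfl fun k _ => ?_
    rw [inner_field_proj hE hG hM hS hc hβ hR hQ]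
    refine integral_congr_ae ?_
    filter_upwards [hdiv] with p hp
    rw [hp]
  -- Two integrations by parts: (u_k, w_k) in the closed graph moves A* from Y onto u_k, producing
  -- w_k, and b_k = a_k' then moves the time derivative onto F.
  have h2 : inner ℝ q g = -inner ℝ r s := by
    rw [hg, hs, inner_sum, inner_sum, ← Finset.sum_neg_distrib]
    refine Finset.sum_congr rfl fun k _ => ?_
    rw [inner_spaceField_eq hE hG hM hβ hFD hP hQ (hb k) (huw k)]
    exact eq_neg_of_add_eq_zero_left (inner_timeField_eq hE hβ hFD hP hR (hab k) (hw k))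
  -- A constant in time pairs to zero with ∂_t F because F vanishes at both ends; this frees the
  -- initial value in the residual.
  have h3 : inner ℝ r (tensor T 1 u₀) = 0 := by
    have := inner_timeField_eq (θ := 1) (θ' := 0) hE hβ hFD hP hR
      (fun t => hasDerivAt_const t (1 : ℝ)) hu₀
    have h0 : tensor T 0 u₀ = 0 := by
      have := IsEquilibrium.inner_tensor (T := T) 0 0 u₀ u₀
      simpa using this
    rwa [h0, inner_zero_right, zero_add] at this
  -- Writing S = g − e leaves only the residual of f = f(0) + ∫f' and the microscopic part e, each
  -- paired with a functional of size at most a multiple of ‖S‖.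
  have h4 : ‖S‖ ^ 2 = inner ℝ r (g - (tensor T 1 u₀ + s)) - inner ℝ r e - inner ℝ q e := by
    rw [h1, heq, inner_sub_right, inner_sub_right, inner_sub_right, inner_add_right, h2, h3]; ring
  set x := ‖g - (tensor T 1 u₀ + s)‖
  have i1 : inner ℝ r (g - (tensor T 1 u₀ + s)) ≤ Real.sqrt K₀ * ‖S‖ * x :=
    (real_inner_le_norm _ _).trans (mul_le_mul_of_nonneg_right nR (norm_nonneg _))
  have i2 : -inner ℝ r e ≤ Real.sqrt K₀ * ‖S‖ * ‖e‖ :=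
    (neg_le_abs _).trans ((abs_real_inner_le_norm _ _).trans
      (mul_le_mul_of_nonneg_right nR (norm_nonneg _)))
  have i3 : -inner ℝ q e ≤ Real.sqrt K₀ * ‖S‖ * ‖e‖ :=
    (neg_le_abs _).trans ((abs_real_inner_le_norm _ _).trans
      (mul_le_mul_of_nonneg_right nQ (norm_nonneg _)))
  have hx : 0 ≤ x := norm_nonneg _
  have h5 : ‖S‖ * ‖S‖ ≤ ‖S‖ * (2 * Real.sqrt K₀ * (x + ‖e‖)) := by
    have : 0 ≤ Real.sqrt K₀ * ‖S‖ * x := by positivity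
    nlinarith
  rcases (norm_nonneg S).eq_or_lt with h0 | h0
  · rw [← h0]; positivity
  · exact le_of_mul_le_mul_left h5 h0

end Kinetic

end

/-! ### Bernstein approximation in time and the averaged macroscopic bound. -/

noncomputable section

namespace Kinetic

open Filter Topology

variable {d : ℕ}

section Approximation

theorem tendsto_setIntegral_norm_sq {H : Type*} [NormedAddCommGroup H] {T : ℝ} {g : ℕ → ℝ → H} {g₀ : ℝ → H} (hg : ∀ n, Continuous (g n))
    (hg₀ : Continuous g₀) (h : TendstoUniformlyOn g g₀ atTop (Icc 0 T)) :
    Tendsto (fun n => ∫ t in Icc 0 T, ‖g n t‖ ^ 2) atTop (𝓝 (∫ t in Icc 0 T, ‖g₀ t‖ ^ 2)) := by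
  obtain ⟨C, hC⟩ := (isCompact_Icc (a := (0 : ℝ)) (b := T)).exists_bound_of_continuousOn
    hg₀.continuousOn
  refine tendsto_integral_filter_of_dominated_convergence (fun _ => (C + 1) ^ 2)
    (.of_forall fun n => ((hg n).norm.pow 2).aestronglyMeasurable) ?_
    (integrable_const _) ?_
  · filter_upwards [Metric.tendstoUniformlyOn_iff.1 h 1 one_pos] with n hn
    filter_upwards [ae_restrict_mem measurableSet_Icc] with t ht
    have h1 := hn t ht
    rw [dist_comm, dist_eq_norm] at h1
    have h2 : ‖g n t‖ ≤ C + 1 := by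
      have := norm_le_norm_add_norm_sub (g₀ t) (g n t)
      rw [norm_sub_rev] at this
      linarith [hC t ht]
    rw [Real.norm_of_nonneg (by positivity)]
    gcongr
  · filter_upwards [ae_restrict_mem measurableSet_Icc] with t ht
    exact ((h.tendsto_at ht).norm).pow 2

variable {H : Type*} [NormedAddCommGroup H] [NormedSpace ℝ H] {T : ℝ}

/-- The Bernstein polynomials of the interval `[0, T]`. -/
def bernsteinBasis (T : ℝ) (n k : ℕ) : C(ℝ, ℝ) :=
  ⟨fun t => n.choose k * (t / T) ^ k * (1 - t / T) ^ (n - k), by fun_prop⟩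

theorem contDiff_bernsteinBasis (T : ℝ) (n k : ℕ) : ContDiff ℝ 1 (bernsteinBasis T n k) := by
  simp only [bernsteinBasis, ContinuousMap.coe_mk]
  fun_prop

/-- Primitives of the Bernstein polynomials. -/
def bernsteinPrimitive (T : ℝ) (n k : ℕ) : C(ℝ, ℝ) :=
  ⟨fun t => ∫ s in (0 : ℝ)..t, bernsteinBasis T n k s,
    intervalIntegral.continuous_primitive
      (fun _ _ => (bernsteinBasis T n k).continuous.intervalIntegrable _ _) 0⟩

theorem hasDerivAt_bernsteinPrimitive (T : ℝ) (n k : ℕ) (t : ℝ) :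
    HasDerivAt (bernsteinPrimitive T n k) (bernsteinBasis T n k t) t :=
  (bernsteinBasis T n k).continuous.integral_hasStrictDerivAt 0 t |>.hasDerivAt

/-- The Bernstein approximation on `[0, T]`. -/
def bernsteinSum (T : ℝ) (f : ℝ → H) (n : ℕ) (t : ℝ) : H :=
  ∑ k : Fin (n + 1), bernsteinBasis T n k t • f (T * (k / n))

theorem continuous_bernsteinSum (f : ℝ → H) (n : ℕ) : Continuous (bernsteinSum T f n) := by
  unfold bernsteinSum; fun_prop

/-- Bernstein sums use values of f itself as coefficients. Relations that hold at each time, such as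
graph membership and zero mass, are therefore inherited by the coefficients. -/
theorem tendstoUniformlyOn_bernsteinSum (hT : 0 < T) {f : ℝ → H} (hf : Continuous f) :
    TendstoUniformlyOn (bernsteinSum T f) f atTop (Icc 0 T) := by
  set φ : C(unitInterval, H) := ⟨fun s => f (T * s), by fun_prop⟩
  have h := bernsteinApproximation_uniform φ
  rw [ContinuousMap.tendsto_iff_tendstoUniformly, Metric.tendstoUniformly_iff] at h
  rw [Metric.tendstoUniformlyOn_iff]
  intro ε hε
  filter_upwards [h ε hε] with n hn t ht
  have hs : t / T ∈ unitInterval := ⟨div_nonneg ht.1 hT.le, (div_le_one hT).2 ht.2⟩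
  have h1 := hn ⟨t / T, hs⟩
  have h2 : φ ⟨t / T, hs⟩ = f t := by
    simp only [φ, ContinuousMap.coe_mk]
    rw [mul_div_cancel₀ _ hT.ne']
  have h3 : bernsteinApproximation n φ ⟨t / T, hs⟩ = bernsteinSum T f n t := by
    rw [bernsteinApproximation.apply, bernsteinSum]
    refine Finset.sum_congr rfl fun k _ => ?_
    rw [bernstein_apply]; rfl
  rwa [h2, h3] at h1

theorem sum_primitive_smul (f : ℝ → H) (n : ℕ) (t : ℝ) [CompleteSpace H] :
    ∑ k : Fin (n + 1), bernsteinPrimitive T n k t • f (T * (k / n)) =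
      ∫ s in (0 : ℝ)..t, bernsteinSum T f n s := by
  simp only [bernsteinSum]
  rw [intervalIntegral.integral_finsetSum]
  · refine Finset.sum_congr rfl fun k _ => ?_
    rw [intervalIntegral.integral_smul_const]; rfl
  · intro k _
    exact Continuous.intervalIntegrable (by fun_prop) _ _

theorem tendstoUniformlyOn_integral_bernsteinSum [CompleteSpace H] (hT : 0 < T) {f : ℝ → H}
    (hf : Continuous f) :
    TendstoUniformlyOn (fun n t => ∫ s in (0 : ℝ)..t, bernsteinSum T f n s)
      (fun t => ∫ s in (0 : ℝ)..t, f s) atTop (Icc 0 T) := by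
  have h := tendstoUniformlyOn_bernsteinSum hT hf
  rw [Metric.tendstoUniformlyOn_iff] at h ⊢
  intro ε hε
  filter_upwards [h (ε / (2 * T)) (by positivity)] with n hn t ht
  rw [dist_eq_norm, ← intervalIntegral.integral_sub (hf.intervalIntegrable _ _)
    ((continuous_bernsteinSum f n).intervalIntegrable _ _)]
  have h1 := intervalIntegral.norm_integral_le_of_norm_le_const (a := 0) (b := t)
    (C := ε / (2 * T)) (f := fun s => f s - bernsteinSum T f n s) fun s hs => by
      rw [uIoc_of_le ht.1] at hs
      have := (hn s ⟨hs.1.le, hs.2.trans ht.2⟩).le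
      rwa [dist_eq_norm] at this
  refine h1.trans_lt ?_
  rw [sub_zero, abs_of_nonneg ht.1]
  calc ε / (2 * T) * t ≤ ε / (2 * T) * T := by gcongr; exact ht.2
    _ = ε / 2 := by field_simp
    _ < ε := by linarith

end Approximation

/-- Continuously differentiable solutions of zero mass. -/
structure IsClassicalSolution (L : Collision) (G : E d × E d → E d) (M fInf : E d × E d → ℝ)
    (f f' : ℝ → WL2 fInf) : Prop where
  hasDerivAt : ∀ t, HasDerivAt f (f' t) t
  continuous_deriv : Continuous f'
  mem : ∀ t, 0 ≤ t → (f t, f' t) ∈ closure (coreGraph L G M fInf)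
  mass : ∀ t, 0 ≤ t → ∫ z, f t z = 0

section Classical

variable {L : Collision} {G : E d × E d → E d} {M fInf : E d × E d → ℝ} {f f' : ℝ → WL2 fInf}

theorem IsClassicalSolution.continuous (h : IsClassicalSolution L G M fInf f f') : Continuous f :=
  continuous_iff_continuousAt.2 fun t => (h.hasDerivAt t).continuousAt

theorem IsClassicalSolution.mem_closure_fst (h : IsClassicalSolution L G M fInf f f') {t : ℝ}
    (ht : 0 ≤ t) : f t ∈ closure (Prod.fst '' coreGraph L G M fInf) :=
  image_closure_subset_closure_image continuous_fst ⟨_, h.mem t ht, rfl⟩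

/-- Time integration by parts is applied to f'(t), which need not lie in the domain of A. It is a
limit of difference quotients in a closed subspace; slopes from the right are used because
membership is known only for nonnegative times. -/
theorem IsClassicalSolution.deriv_mem_closure_fst (h : IsClassicalSolution L G M fInf f f')
    (hG : ContDiff ℝ ∞ G) (hM : IsBackground L M) {t : ℝ} (ht : 0 ≤ t) :
    f' t ∈ closure (Prod.fst '' coreGraph L G M fInf) := by
  set V := ((coreSubmodule hG hM fInf).map (LinearMap.fst ℝ _ _)).topologicalClosure with hV
  have hVc : (V : Set (WL2 fInf)) = closure (Prod.fst '' coreGraph L G M fInf) := by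
    rw [hV, Submodule.topologicalClosure_coe]; rfl
  have hmem : ∀ s, 0 ≤ s → f s ∈ V := fun s hs => by
    rw [← SetLike.mem_coe, hVc]; exact h.mem_closure_fst hs
  have h1 := (hasDerivWithinAt_iff_tendsto_slope' (s := Ioi t) (by simp)).1
    (h.hasDerivAt t).hasDerivWithinAt
  rw [← hVc]
  refine (hVc ▸ isClosed_closure : IsClosed (V : Set (WL2 fInf))).mem_of_tendsto h1 ?_
  filter_upwards [self_mem_nhdsWithin] with s hs
  rw [slope, vsub_eq_sub]
  exact V.smul_mem _ (V.sub_mem (hmem s (ht.trans (le_of_lt hs))) (hmem t ht))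

theorem IsClassicalSolution.shift (h : IsClassicalSolution L G M fInf f f') {s : ℝ} (hs : 0 ≤ s) :
    IsClassicalSolution L G M fInf (fun t => f (t + s)) (fun t => f' (t + s)) where
  hasDerivAt t := (h.hasDerivAt (t + s)).comp_add_const t s
  continuous_deriv := h.continuous_deriv.comp (by fun_prop)
  mem t ht := h.mem _ (by linarith)
  mass t ht := h.mass _ (by linarith)

end Classical

/-- The time-averaged macroscopic part is controlled by the microscopic part. -/
theorem exists_averaged_bound (d : ℕ) (cM lam2 : ℝ) {cInf : ℝ} (hc : 0 < cInf) :
    ∃ K : ℝ, 0 < K ∧ ∀ (L : Collision) (G : E d × E d → E d) (M fInf : E d × E d → ℝ) (T : ℝ),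
      0 < T → ContDiff ℝ ∞ G → IsBackground L M → IsStationaryState L G M fInf cInf cM →
      SpatialCoercivity G fInf T lam2 → ∀ (hE : IsEquilibrium fInf) (f f' : ℝ → WL2 fInf),
      IsClassicalSolution L G M fInf f f' →
      ∫ t in Icc 0 T, ‖hE.proj (f t)‖ ^ 2 ≤ K * ∫ t in Icc 0 T, ‖f t - hE.proj (f t)‖ ^ 2 := by
  obtain ⟨K, hK, hbound⟩ := exists_macroscopic_bound d cM lam2 hc
  -- From (K(x + y))² ≤ 2K²(x² + y²).
  refine ⟨2 * K ^ 2, by positivity, ?_⟩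
  intro L G M fInf T hT hG hM hS hSC hE f f' hf
  have hfc := hf.continuous
  -- The nodes are nonnegative even for n = 0, where k/n is 0 by convention.
  have hpt : ∀ n (k : Fin (n + 1)), 0 ≤ T * ((k : ℕ) / n : ℝ) := fun n k => by positivity
  have hn : ∀ n : ℕ, ∫ t in Icc 0 T, ‖hE.proj (bernsteinSum T f n t)‖ ^ 2 ≤
      2 * K ^ 2 * ((∫ t in Icc 0 T, ‖bernsteinSum T f n t -
        (f 0 + ∫ s in (0 : ℝ)..t, bernsteinSum T f' n s)‖ ^ 2) +
        ∫ t in Icc 0 T, ‖bernsteinSum T f n t - hE.proj (bernsteinSum T f n t)‖ ^ 2) := fun n => by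
    have h := hbound L G M fInf T hG hM hS hSC hE (n + 1) (fun k => bernsteinPrimitive T n k)
      (fun k => bernsteinBasis T n k) (fun k => f (T * ((k : ℕ) / n)))
      (fun k => f' (T * ((k : ℕ) / n))) (f 0) (fun k => contDiff_bernsteinBasis T n k)
      (fun k => hasDerivAt_bernsteinPrimitive T n k) (fun k => hf.mem _ (hpt n k))
      (fun k => by rw [hE.inner_toWL2]; exact hf.mass _ (hpt n k))
      (fun k => hf.deriv_mem_closure_fst hG hM (hpt n k)) (hf.mem_closure_fst le_rfl)
    have e1 := IsEquilibrium.norm_sq_sum_tensor (T := T) (fun k : Fin (n + 1) => bernsteinBasis T n k)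
      (fun k => hE.proj (f (T * ((k : ℕ) / n))))
    have e2 := IsEquilibrium.norm_sq_sum_tensor (T := T) (fun k : Fin (n + 1) => bernsteinBasis T n k)
      (fun k => f (T * ((k : ℕ) / n)) - hE.proj (f (T * ((k : ℕ) / n))))
    -- The residual is written as one finite sum over a disjoint union of index sets, with signs put
    -- into the vectors, so that its norm is again a time integral.
    have e3 := IsEquilibrium.norm_sq_sum_tensor (T := T)
      (Sum.elim (fun k : Fin (n + 1) => bernsteinBasis T n k)
        (Sum.elim (fun _ : Unit => 1) fun k : Fin (n + 1) => bernsteinPrimitive T n k))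
      (Sum.elim (fun k => f (T * ((k : ℕ) / n)))
        (Sum.elim (fun _ => -f 0) fun k => -f' (T * ((k : ℕ) / n))))
    simp only [Fintype.sum_sum_type, Sum.elim_inl, Sum.elim_inr, Finset.univ_unique,
      Finset.sum_singleton, map_neg, smul_neg, Finset.sum_neg_distrib,
      ← sub_eq_add_neg, ContinuousMap.one_apply, one_smul] at e3
    simp only [← neg_add', ← sub_eq_add_neg] at e3
    have e3' : ∀ t, ∑ k : Fin (n + 1), bernsteinPrimitive T n k t • f' (T * ((k : ℕ) / n)) =
      ∫ s in (0 : ℝ)..t, bernsteinSum T f' n s := fun t => sum_primitive_smul f' n t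
    have e1' : ∀ t, ∑ k : Fin (n + 1), bernsteinBasis T n k t • hE.proj (f (T * ((k : ℕ) / n))) =
      hE.proj (bernsteinSum T f n t) := fun t => by simp [bernsteinSum]
    have e2' : ∀ t, ∑ k : Fin (n + 1), bernsteinBasis T n k t • (f (T * ((k : ℕ) / n)) -
      hE.proj (f (T * ((k : ℕ) / n)))) =
      bernsteinSum T f n t - hE.proj (bernsteinSum T f n t) := fun t => by
      simp [bernsteinSum, smul_sub]
    simp only [e3'] at e3
    simp only [e1'] at e1
    simp only [e2'] at e2
    rw [← e1, ← e2]
    refine le_trans ?_ (mul_le_mul_of_nonneg_left (add_le_add_left (le_of_eq e3) _)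
      (by positivity : 0 ≤ 2 * K ^ 2))
    refine (pow_le_pow_left₀ (norm_nonneg _) h 2).trans ?_
    rw [mul_pow]
    nlinarith [add_sq_le (a := ‖∑ k : Fin (n + 1), IsEquilibrium.tensor T (bernsteinBasis T n k)
      (f (T * ((k : ℕ) / n))) - (IsEquilibrium.tensor T 1 (f 0) +
      ∑ k : Fin (n + 1), IsEquilibrium.tensor T (bernsteinPrimitive T n k)
        (f' (T * ((k : ℕ) / n))))‖) (b := ‖∑ k : Fin (n + 1),
      IsEquilibrium.tensor T (bernsteinBasis T n k) (f (T * ((k : ℕ) / n)) -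
      hE.proj (f (T * ((k : ℕ) / n))))‖), sq_nonneg K]
  have hu := tendstoUniformlyOn_bernsteinSum hT hfc
  have hu' := tendstoUniformlyOn_integral_bernsteinSum hT hf.continuous_deriv
  have t1 := tendsto_setIntegral_norm_sq (g := fun n t => hE.proj (bernsteinSum T f n t))
    (g₀ := fun t => hE.proj (f t)) (fun n => by have := continuous_bernsteinSum (T := T) f n; fun_prop)
    (by fun_prop) (hE.proj.uniformContinuous.comp_tendstoUniformlyOn hu)
  have t2 := tendsto_setIntegral_norm_sq
    (g := fun n t => bernsteinSum T f n t - hE.proj (bernsteinSum T f n t))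
    (g₀ := fun t => f t - hE.proj (f t)) (fun n => by
      have := continuous_bernsteinSum (T := T) f n; fun_prop)
    (by fun_prop) (hu.sub (hE.proj.uniformContinuous.comp_tendstoUniformlyOn hu))
  -- By the fundamental theorem of calculus the residual tends to zero, so only the microscopic term
  -- survives the limit.
  have hftc : ∀ t, f 0 + ∫ s in (0 : ℝ)..t, f' s = f t := fun t => by
    rw [intervalIntegral.integral_eq_sub_of_hasDerivAt (fun s _ => hf.hasDerivAt s)
      (hf.continuous_deriv.intervalIntegrable _ _)]
    abel
  have t3 := tendsto_setIntegral_norm_sq (T := T)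
    (g := fun n t => bernsteinSum T f n t - (f 0 + ∫ s in (0 : ℝ)..t, bernsteinSum T f' n s))
    (g₀ := fun t => f t - (f 0 + ∫ s in (0 : ℝ)..t, f' s)) (fun n => by
      have h1 := continuous_bernsteinSum (T := T) f n
      have h2 : Continuous fun t => ∫ s in (0 : ℝ)..t, bernsteinSum T f' n s :=
        intervalIntegral.continuous_primitive
          (fun _ _ => (continuous_bernsteinSum f' n).intervalIntegrable _ _) 0
      fun_prop)
    (by simp only [hftc]; fun_prop) (hu.sub (.add (fun _ hu => .of_forall
      fun _ _ _ => refl_mem_uniformity hu) hu'))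
  simp only [hftc, sub_self, norm_zero, ne_eq, OfNat.ofNat_ne_zero, not_false_eq_true, zero_pow,
    integral_zero] at t3
  have := le_of_tendsto_of_tendsto' t1 ((t3.add t2).const_mul (2 * K ^ 2)) hn
  rwa [zero_add] at this

end Kinetic

end

/-! ### Exponential decay for classical solutions, and time averages of mild solutions. -/

noncomputable section

namespace Kinetic

open Filter Topology

variable {d : ℕ}

/-- Iterate n = ⌊t/T⌋ times and use monotonicity on the remaining fraction of a period; q^n ≤ q^(t/T
− 1) costs the factor q⁻¹. -/
theorem exp_decay_of_contraction {N : ℝ → ℝ} {T q : ℝ} (hT : 0 < T) (hq : 0 < q) (hq1 : q < 1)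
    (hN : AntitoneOn N (Ici 0)) (h0 : 0 ≤ N 0) (hstep : ∀ s, 0 ≤ s → N (s + T) ≤ q * N s)
    {t : ℝ} (ht : 0 ≤ t) : N t ≤ q⁻¹ * Real.exp (Real.log q / T * t) * N 0 := by
  have h1 : ∀ n : ℕ, N (n * T) ≤ q ^ n * N 0 := fun n => by
    induction n with
    | zero => simp
    | succ n ih =>
      have := hstep (n * T) (by positivity)
      rw [Nat.cast_add_one, add_mul, one_mul, pow_succ]
      nlinarith
  set n := ⌊t / T⌋₊ with hn
  have h2 : (n : ℝ) * T ≤ t := by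
    rw [← le_div_iff₀ hT]; exact Nat.floor_le (by positivity)
  have h3 : t / T - 1 ≤ n := by linarith [Nat.lt_floor_add_one (t / T)]
  have h4 : q ^ n ≤ q⁻¹ * Real.exp (Real.log q / T * t) := by
    rw [← Real.rpow_natCast, Real.rpow_def_of_pos hq]
    nth_rewrite 2 [← Real.exp_log hq]
    rw [← Real.exp_neg, ← Real.exp_add, Real.exp_le_exp]
    have hl : Real.log q ≤ 0 := Real.log_nonpos hq.le hq1.le
    have : Real.log q / T * t = Real.log q * (t / T) := by ring
    rw [this]
    nlinarith
  calc N t ≤ N (n * T) := hN (mem_Ici.2 (by positivity)) (mem_Ici.2 ht) h2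
    _ ≤ q ^ n * N 0 := h1 n
    _ ≤ _ := mul_le_mul_of_nonneg_right h4 h0

section Classical

variable {L : Collision} {G : E d × E d → E d} {M fInf : E d × E d → ℝ} {f f' : ℝ → WL2 fInf}

theorem IsClassicalSolution.hasDerivAt_norm_sq (h : IsClassicalSolution L G M fInf f f') (t : ℝ) :
    HasDerivAt (fun t => ‖f t‖ ^ 2) (2 * inner ℝ (f t) (f' t)) t :=
  (h.hasDerivAt t).norm_sq

theorem IsClassicalSolution.antitoneOn (h : IsClassicalSolution L G M fInf f f')
    (hle : ∀ t, 0 ≤ t → inner ℝ (f t) (f' t) ≤ 0) : AntitoneOn (fun t => ‖f t‖ ^ 2) (Ici 0) := by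
  refine antitoneOn_of_deriv_nonpos (convex_Ici 0) (fun t _ =>
    (h.hasDerivAt_norm_sq t).continuousAt.continuousWithinAt) (fun t _ =>
    (h.hasDerivAt_norm_sq t).differentiableAt.differentiableWithinAt) fun t ht => ?_
  rw [interior_Ici] at ht
  rw [(h.hasDerivAt_norm_sq t).deriv]
  linarith [hle t (le_of_lt ht)]

end Classical

/-- Exponential decay of classical solutions. -/
theorem exists_classical_decay (d : ℕ) (L : Collision) {cInf lam1 T : ℝ} (cM lam2 : ℝ)
    (hc : 0 < cInf) (hlam1 : 0 < lam1) (hT : 0 < T) :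
    ∃ lam C : ℝ, 0 < lam ∧ 0 < C ∧
      ∀ (G : E d × E d → E d) (M fInf : E d × E d → ℝ), ContDiff ℝ ∞ G → IsBackground L M →
      IsStationaryState L G M fInf cInf cM → LocalCoercivity L M fInf lam1 →
      SpatialCoercivity G fInf T lam2 → ∀ f f' : ℝ → WL2 fInf,
      IsClassicalSolution L G M fInf f f' →
      ∀ t, 0 ≤ t → ‖f t‖ ≤ C * Real.exp (-lam * t) * ‖f 0‖ := by
  obtain ⟨K, hK, hbound⟩ := exists_averaged_bound d cM lam2 hc
  -- Chosen so that T‖f(T)‖² ≤ c(‖f(0)‖² − ‖f(T)‖²); solving for ‖f(T)‖² gives the factor q = c/(T +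
  -- c).
  set c := (1 + K) * (lam1 / 2) with hcdef
  have hc0 : 0 < c := by positivity
  set q := c / (T + c) with hq
  have hq0 : 0 < q := by positivity
  have hq1 : q < 1 := (div_lt_one (by positivity)).2 (by linarith)
  have hlog : Real.log q < 0 := Real.log_neg hq0 hq1
  -- The 2 appears because the contraction is for the squared norm.
  refine ⟨-Real.log q / (2 * T), q⁻¹, div_pos (by linarith) (by positivity), by positivity, ?_⟩
  intro G M fInf hG hM hS hLC hSC f f' hf t ht
  have hE := hS.isEquilibrium hc
  have hdiss : ∀ {f f' : ℝ → WL2 fInf}, IsClassicalSolution L G M fInf f f' → ∀ t, 0 ≤ t →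
      2 * inner ℝ (f t) (f' t) ≤ -(2 / lam1) * ‖f t - hE.proj (f t)‖ ^ 2 := fun {f f'} hf t ht => by
    have h := hE.coercive hG hM hS hc hLC (hf.mem t ht)
    simp only at h
    rw [neg_mul, le_neg, div_mul_eq_mul_div, div_le_iff₀ hlam1]
    linarith
  have hanti : ∀ {f f' : ℝ → WL2 fInf}, IsClassicalSolution L G M fInf f f' →
      AntitoneOn (fun t => ‖f t‖ ^ 2) (Ici 0) := fun {f f'} hf => hf.antitoneOn fun t ht => by
    have h1 := hdiss hf t ht
    have h2 : 0 ≤ 2 / lam1 * ‖f t - hE.proj (f t)‖ ^ 2 := by positivity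
    linarith
  have hstep0 : ∀ {f f' : ℝ → WL2 fInf}, IsClassicalSolution L G M fInf f f' →
      ‖f T‖ ^ 2 ≤ q * ‖f 0‖ ^ 2 := fun {f f'} hf => by
    have hfc := hf.continuous
    have hfc' := hf.continuous_deriv
    have hav := hbound L G M fInf T hT hG hM hS hSC hE f f' hf
    set X := ∫ t in Icc 0 T, ‖f t - hE.proj (f t)‖ ^ 2 with hX
    have iX : IntegrableOn (fun t => ‖f t - hE.proj (f t)‖ ^ 2) (Icc 0 T) :=
      Continuous.integrableOn_Icc (by fun_prop)
    have iP : IntegrableOn (fun t => ‖hE.proj (f t)‖ ^ 2) (Icc 0 T) :=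
      Continuous.integrableOn_Icc (by fun_prop)
    -- The norm is nonincreasing, so its final value is its minimum on [0, T].
    have h1 : T * ‖f T‖ ^ 2 ≤ ∫ t in Icc 0 T, ‖f t‖ ^ 2 := by
      have hconst : ∫ _ in Icc 0 T, ‖f T‖ ^ 2 = T * ‖f T‖ ^ 2 := by
        simp [hT.le]
      rw [← hconst]
      refine setIntegral_mono_on (integrable_const _)
        (Continuous.integrableOn_Icc (by fun_prop)) measurableSet_Icc fun t ht => ?_
      exact hanti hf (mem_Ici.2 ht.1) (mem_Ici.2 hT.le) ht.2
    have h2 : ∫ t in Icc 0 T, ‖f t‖ ^ 2 = X + ∫ t in Icc 0 T, ‖hE.proj (f t)‖ ^ 2 := by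
      rw [hX, ← integral_add iX iP]
      refine integral_congr_ae (.of_forall fun t => ?_)
      simp only [hE.norm_sq_sub_proj]; ring
    have h3 : ‖f T‖ ^ 2 - ‖f 0‖ ^ 2 ≤ -(2 / lam1) * X := by
      rw [← intervalIntegral.integral_eq_sub_of_hasDerivAt
        (fun s _ => hf.hasDerivAt_norm_sq s) (Continuous.intervalIntegrable (by fun_prop) _ _),
        intervalIntegral.integral_of_le hT.le, ← integral_Icc_eq_integral_Ioc, hX,
        ← integral_const_mul]
      exact setIntegral_mono_on (Continuous.integrableOn_Icc (by fun_prop))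
        (iX.const_mul _) measurableSet_Icc fun t ht => hdiss hf t ht.1
    have h4 : X ≤ lam1 / 2 * (‖f 0‖ ^ 2 - ‖f T‖ ^ 2) := by
      have : 2 / lam1 * X ≤ ‖f 0‖ ^ 2 - ‖f T‖ ^ 2 := by linarith
      calc X = lam1 / 2 * (2 / lam1 * X) := by field_simp
        _ ≤ _ := mul_le_mul_of_nonneg_left this (by positivity)
    have h5 : T * ‖f T‖ ^ 2 ≤ c * (‖f 0‖ ^ 2 - ‖f T‖ ^ 2) := by
      calc T * ‖f T‖ ^ 2 ≤ (1 + K) * X := by linarith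
        _ ≤ (1 + K) * (lam1 / 2 * (‖f 0‖ ^ 2 - ‖f T‖ ^ 2)) :=
          mul_le_mul_of_nonneg_left h4 (by positivity)
        _ = _ := by rw [hcdef]; ring
    rw [hq, div_mul_eq_mul_div, le_div_iff₀ (by positivity)]
    linarith
  -- The equation is autonomous, so the one-period estimate may start at any time s.
  have hstep : ∀ s, 0 ≤ s → ‖f (s + T)‖ ^ 2 ≤ q * ‖f s‖ ^ 2 := fun s hs => by
    have := hstep0 (hf.shift hs)
    rwa [zero_add, add_comm T s] at this
  have hdecay := exp_decay_of_contraction hT hq0 hq1 (hanti hf) (sq_nonneg _) hstep ht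
  refine le_of_sq_le_sq (hdecay.trans ?_) (by positivity)
  have hexp : Real.exp (Real.log q / T * t) = Real.exp (-(-Real.log q / (2 * T)) * t) ^ 2 := by
    rw [← Real.exp_nat_mul]
    congr 1
    push_cast
    field_simp
  rw [hexp, mul_pow, mul_pow]
  -- Using q⁻¹ as the constant, in place of its square root, is harmless because q < 1.
  have : q⁻¹ ≤ q⁻¹ ^ 2 := le_self_pow₀ ((one_le_inv₀ hq0).2 hq1.le) (by norm_num)
  gcongr

section Mild

variable {L : Collision} {G : E d × E d → E d} {M fInf : E d × E d → ℝ} {fIn : WL2 fInf}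
  {f : ℝ → WL2 fInf}

/-- Time averages of mild solutions are classical solutions. -/
theorem IsSolution.isClassicalSolution (hf : IsSolution L G M fInf fIn f) (hE : IsEquilibrium fInf)
    (hG : ContDiff ℝ ∞ G) (hM : IsBackground L M) (hmass : ∫ z, fIn z = 0) {ε : ℝ} (hε : 0 < ε) :
    IsClassicalSolution L G M fInf
      (fun t => ε⁻¹ • ((∫ s in (0 : ℝ)..(t + ε), f (max s 0)) - ∫ s in (0 : ℝ)..t, f (max s 0)))
      (fun t => ε⁻¹ • (f (max (t + ε) 0) - f (max t 0))) := by
  -- Freezing f at its initial value for negative times makes it continuous on the line, so the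
  -- averages are differentiable at every real time.
  have hc : Continuous fun s => f (max s 0) :=
    hf.continuousOn.comp_continuous (by fun_prop) fun s => le_max_right s 0
  have hprim : ∀ t, HasDerivAt (fun t => ∫ s in (0 : ℝ)..t, f (max s 0)) (f (max t 0)) t :=
    fun t => (hc.integral_hasStrictDerivAt 0 t).hasDerivAt
  have hmem : ∀ t, 0 ≤ t → ((∫ s in (0 : ℝ)..t, f (max s 0)), f (max t 0) - fIn) ∈
      closure (coreGraph L G M fInf) := fun t ht => by
    have h : ∫ s in (0 : ℝ)..t, f (max s 0) = ∫ s in (0 : ℝ)..t, f s :=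
      intervalIntegral.integral_congr fun s hs => by
        rw [uIcc_of_le ht] at hs
        simp only [max_eq_left hs.1]
    rw [h, max_eq_left ht]
    exact hf.mild t ht
  -- f(t) − fIn is in the range of the closed operator, which has zero mass.
  have hzero : ∀ t, inner ℝ (f (max t 0)) hE.toWL2 = 0 := fun t => by
    have := hE.mass_conservation hG hM (hf.mild (max t 0) (le_max_right _ _))
    simp only [inner_sub_left] at this
    rw [sub_eq_zero.1 this, hE.inner_toWL2, hmass]
  have hprim0 : ∀ t, inner ℝ (∫ s in (0 : ℝ)..t, f (max s 0)) hE.toWL2 = 0 := fun t => by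
    have h := (innerSL ℝ hE.toWL2).intervalIntegral_comp_comm (hc.intervalIntegrable (μ := volume) 0 t)
    simp only [innerSL_apply_apply] at h
    rw [real_inner_comm, ← h]
    simp only [fun x => (real_inner_comm (f (max x 0)) hE.toWL2).trans (hzero x),
      intervalIntegral.integral_zero]
  have hderiv : ∀ t, HasDerivAt
      (fun t => (∫ s in (0 : ℝ)..(t + ε), f (max s 0)) - ∫ s in (0 : ℝ)..t, f (max s 0))
      (f (max (t + ε) 0) - f (max t 0)) t :=
    fun t => ((hprim (t + ε)).comp_add_const t ε).sub (hprim t)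
  refine ⟨fun t => (hderiv t).const_smul ε⁻¹,
    ((hc.comp (continuous_add_const ε)).sub hc).const_smul ε⁻¹, fun t ht => ?_, fun t ht => ?_⟩
  · set V := (coreSubmodule hG hM fInf).topologicalClosure with hV
    have hVc : (V : Set (WL2 fInf × WL2 fInf)) = closure (coreGraph L G M fInf) := by
      rw [hV, Submodule.topologicalClosure_coe]; rfl
    -- Subtracting the mild relations at t + ε and t cancels fIn and shows that A maps the average
    -- to (f(t + ε) − f(t))/ε, which is its time derivative.
    have h1 := hmem (t + ε) (by positivity)
    have h2 := hmem t ht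
    rw [← hVc, SetLike.mem_coe] at h1 h2 ⊢
    have h3 := V.smul_mem ε⁻¹ (V.sub_mem h1 h2)
    rwa [Prod.mk_sub_mk, sub_sub_sub_cancel_right, Prod.smul_mk] at h3
  · rw [← hE.inner_toWL2, real_inner_smul_left, inner_sub_left, hprim0, hprim0, sub_zero, mul_zero]

/-- The average is the difference quotient of a primitive of a continuous curve, so it tends to the
curve itself; this removes the regularization. -/
theorem IsSolution.tendsto_average (hf : IsSolution L G M fInf fIn f) {t : ℝ} (ht : 0 ≤ t) :
    Tendsto (fun ε : ℝ => ε⁻¹ • ((∫ s in (0 : ℝ)..(t + ε), f (max s 0)) -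
      ∫ s in (0 : ℝ)..t, f (max s 0))) (𝓝[>] 0) (𝓝 (f t)) := by
  have hc : Continuous fun s => f (max s 0) :=
    hf.continuousOn.comp_continuous (by fun_prop) fun s => le_max_right s 0
  have h := (hc.integral_hasStrictDerivAt 0 t).hasDerivAt.tendsto_slope_zero_right
  simpa only [max_eq_left ht] using h

end Mild

end Kinetic

end

/-! ### Decay of mild solutions. -/

theorem theorem1 (d : ℕ) (L : Kinetic.Collision) (cInf cM lam1 lam2 T : ℝ)
    (hcInf : 0 < cInf) (hlam1 : 0 < lam1) (hT : 0 < T) :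
    ∃ lam C : ℝ, 0 < lam ∧ 0 < C ∧
      ∀ (G : Kinetic.E d × Kinetic.E d → Kinetic.E d) (M fInf : Kinetic.E d × Kinetic.E d → ℝ),
        ContDiff ℝ ∞ G →
        Kinetic.IsBackground L M →
        Kinetic.IsStationaryState L G M fInf cInf cM →
        Kinetic.LocalCoercivity L M fInf lam1 →
        Kinetic.SpatialCoercivity G fInf T lam2 →
        ∀ (fIn : Kinetic.WL2 fInf) (f : ℝ → Kinetic.WL2 fInf),
          Kinetic.IsSolution L G M fInf fIn f →
          ∫ z, fIn z = 0 →
          ∀ t : ℝ, 0 < t → ‖f t‖ ≤ C * Real.exp (-lam * t) * ‖fIn‖ := by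
  obtain ⟨lam, C, hlam, hC, h⟩ :=
    Kinetic.exists_classical_decay d L cM lam2 hcInf hlam1 hT
  refine ⟨lam, C, hlam, hC, ?_⟩
  intro G M fInf hG hM hS hLC hSC fIn f hf hmass t ht
  have hE := hS.isEquilibrium hcInf
  -- The averages decay with constants independent of ε and start from averages tending to f(0) =
  -- fIn, so the estimate survives the limit ε → 0.
  refine le_of_tendsto_of_tendsto (hf.tendsto_average ht.le).norm
    ((hf.initial ▸ hf.tendsto_average le_rfl).norm.const_mul _) ?_
  filter_upwards [self_mem_nhdsWithin] with ε hε
  exact h G M fInf hG hM hS hLC hSC _ _ (hf.isClassicalSolution hE hG hM hmass hε) t ht.le
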